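/- **Notions.** Classical algorithms are multi-tape machines with fair coin flips and, where stated, a separate oracle tape on which a query is answered in one step. $\mathrm{NTIME}[n^2]$ is the class of languages decided by nondeterministic machines of this kind in time $O(n^2)$. For $n\ge 0$ let $f$ range over the degree-2 polynomials $$f(x)=\sum_{i}\alpha_i x_i+\sum_{i>j}\beta_{i,j}x_ix_j$$ over $\mathbb F_2$ in $n$ variables; a fraction of the $f$'s refers to the uniform distribution on the coefficients $\alpha_i,\beta_{i,j}\in\{0,1\}$. A log-depth family $g=(g_n)_n$ consists of Boolean circuits $g_n:\{0,1\}^n\to\{0,1\}$ of fan-in at most $2$, depth $O(\log n)$ and polynomial size. Put $$gap(f+g_n)=\sum_{x\in\{0,1\}^n}(-1)^{f(x)+g_n(x)}.$$ **Hardness assumption** (for constants $u,v,w$, a real $a>0$ and a log-depth family $g$): Let $\mathcal A$ be any probabilistic algorithm with an oracle $O\in \mathrm{NTIME}[n^2]$ that on the inputs $(f,g_n)$ (described as bit strings) runs in time $O^*(2^{an})$, i.e. $O(\mathrm{poly}(n)\,2^{an})$, and makes only queries of length $O(2^{an})$. Then there is $n_0$ such that for every $n>n_0$ the following does not hold: for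 at least a fraction $v$ of all $n$-variable degree-2 polynomials $f$, the output $y\in\mathbb N$ of $\mathcal A$ on $(f,g_n)$ satisfies $|y-gap(f+g_n)^2|\le u\,gap(f+g_n)^2$ with probability at least $w$. **Theorem.** Let $u>0$, $0<v<1/3$ and $0<w<1$. There is a constant $\varepsilon>0$, depending only on $u,v,w$, such that for every $a>0$ and every log-depth family $g$ for which the hardness assumption holds there are quantum circuits $U_n$ on $N=n+1$ qubits (the last one being an ancilla), made of one- and two-qubit gates, with the following properties. 1. For all $n$ and $x\in\{0,1\}^n$, $U_n(|x\rangle\otimes|0\rangle)=e^{ih_n(x)}|x\rangle\otimes|g_n(x)\rangle$ for some real $h_n(x)$. 2. For a degree-2 polynomial $f$ in $n$ variables let $Q_{n,f}$ be the $N$-qubit circuit that applies, in this order, $H^{\otimes n}\otimes I$; $U_n$; $Z$ on the ancilla; $U_n^\dagger$; the gates $Z$ on the qubits $i$ with $\alpha_i=1$ and $CZ$ on the pairs $i>j$ with $\beta_{i,j}=1$; $H^{\otimes n}\otimes I$. Its size is at most polynomial in $N$. 3. Let $p_z(Q_{n,f})$ be the probability of the outcome $z\in\{0,1\}^n$ when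 $Q_{n,f}$ is applied to $|0^{N}\rangle$ and the first $n$ qubits are measured in the computational basis. These distributions cannot be classically sampled in time $O(2^{aN})$ within the additive error $\varepsilon$: for every probabilistic algorithm without oracle that on the inputs $(f,g_n)$ runs in time $O(2^{aN})$ there is $n_0$ such that for every $n>n_0$ there is an $f$ with $\sum_{z\in\{0,1\}^n}|p_z(Q_{n,f})-q_z|>\varepsilon$, where $q_z$ is the probability that the algorithm outputs $z$ on the input $(f,g_n)$. -/

import Mathlib

namespace FineGrained

open scoped Classical Matrix

/-! # Classical machines

Programs over finitely many stacks of bits (a tape is a pair of stacks, and a stack is a tape, so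
up to a constant factor in the running time these are multi-tape Turing machines), with fair coin
flips and with queries to an oracle.  When no probabilities are involved, a coin flip is read as
a nondeterministic guess. -/

/-- Programs.  Stack `0` holds the input, stack `1` the output, stack `2` is the oracle tape. -/
inductive Prog : Type
  /-- do nothing -/
  | skip : Prog
  /-- push the bit `b` on stack `i` -/
  | push (i : ℕ) (b : Bool) : Prog
  /-- remove the top bit of stack `i`, if there is one -/
  | pop (i : ℕ) : Prog
  /-- push a coin flip on stack `i` -/
  | flip (i : ℕ) : Prog
  /-- ask the oracle about the content of stack `2` and push the answer on stack `i` -/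
  | query (i : ℕ) : Prog
  /-- first `P`, then `Q` -/
  | seq (P Q : Prog) : Prog
  /-- look at the top of stack `i`: run `P` if the stack is empty, `Q` if the top bit is `false`,
  `R` if the top bit is `true` -/
  | branch (i : ℕ) (P Q R : Prog) : Prog
  /-- as long as stack `i` is not empty, run `P` -/
  | loop (i : ℕ) (P : Prog) : Prog

/-- The memory: the stacks (head = top), and the coin flips that are still to come. -/
structure Mem : Type where
  stack : ℕ → List Bool
  coins : ℕ → Bool

/-- Replace the content of stack `i` by `l`. -/
def Mem.set (m : Mem) (i : ℕ) (l : List Bool) : Mem :=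
  ⟨Function.update m.stack i l, m.coins⟩

/-- The memory at the start, on the input `x` and with the coin flips `ω`. -/
def Mem.init (x : List Bool) (ω : ℕ → Bool) : Mem :=
  ⟨Function.update (fun _ => []) 0 x, ω⟩

/-- `Exec O B P m t m'`: started in the memory `m` and with the oracle `O`, the program `P` halts
after exactly `t` steps in the memory `m'`, and all its queries have length at most `B`.
Every elementary instruction, every query and every test is one step. -/
inductive Exec (O : Set (List Bool)) (B : ℕ) : Prog → Mem → ℕ → Mem → Prop
  | skip (m : Mem) : Exec O B .skip m 1 m
  | push (i : ℕ) (b : Bool) (m : Mem) :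
      Exec O B (.push i b) m 1 (m.set i (b :: m.stack i))
  | pop (i : ℕ) (m : Mem) :
      Exec O B (.pop i) m 1 (m.set i (m.stack i).tail)
  | flip (i : ℕ) (m : Mem) :
      Exec O B (.flip i) m 1
        ⟨Function.update m.stack i (m.coins 0 :: m.stack i), fun k => m.coins (k + 1)⟩
  | query (i : ℕ) (m : Mem) (hB : (m.stack 2).length ≤ B) :
      Exec O B (.query i) m 1 (m.set i (decide (m.stack 2 ∈ O) :: m.stack i))
  | seq {P Q : Prog} {m m' m'' : Mem} {t t' : ℕ}
      (hP : Exec O B P m t m') (hQ : Exec O B Q m' t' m'') :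
      Exec O B (.seq P Q) m (t + t') m''
  | branch_empty {i : ℕ} {P Q R : Prog} {m m' : Mem} {t : ℕ}
      (h : m.stack i = []) (hP : Exec O B P m t m') :
      Exec O B (.branch i P Q R) m (t + 1) m'
  | branch_false {i : ℕ} {P Q R : Prog} {m m' : Mem} {t : ℕ} {l : List Bool}
      (h : m.stack i = false :: l) (hQ : Exec O B Q m t m') :
      Exec O B (.branch i P Q R) m (t + 1) m'
  | branch_true {i : ℕ} {P Q R : Prog} {m m' : Mem} {t : ℕ} {l : List Bool}
      (h : m.stack i = true :: l) (hR : Exec O B R m t m') :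
      Exec O B (.branch i P Q R) m (t + 1) m'
  | loop_stop {i : ℕ} {P : Prog} {m : Mem} (h : m.stack i = []) :
      Exec O B (.loop i P) m 1 m
  | loop_step {i : ℕ} {P : Prog} {m m' m'' : Mem} {t t' : ℕ}
      (h : m.stack i ≠ []) (hP : Exec O B P m t m') (hL : Exec O B (.loop i P) m' t' m'') :
      Exec O B (.loop i P) m (t + t' + 1) m''

/-- On the input `x`, whatever the coin flips, the program halts within `T` steps, and all its
queries have length at most `B`. -/
def HaltsWithin (O : Set (List Bool)) (B : ℕ) (P : Prog) (x : List Bool) (T : ℕ) : Prop :=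
  ∀ ω : ℕ → Bool, ∃ t ≤ T, ∃ m : Mem, Exec O B P (Mem.init x ω) t m

/-- On the input `x` and with the coin flips `ω`, the program halts with the output `y`. -/
def Outputs (O : Set (List Bool)) (B : ℕ) (P : Prog) (x : List Bool) (ω : ℕ → Bool)
    (y : List Bool) : Prop :=
  ∃ (t : ℕ) (m : Mem), Exec O B P (Mem.init x ω) t m ∧ m.stack 1 = y

/-- The probability, over `T` independent fair coin flips, that the output has the property `E`.
It is used only for programs that halt within `T` steps, so that they flip at most `T` coins and
the values used for the later coins do not matter. -/
noncomputable def outputProb (O : Set (List Bool)) (B : ℕ) (P : Prog) (x : List Bool) (T : ℕ)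
    (E : List Bool → Prop) : ℝ :=
  (Fintype.card {r : Fin T → Bool //
    ∃ y, E y ∧ Outputs O B P x (fun k => if h : k < T then r ⟨k, h⟩ else false) y} : ℝ) / 2 ^ T

/-- The class `NTIME[n²]`: languages decided by nondeterministic programs (the coin flips being
the guesses) in time `O(n²)` on all branches.  The empty oracle with the bound `0` on the query
length is the same as no oracle at all. -/
def NTIMESq : Set (Set (List Bool)) :=
  {L | ∃ (P : Prog) (c : ℕ), ∀ x : List Bool,
    HaltsWithin ∅ 0 P x (c * x.length ^ 2 + c) ∧
      (x ∈ L ↔ ∃ ω : ℕ → Bool, Outputs ∅ 0 P x ω [true])}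

/-! # Degree-two polynomials over the field with two elements -/

/-- The coefficients of `f(x) = ∑ i, α i * x i + ∑ i > j, β i j * x i * x j` over `𝔽₂`. -/
abbrev QuadPoly (n : ℕ) : Type := (Fin n → Bool) × ((i : Fin n) → Fin i → Bool)

/-- A bit as an element of `𝔽₂`. -/
def bit2 (b : Bool) : ZMod 2 := if b then 1 else 0

/-- The value of the polynomial at a point. -/
def QuadPoly.eval {n : ℕ} (f : QuadPoly n) (x : Fin n → Bool) : ZMod 2 :=
  ∑ i : Fin n, bit2 (f.1 i) * bit2 (x i) +
    ∑ i : Fin n, ∑ j : Fin i,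
      bit2 (f.2 i j) * bit2 (x i) * bit2 (x (Fin.castLE i.isLt.le j))

/-- The coefficients as a string of `n * (n + 1) / 2` bits. -/
def QuadPoly.encode {n : ℕ} (f : QuadPoly n) : List Bool :=
  (List.ofFn fun i : Fin n => f.1 i :: List.ofFn (f.2 i)).flatten

/-! # Boolean circuits -/

/-- A gate of fan-in at most two, whose arguments are among the first `k` wires. -/
inductive BoolGate (k : ℕ) : Type
  | const (b : Bool) : BoolGate k
  | not (i : Fin k) : BoolGate k
  | and (i j : Fin k) : BoolGate k
  | or (i j : Fin k) : BoolGate k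

/-- The value of a gate, given the values of the wires. -/
def BoolGate.eval {k : ℕ} (val : Fin k → Bool) : BoolGate k → Bool
  | .const b => b
  | .not i => !(val i)
  | .and i j => val i && val j
  | .or i j => val i || val j

/-- The depth of a gate, given the depths of the wires. -/
def BoolGate.depth {k : ℕ} (d : Fin k → ℕ) : BoolGate k → ℕ
  | .const _ => 0
  | .not i => d i + 1
  | .and i j => max (d i) (d j) + 1
  | .or i j => max (d i) (d j) + 1

/-- The number `i` in unary, with an end marker. -/
def unary (i : ℕ) : List Bool := List.replicate i true ++ [false]

/-- A gate as a bit string. -/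
def BoolGate.encode {k : ℕ} : BoolGate k → List Bool
  | .const b => [false, false, b]
  | .not i => [false, true] ++ unary i
  | .and i j => [true, false] ++ unary i ++ unary j
  | .or i j => [true, true] ++ unary i ++ unary j

/-- Sequences of `m` gates in topological order.  Wires `0, …, n - 1` are the inputs, and wire
`n + k` carries the output of gate `k`. -/
inductive BoolGates (n : ℕ) : ℕ → Type
  | nil : BoolGates n 0
  | snoc {m : ℕ} (G : BoolGates n m) (γ : BoolGate (n + m)) : BoolGates n (m + 1)

/-- The values of all wires on the input `x`. -/
def BoolGates.eval {n : ℕ} (x : Fin n → Bool) : {m : ℕ} → BoolGates n m → Fin (n + m) → Bool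
  | _, .nil => x
  | _, .snoc G γ => Fin.snoc (α := fun _ => Bool) (G.eval x) (γ.eval (G.eval x))

/-- The depths of all wires. -/
def BoolGates.depth {n : ℕ} : {m : ℕ} → BoolGates n m → Fin (n + m) → ℕ
  | _, .nil => fun _ => 0
  | _, .snoc G γ => Fin.snoc (α := fun _ => ℕ) G.depth (γ.depth G.depth)

/-- A sequence of gates as a bit string. -/
def BoolGates.encode {n : ℕ} : {m : ℕ} → BoolGates n m → List Bool
  | _, .nil => []
  | _, .snoc G γ => G.encode ++ true :: γ.encode

/-- Boolean circuits with `n` inputs and one output. -/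
structure BoolCircuit (n : ℕ) : Type where
  size : ℕ
  gates : BoolGates n size
  out : Fin (n + size)

/-- The function computed by a circuit. -/
def BoolCircuit.eval {n : ℕ} (g : BoolCircuit n) (x : Fin n → Bool) : Bool :=
  g.gates.eval x g.out

/-- The depth of a circuit. -/
def BoolCircuit.depth {n : ℕ} (g : BoolCircuit n) : ℕ := g.gates.depth g.out

/-- The description of a circuit as a bit string. -/
def BoolCircuit.encode {n : ℕ} (g : BoolCircuit n) : List Bool :=
  g.gates.encode ++ false :: unary g.out

/-- A family of log-depth circuits: depth `O(log n)` (and polynomial size). -/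
def IsLogDepth (g : ∀ n, BoolCircuit n) : Prop :=
  ∃ c : ℕ, ∀ n : ℕ, (g n).depth ≤ c * Nat.log 2 n + c ∧ (g n).size ≤ c * n ^ c + c

/-- The description of the pair `(f, g)`, the input of the classical algorithms. -/
def encodeInput {n : ℕ} (f : QuadPoly n) (g : BoolCircuit n) : List Bool :=
  unary n ++ f.encode ++ g.encode

/-! # The hardness assumption -/

/-- `gap(f + g) = ∑ x, (-1) ^ (f(x) + g(x))`. -/
def gap {n : ℕ} (f : QuadPoly n) (g : BoolCircuit n) : ℤ :=
  ∑ x : Fin n → Bool, (-1) ^ (f.eval x + bit2 (g.eval x)).val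

/-- The natural number with the binary digits `l`, least significant digit first. -/
def decodeNat (l : List Bool) : ℕ := Nat.ofDigits 2 (l.map Bool.toNat)

/-- The probability that the output is within the multiplicative error `u` of `gap(f + g)²`. -/
noncomputable def gapSuccess (O : Set (List Bool)) (B : ℕ) (P : Prog) (T : ℕ) (u : ℝ) {n : ℕ}
    (f : QuadPoly n) (g : BoolCircuit n) : ℝ :=
  outputProb O B P (encodeInput f g) T fun y =>
    |(decodeNat y : ℝ) - (gap f g : ℝ) ^ 2| ≤ u * (gap f g : ℝ) ^ 2

/-- Average-case hardness of `gap(f + g)²`: no probabilistic `O*(2^{an})`-time algorithm that makes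
queries of length `O(2^{an})` to an `NTIME[n²]` oracle computes `gap(f + g n)²`, within the
multiplicative error `u` and with success probability at least `w`, for at least a fraction `v` of
all `n`-variable degree-two polynomials `f`, for any large enough `n`. -/
def GapHard (u v w a : ℝ) (g : ∀ n, BoolCircuit n) : Prop :=
  ∀ O ∈ NTIMESq, ∀ (P : Prog) (T B : ℕ → ℕ),
    (∃ (C : ℝ) (k : ℕ), ∀ n : ℕ, (T n : ℝ) ≤ C * ((n : ℝ) + 1) ^ k * (2 : ℝ) ^ (a * n)) →
    (∃ D : ℝ, ∀ n : ℕ, (B n : ℝ) ≤ D * (2 : ℝ) ^ (a * n)) →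
    (∀ (n : ℕ) (f : QuadPoly n), HaltsWithin O (B n) P (encodeInput f (g n)) (T n)) →
    ∃ n₀ : ℕ, ∀ n > n₀,
      ¬ (v * (Fintype.card (QuadPoly n) : ℝ) ≤
          (Fintype.card {f : QuadPoly n // w ≤ gapSuccess O (B n) P (T n) u f (g n)} : ℝ))

/-! # Quantum circuits -/

/-- State vectors of `N` qubits, by their coordinates in the computational basis. -/
abbrev QState (N : ℕ) : Type := (Fin N → Bool) → ℂ

/-- The basis vector `|x⟩`. -/
noncomputable def ket {N : ℕ} (x : Fin N → Bool) : QState N := fun y => if y = x then 1 else 0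

/-- Arbitrary one- and two-qubit unitary gates. -/
inductive QGate (N : ℕ) : Type
  | one (p : Fin N) (M : Matrix.unitaryGroup Bool ℂ) : QGate N
  | two (p q : Fin N) (hpq : p ≠ q) (M : Matrix.unitaryGroup (Bool × Bool) ℂ) : QGate N

/-- The action of a gate on a state vector. -/
noncomputable def QGate.apply {N : ℕ} : QGate N → QState N → QState N
  | .one p M, ψ => fun x => ∑ b : Bool, M.1 (x p) b * ψ (Function.update x p b)
  | .two p q _ M, ψ => fun x => ∑ b : Bool, ∑ c : Bool,
      M.1 (x p, x q) (b, c) * ψ (Function.update (Function.update x p b) q c)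

/-- The inverse gate. -/
noncomputable def QGate.inv {N : ℕ} : QGate N → QGate N
  | .one p M => .one p M⁻¹
  | .two p q hpq M => .two p q hpq M⁻¹

/-- A circuit is a list of gates, the first one being applied first; its size is the length. -/
abbrev QCircuit (N : ℕ) : Type := List (QGate N)

/-- The action of a circuit on a state vector. -/
noncomputable def QCircuit.apply {N : ℕ} (C : QCircuit N) (ψ : QState N) : QState N :=
  C.foldl (fun φ γ => γ.apply φ) ψ

/-- The inverse circuit. -/
noncomputable def QCircuit.inv {N : ℕ} (C : QCircuit N) : QCircuit N :=
  (C.map QGate.inv).reverse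

/-- The Hadamard matrix. -/
noncomputable def hadamard : Matrix.unitaryGroup Bool ℂ :=
  ⟨Matrix.of fun b c => ((if b && c then -1 else 1) / (Real.sqrt 2 : ℝ) : ℂ), by
    have h : ((Real.sqrt 2 : ℝ) : ℂ) * ((Real.sqrt 2 : ℝ) : ℂ) = 2 := by
      rw [← Complex.ofReal_mul, Real.mul_self_sqrt (by norm_num)]; norm_num
    have h0 : ((Real.sqrt 2 : ℝ) : ℂ) ≠ 0 := by
      intro h0; rw [h0] at h; norm_num at h
    rw [Matrix.mem_unitaryGroup_iff]
    ext b c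
    cases b <;> cases c <;>
      simp [Matrix.mul_apply, Matrix.star_apply] <;> field_simp <;>
      first | linear_combination -h | norm_num⟩

/-- The Pauli matrix `Z`. -/
noncomputable def pauliZ : Matrix.unitaryGroup Bool ℂ :=
  ⟨Matrix.diagonal fun b => if b then -1 else 1, by
    rw [Matrix.mem_unitaryGroup_iff, Matrix.star_eq_conjTranspose, Matrix.diagonal_conjTranspose,
      Matrix.diagonal_mul_diagonal, ← Matrix.diagonal_one]
    congr 1
    ext b
    cases b <;> simp⟩

/-- The controlled `Z` matrix. -/
noncomputable def controlledZ : Matrix.unitaryGroup (Bool × Bool) ℂ :=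
  ⟨Matrix.diagonal fun b => if b.1 && b.2 then -1 else 1, by
    rw [Matrix.mem_unitaryGroup_iff, Matrix.star_eq_conjTranspose, Matrix.diagonal_conjTranspose,
      Matrix.diagonal_mul_diagonal, ← Matrix.diagonal_one]
    congr 1
    ext ⟨b, c⟩
    cases b <;> cases c <;> simp⟩

/-- `H^{⊗n} ⊗ I` on `n + 1` qubits. -/
noncomputable def hadamardLayer (n : ℕ) : QCircuit (n + 1) :=
  List.ofFn fun i : Fin n => .one i.castSucc hadamard

/-- The `Z` and `CZ` gates that correspond to the terms of `f`, on the first `n` of `n + 1`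
qubits. -/
noncomputable def phaseLayer {n : ℕ} (f : QuadPoly n) : QCircuit (n + 1) :=
  (List.ofFn fun i : Fin n =>
    (if f.1 i then [QGate.one i.castSucc pauliZ] else []) ++
      (List.ofFn fun j : Fin i =>
        if f.2 i j then
          [QGate.two i.castSucc (Fin.castLE i.isLt.le j).castSucc
            (by intro h; have := congrArg Fin.val h; simp at this; omega) controlledZ]
        else []).flatten).flatten

/-- The circuit `U` on `n + 1` qubits computes `g` reversibly with one ancilla, up to phases:
`U |x⟩|0⟩ = e^{i θ(x)} |x⟩|g(x)⟩`. -/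
def ComputesReversibly {n : ℕ} (U : QCircuit (n + 1)) (g : BoolCircuit n) : Prop :=
  ∀ x : Fin n → Bool, ∃ θ : ℝ,
    U.apply (ket (Fin.snoc (α := fun _ => Bool) x false)) =
      fun y => Complex.exp (θ * Complex.I) *
        ket (Fin.snoc (α := fun _ => Bool) x (g.eval x)) y

/-- The IQP circuit of `f` combined with the reversible circuit `U`: Hadamard gates, then `U`, `Z` on
the ancilla and `U†`, then the `Z` and `CZ` gates of `f`, and Hadamard gates again. -/
noncomputable def iqpWith {n : ℕ} (f : QuadPoly n) (U : QCircuit (n + 1)) : QCircuit (n + 1) :=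
  hadamardLayer n ++ U ++ [.one (Fin.last n) pauliZ] ++ U.inv ++ phaseLayer f ++ hadamardLayer n

/-- The probability of the outcome `z` if the circuit is applied to `|0⟩` and the first `n` qubits
are measured in the computational basis. -/
noncomputable def outcomeProb {n : ℕ} (Q : QCircuit (n + 1)) (z : Fin n → Bool) : ℝ :=
  ∑ b : Bool, Complex.normSq (Q.apply (ket fun _ => false) (Fin.snoc (α := fun _ => Bool) z b))

/-! # Hardness of sampling -/

/-- The probability that a classical program outputs the string `z` on the input `(f, g)`. -/
noncomputable def sampleProb (S : Prog) (T : ℕ) {n : ℕ} (f : QuadPoly n) (g : BoolCircuit n)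
    (z : Fin n → Bool) : ℝ :=
  outputProb ∅ 0 S (encodeInput f g) T fun y => y = List.ofFn z

/-- No probabilistic `O(2^{aN})`-time algorithm, `N = n + 1`, that is given `(f, g n)`, samples the
outcomes of the circuits `Q n f` within the additive error `ε`: for all large enough `n` it fails
for some `f`. -/
def SamplingHard (a ε : ℝ) (g : ∀ n, BoolCircuit n)
    (Q : ∀ n, QuadPoly n → QCircuit (n + 1)) : Prop :=
  ∀ (S : Prog) (T : ℕ → ℕ),
    (∃ C : ℝ, ∀ n : ℕ, (T n : ℝ) ≤ C * (2 : ℝ) ^ (a * ((n : ℝ) + 1))) →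
    (∀ (n : ℕ) (f : QuadPoly n), HaltsWithin ∅ 0 S (encodeInput f (g n)) (T n)) →
    ∃ n₀ : ℕ, ∀ n > n₀, ∃ f : QuadPoly n,
      ¬ (∑ z : Fin n → Bool, |outcomeProb (Q n f) z - sampleProb S (T n) f (g n) z| ≤ ε)

end FineGrained

open FineGrained

namespace FineGrained

open scoped Classical

/-! # Execution of programs -/

variable {O : Set (List Bool)} {B : ℕ}

/-! Suppose that a sampler `S` is within `ε` for every `f`, at some large `n`. In the circuit of `f`
the last Hadamard layer contributes the sign `(-1)^(z·x)`, so the outcome `z` has probability `gap(f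
+ z·x + g)² / 4^n` (`outcomeProb_iqpWith`). Read for the polynomial `f + z·x`, this says that the
one number `gap(f + g)² / 4^n` is the probability of `z` on that shifted input, for each of the
`2^n` strings `z`. Shifts permute the polynomials (`sum_shift`), so by Markov's inequality, for most
`f` and most `z`, the probability `q` that `S` outputs `z` on the shifted input satisfies `|2^n q -
gap² / 2^n| ≤ δ`. A bound on the total error thereby yields information about a single gap.

It remains to estimate `2^n q` up to a constant additive error, with few queries. A random Toeplitz
hash function provides `2^(n+κ)` pairwise independent coin strings (`bitAvg_hash_pair`). The number
of them that make `S` output `z` has mean `2^κ · 2^n q`, which is bounded for most `f`, and by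
Chebyshev's inequality it is accurate enough for a large constant `κ`. To count the hits, the index
is split into `ρ` bits that are written in the query and the remaining bits, which the oracle
guesses. For a large constant `ρ` two hits rarely share a prefix, so the number of prefixes with a
hit is nearly the number of hits (`pairAvg_count_le`), and `2^ρ` queries determine it. A Toeplitz
seed has length linear in the running time, hence queries of length `O(2^(an))`, and it is evaluated
in quadratic time, hence an oracle in `NTIME[n²]` (`verifier_halts`, `oracle_mem`).

The time bound of `S` need not be computable. The verifier therefore runs `S` against a unary clock
contained in the query (`clocked_halts`, `clocked_simulates`), and the estimator lengthens the clock
until the oracle denies that some coin flips exhaust it (`haltLoop_runs`). `S` enters only through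
the oracle; the estimator itself depends on the constants alone (`estimator_success`).

An additive error `2δ · 2^n` on `gap²` is a multiplicative error `u` as soon as `gap² ≥ 3η · 2^n`.
Over random `f` the second moment of the gap is `2^n` and the fourth is at most `3 · 4^n`, because
points on which all polynomials of degree two have evaluations summing to zero coincide in pairs.
The Paley–Zygmund inequality then gives a fraction `(1 - 3η)² / 3` of good `f`
(`gap_anticoncentration`), which explains the condition `v < 1/3`.

The circuits `U` use the ancilla as their only work space. As in Barrington's theorem, a conjunction
is a group commutator of two operators on the ancilla (`commutator_eq`), so a circuit of logarithmic
depth unfolds to polynomial length (`exists_addsToAncilla`). -/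

theorem Exec.det {P : Prog} {m m₁ m₂ : Mem} {t₁ t₂ : ℕ} (h₁ : Exec O B P m t₁ m₁)
    (h₂ : Exec O B P m t₂ m₂) : t₁ = t₂ ∧ m₁ = m₂ := by
  induction h₁ generalizing t₂ m₂ with
  | skip | push | pop | flip | query => cases h₂; exact ⟨rfl, rfl⟩
  | seq _ _ ihP ihQ =>
    cases h₂ with
    | seq hP hQ =>
      obtain ⟨rfl, rfl⟩ := ihP hP
      obtain ⟨rfl, rfl⟩ := ihQ hQ
      exact ⟨rfl, rfl⟩
  | branch_empty h _ ih | branch_false h _ ih | branch_true h _ ih =>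
    cases h₂ <;> rename_i h' h₂ <;>
      simp only [h, reduceCtorEq, List.cons.injEq, Bool.true_eq_false, Bool.false_eq_true,
        false_and] at h'
    obtain ⟨rfl, rfl⟩ := ih h₂
    exact ⟨rfl, rfl⟩
  | loop_stop h =>
    cases h₂ with
    | loop_stop => exact ⟨rfl, rfl⟩
    | loop_step h' => exact absurd h h'
  | loop_step h _ _ ihP ihL =>
    cases h₂ with
    | loop_stop h' => exact absurd h' h
    | loop_step h' hP hL =>
      obtain ⟨rfl, rfl⟩ := ihP hP
      obtain ⟨rfl, rfl⟩ := ihL hL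
      exact ⟨rfl, rfl⟩

/-- `P` leads from `m` to `m'` in at most `T` steps. -/
def Runs (O : Set (List Bool)) (B : ℕ) (P : Prog) (m : Mem) (T : ℕ) (m' : Mem) : Prop :=
  ∃ t ≤ T, Exec O B P m t m'

theorem Runs.mono {P : Prog} {m m' : Mem} {T T' : ℕ} (h : Runs O B P m T m') (hT : T ≤ T') :
    Runs O B P m T' m' := by
  obtain ⟨t, ht, h⟩ := h
  exact ⟨t, ht.trans hT, h⟩

theorem Runs.seq {P Q : Prog} {m m' m'' : Mem} {T T' : ℕ} (hP : Runs O B P m T m')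
    (hQ : Runs O B Q m' T' m'') : Runs O B (.seq P Q) m (T + T') m'' := by
  obtain ⟨t, ht, hP⟩ := hP
  obtain ⟨t', ht', hQ⟩ := hQ
  exact ⟨t + t', by omega, .seq hP hQ⟩

theorem Runs.loop_stop {i : ℕ} {P : Prog} {m : Mem} {T : ℕ} (hT : 1 ≤ T) (h : m.stack i = []) :
    Runs O B (.loop i P) m T m := ⟨1, hT, Exec.loop_stop h⟩

theorem Runs.loop_step {i : ℕ} {P : Prog} {m m' m'' : Mem} {T T' T'' : ℕ} (h : m.stack i ≠ [])
    (hP : Runs O B P m T m') (hL : Runs O B (.loop i P) m' T' m'') (hT : T + T' + 1 ≤ T'') :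
    Runs O B (.loop i P) m T'' m'' := by
  obtain ⟨t, ht, hP⟩ := hP
  obtain ⟨t', ht', hL⟩ := hL
  exact ⟨t + t' + 1, by omega, .loop_step h hP hL⟩

/-- The number of instructions and tests in a program; a bound on the running time of a program
without loops. -/
def Prog.cost : Prog → ℕ
  | .seq P Q => P.cost + Q.cost
  | .branch _ P Q R => P.cost + Q.cost + R.cost + 1
  | .loop _ P => P.cost + 1
  | _ => 1

/-- Programs without loops and queries. -/
def Prog.Straight : Prog → Prop
  | .seq P Q => P.Straight ∧ Q.Straight
  | .branch _ P Q R => P.Straight ∧ Q.Straight ∧ R.Straight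
  | .loop _ _ => False
  | .query _ => False
  | _ => True

/-- The effect of a program without loops and queries. -/
def Prog.effect : Prog → Mem → Mem
  | .push i b, m => m.set i (b :: m.stack i)
  | .pop i, m => m.set i (m.stack i).tail
  | .flip i, m => ⟨Function.update m.stack i (m.coins 0 :: m.stack i), fun k => m.coins (k + 1)⟩
  | .seq P Q, m => Q.effect (P.effect m)
  | .branch i P Q R, m =>
    match m.stack i with
    | [] => P.effect m
    | false :: _ => Q.effect m
    | true :: _ => R.effect m
  | _, m => m

/-- Loop-free programs are evaluated by a function, so that `simp` can compute their behaviour later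
on; derivations of `Exec` have to be built only for loops and queries. The cost adds up all arms of
a branch, which is crude but does not depend on the memory. -/
theorem Prog.Straight.runs {P : Prog} (h : P.Straight) (m : Mem) :
    Runs O B P m P.cost (P.effect m) := by
  induction P generalizing m with
  | skip => exact ⟨1, le_rfl, .skip m⟩
  | push i b => exact ⟨1, le_rfl, .push i b m⟩
  | pop i => exact ⟨1, le_rfl, .pop i m⟩
  | flip i => exact ⟨1, le_rfl, .flip i m⟩
  | query i => exact h.elim
  | seq P Q ihP ihQ => exact (ihP h.1 m).seq (ihQ h.2 _)
  | branch i P Q R ihP ihQ ihR =>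
    rw [Prog.effect]
    split
    · obtain ⟨t, ht, hP⟩ := ihP h.1 m
      exact ⟨t + 1, by simp only [Prog.cost]; omega, .branch_empty ‹_› hP⟩
    · obtain ⟨t, ht, hP⟩ := ihQ h.2.1 m
      exact ⟨t + 1, by simp only [Prog.cost]; omega, .branch_false ‹_› hP⟩
    · obtain ⟨t, ht, hP⟩ := ihR h.2.2 m
      exact ⟨t + 1, by simp only [Prog.cost]; omega, .branch_true ‹_› hP⟩
  | loop i P => exact h.elim

/-- The memory whose first twelve stacks are listed in `L`, and whose further stacks are given by
`s`. -/
def mem (L : List (List Bool)) (s : ℕ → List Bool) (ω : ℕ → Bool) : Mem :=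
  ⟨fun i => if i < 12 then L.getD i [] else s (i - 12), ω⟩

/-- The coins that are left after `k` of them have been used. -/
def dropCoins (k : ℕ) (ω : ℕ → Bool) : ℕ → Bool := fun i => ω (i + k)

@[simp] theorem dropCoins_zero (ω : ℕ → Bool) : dropCoins 0 ω = ω := rfl

@[simp] theorem dropCoins_dropCoins (k l : ℕ) (ω : ℕ → Bool) :
    dropCoins k (dropCoins l ω) = dropCoins (k + l) ω := by
  funext i; simp [dropCoins, add_assoc]

@[simp] theorem dropCoins_apply (k i : ℕ) (ω : ℕ → Bool) : dropCoins k ω i = ω (i + k) := rfl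

section mem

variable (L : List (List Bool)) (s : ℕ → List Bool) (ω : ℕ → Bool)

theorem mem_stack {i : ℕ} (hi : i < 12) : (mem L s ω).stack i = L.getD i [] := by
  simp [mem, hi]

@[simp] theorem mem_stack_add (i : ℕ) : (mem L s ω).stack (i + 12) = s i := by
  simp [mem]

theorem mem_set {i : ℕ} (l : List Bool) (hi : i < 12) (hL : i < L.length) :
    (mem L s ω).set i l = mem (L.set i l) s ω := by
  simp only [Mem.set, mem, Mem.mk.injEq, and_true]
  funext j
  by_cases h : j = i
  · subst h; simp [hi, hL]
  · rw [Function.update_of_ne h]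
    simp [List.getElem?_set_ne (Ne.symm h)]

@[simp] theorem mem_set_add (i : ℕ) (l : List Bool) :
    (mem L s ω).set (i + 12) l = mem L (Function.update s i l) ω := by
  simp only [Mem.set, mem, Mem.mk.injEq, and_true]
  funext j
  by_cases h : j = i + 12
  · subst h; simp
  · rw [Function.update_of_ne h]
    split
    · rfl
    · rw [Function.update_of_ne]; omega

theorem mem_init (x : List Bool) :
    Mem.init x ω = mem [x, [], [], [], [], [], [], [], [], [], [], []] (fun _ => []) ω := by
  simp only [Mem.init, mem, Mem.mk.injEq, and_true]
  funext j
  by_cases h : j = 0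
  · subst h; simp
  · rw [Function.update_of_ne h]
    split
    · interval_cases j <;> simp at h ⊢
    · rfl

variable {L s ω}

theorem effect_push {i : ℕ} (b : Bool) (hi : i < 12) (hL : i < L.length) :
    (Prog.push i b).effect (mem L s ω) = mem (L.set i (b :: L.getD i [])) s ω := by
  rw [Prog.effect, mem_set _ _ _ _ hi hL, mem_stack _ _ _ hi]

theorem effect_pop {i : ℕ} (hi : i < 12) (hL : i < L.length) :
    (Prog.pop i).effect (mem L s ω) = mem (L.set i (L.getD i []).tail) s ω := by
  rw [Prog.effect, mem_set _ _ _ _ hi hL, mem_stack _ _ _ hi]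

theorem effect_flip {i : ℕ} (hi : i < 12) (hL : i < L.length) :
    (Prog.flip i).effect (mem L s ω) = mem (L.set i (ω 0 :: L.getD i [])) s (dropCoins 1 ω) := by
  have := mem_set L s (dropCoins 1 ω) (ω 0 :: L.getD i []) hi hL
  rw [← this, Prog.effect, mem_stack _ _ _ hi]
  rfl

theorem effect_push_add (i : ℕ) (b : Bool) :
    (Prog.push (i + 12) b).effect (mem L s ω) = mem L (Function.update s i (b :: s i)) ω := by
  rw [Prog.effect, mem_set_add, mem_stack_add]

theorem effect_pop_add (i : ℕ) :
    (Prog.pop (i + 12)).effect (mem L s ω) = mem L (Function.update s i (s i).tail) ω := by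
  rw [Prog.effect, mem_set_add, mem_stack_add]

end mem

theorem effect_seq (P Q : Prog) (m : Mem) : (Prog.seq P Q).effect m = Q.effect (P.effect m) := rfl

theorem effect_skip (m : Mem) : Prog.skip.effect m = m := rfl

theorem effect_branch (i : ℕ) (P Q R : Prog) (m : Mem) : (Prog.branch i P Q R).effect m =
    match m.stack i with
    | [] => P.effect m
    | false :: _ => Q.effect m
    | true :: _ => R.effect m := rfl

/-! # Averages over bit strings -/

/-- The sum of `F` over all bit strings of length `k`. -/
def bitSum : ℕ → (List Bool → ℝ) → ℝ
  | 0, F => F []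
  | k + 1, F => bitSum k (fun l => F (false :: l)) + bitSum k (fun l => F (true :: l))

/-- The average of `F` over all bit strings of length `k`. -/
noncomputable def bitAvg (k : ℕ) (F : List Bool → ℝ) : ℝ := bitSum k F / 2 ^ k

theorem bitSum_add_fun (k : ℕ) (F G : List Bool → ℝ) :
    bitSum k (fun l => F l + G l) = bitSum k F + bitSum k G := by
  induction k generalizing F G with
  | zero => rfl
  | succ k ih => simp only [bitSum, ih]; ring

theorem bitSum_mul_left (k : ℕ) (c : ℝ) (F : List Bool → ℝ) :
    bitSum k (fun l => c * F l) = c * bitSum k F := by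
  induction k generalizing F with
  | zero => rfl
  | succ k ih => simp only [bitSum, ih]; ring

theorem bitSum_const (k : ℕ) (c : ℝ) : bitSum k (fun _ => c) = 2 ^ k * c := by
  induction k with
  | zero => simp [bitSum]
  | succ k ih => simp only [bitSum, ih]; ring

theorem bitSum_mono {k : ℕ} {F G : List Bool → ℝ} (h : ∀ l, l.length = k → F l ≤ G l) :
    bitSum k F ≤ bitSum k G := by
  induction k generalizing F G with
  | zero => exact h [] rfl
  | succ k ih =>
    exact add_le_add (ih fun l hl => h _ (by simp [hl])) (ih fun l hl => h _ (by simp [hl]))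

theorem bitSum_congr {k : ℕ} {F G : List Bool → ℝ} (h : ∀ l, l.length = k → F l = G l) :
    bitSum k F = bitSum k G :=
  le_antisymm (bitSum_mono fun l hl => (h l hl).le) (bitSum_mono fun l hl => (h l hl).ge)

theorem bitSum_add (a b : ℕ) (F : List Bool → ℝ) :
    bitSum (a + b) F = bitSum a fun x => bitSum b fun y => F (x ++ y) := by
  induction a generalizing F with
  | zero => simp [bitSum]
  | succ a ih => rw [Nat.succ_add]; simp only [bitSum, ih, List.cons_append]

theorem bitSum_comm (a b : ℕ) (F : List Bool → List Bool → ℝ) :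
    (bitSum a fun x => bitSum b fun y => F x y) = bitSum b fun y => bitSum a fun x => F x y := by
  induction a generalizing F with
  | zero => rfl
  | succ a ih => simp only [bitSum, ih, bitSum_add_fun]

theorem bitSum_finset_sum {ι : Type*} (s : Finset ι) (k : ℕ) (F : ι → List Bool → ℝ) :
    bitSum k (fun l => ∑ i ∈ s, F i l) = ∑ i ∈ s, bitSum k (F i) := by
  induction k generalizing F with
  | zero => rfl
  | succ k ih => simp only [bitSum, ih, Finset.sum_add_distrib]

theorem bitSum_eq_sum (k : ℕ) (F : List Bool → ℝ) :
    bitSum k F = ∑ r : Fin k → Bool, F (List.ofFn r) := by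
  induction k generalizing F with
  | zero => simp [bitSum]
  | succ k ih =>
    rw [bitSum, ih, ih, ← (Fin.consEquiv fun _ => Bool).sum_comp, Fintype.sum_prod_type,
      Fintype.sum_bool, add_comm]
    simp [Fin.consEquiv, List.ofFn_succ]

theorem bitSum_append_const (a b : ℕ) (F : List Bool → ℝ) :
    (bitSum (a + b) fun l => F (l.take a)) = 2 ^ b * bitSum a F := by
  rw [bitSum_add, ← bitSum_mul_left]
  refine bitSum_congr fun l hl => ?_
  rw [← bitSum_const]
  exact bitSum_congr fun l' _ => by rw [← hl, List.take_left]

theorem bitAvg_add (a b : ℕ) (F : List Bool → ℝ) :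
    bitAvg (a + b) F = bitAvg a fun x => bitAvg b fun y => F (x ++ y) := by
  simp only [bitAvg, bitSum_add, div_eq_inv_mul, bitSum_mul_left, pow_add, mul_inv, mul_assoc]

theorem bitAvg_take (a b : ℕ) (F : List Bool → ℝ) :
    (bitAvg (a + b) fun l => F (l.take a)) = bitAvg a F := by
  rw [bitAvg, bitAvg, bitSum_append_const, pow_add]
  field_simp

theorem bitAvg_mono {k : ℕ} {F G : List Bool → ℝ} (h : ∀ l, l.length = k → F l ≤ G l) :
    bitAvg k F ≤ bitAvg k G :=
  div_le_div_of_nonneg_right (bitSum_mono h) (by positivity)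

theorem bitAvg_congr {k : ℕ} {F G : List Bool → ℝ} (h : ∀ l, l.length = k → F l = G l) :
    bitAvg k F = bitAvg k G := by rw [bitAvg, bitSum_congr h, bitAvg]

theorem bitAvg_const (k : ℕ) (c : ℝ) : bitAvg k (fun _ => c) = c := by
  rw [bitAvg, bitSum_const]; field_simp

theorem bitAvg_add_fun (k : ℕ) (F G : List Bool → ℝ) :
    bitAvg k (fun l => F l + G l) = bitAvg k F + bitAvg k G := by
  rw [bitAvg, bitSum_add_fun, add_div]; rfl

theorem bitAvg_mul_left (k : ℕ) (c : ℝ) (F : List Bool → ℝ) :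
    bitAvg k (fun l => c * F l) = c * bitAvg k F := by
  rw [bitAvg, bitSum_mul_left, mul_div_assoc]; rfl

theorem bitAvg_comm (a b : ℕ) (F : List Bool → List Bool → ℝ) :
    (bitAvg a fun x => bitAvg b fun y => F x y) = bitAvg b fun y => bitAvg a fun x => F x y := by
  simp only [bitAvg, div_eq_inv_mul, bitSum_mul_left]
  rw [bitSum_comm]; ring

/-- The stream of coins that starts with the list `l`. -/
def listCoins (l : List Bool) : ℕ → Bool := fun k => l.getD k false

/-- Coins as a list can be split by appending, which is how they are later divided into the shift,
the two halves of the seed and an unused rest. -/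
theorem outputProb_eq_bitAvg (P : Prog) (x : List Bool) (T : ℕ) (E : List Bool → Prop) :
    outputProb O B P x T E =
      bitAvg T fun l => if ∃ y, E y ∧ Outputs O B P x (listCoins l) y then 1 else 0 := by
  rw [outputProb, bitAvg, bitSum_eq_sum, Fintype.card_subtype, Finset.sum_boole]
  congr 3
  ext r
  have : (fun k => if h : k < T then r ⟨k, h⟩ else false) = listCoins (List.ofFn r) := by
    funext k
    by_cases h : k < T <;> simp [listCoins, h]
  simp only [Finset.mem_filter, this]

theorem bitAvg_congr_take {F : List Bool → ℝ} {a b : ℕ} (h : ∀ l, F (l.take a) = F l)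
    (hab : a ≤ b) : bitAvg b F = bitAvg a F := by
  obtain ⟨c, rfl⟩ := Nat.exists_eq_add_of_le hab
  rw [← bitAvg_take a c F]
  simp only [h]

end FineGrained

/-! ### Simulating an arbitrary program so that each of its steps costs one tick of a clock. -/

namespace FineGrained

open scoped Classical

variable {O : Set (List Bool)} {B : ℕ}

/-! # Simulation with a clock -/

/-- Unless the clock has run out, let it tick once and run `P`. -/
def guarded (P : Prog) : Prog := .branch 8 .skip (.seq (.pop 8) P) (.seq (.pop 8) P)

/-- Let the clock tick, and put a mark on stack `11` if stack `i + 12` is not empty. -/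
def testStack (i : ℕ) : Prog :=
  guarded (.branch (i + 12) .skip (.push 11 true) (.push 11 true))

/-- The program `P` on the stacks from `12` on, with stack `8` as a clock and with the coin flips
taken from stack `4`. -/
def clocked : Prog → Prog
  | .skip => guarded .skip
  | .push i b => guarded (.push (i + 12) b)
  | .pop i => guarded (.pop (i + 12))
  | .flip i => guarded (.branch 4 .skip (.seq (.pop 4) (.push (i + 12) false))
      (.seq (.pop 4) (.push (i + 12) true)))
  | .query i => guarded (.push (i + 12) false)
  | .seq P Q => .seq (clocked P) (clocked Q)
  | .branch i P Q R =>
      .seq (guarded .skip) (.branch (i + 12) (clocked P) (clocked Q) (clocked R))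
  | .loop i P => .seq (testStack i)
      (.loop 11 (.seq (.pop 11) (.seq (clocked P) (testStack i))))

/-- The memory during a simulation. -/
def simMem (z a : List Bool) (s : ℕ → List Bool) (r k g : List Bool) (ω : ℕ → Bool) : Mem :=
  mem [[], [], [], [], r, [], z, a, k, [], [], g] s ω

section clocked

variable (z a : List Bool) (ω : ℕ → Bool)

theorem guarded_empty (P : Prog) (hP : P.Straight) (s : ℕ → List Bool) (r : List Bool) :
    Runs O B (guarded P) (simMem z a s r [] [] ω) (guarded P).cost (simMem z a s r [] [] ω) := by
  have h : (guarded P).Straight := by simp [guarded, Prog.Straight, hP]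
  simpa [guarded, effect_branch, simMem, mem_stack, effect_skip] using
    h.runs (O := O) (B := B) (simMem z a s r [] [] ω)

theorem guarded_cons (P : Prog) (hP : P.Straight) (s : ℕ → List Bool) (r k : List Bool) (b : Bool) :
    Runs O B (guarded P) (simMem z a s r (b :: k) [] ω) (guarded P).cost
      (P.effect (simMem z a s r k [] ω)) := by
  have h : (guarded P).Straight := by simp [guarded, Prog.Straight, hP]
  have := h.runs (O := O) (B := B) (simMem z a s r (b :: k) [] ω)
  cases b <;>
  simpa [guarded, effect_branch, simMem, mem_stack, effect_seq, effect_pop] using this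

/-- Without a tick every guarded instruction is the identity, and a simulated loop is left at once
because its test cannot set the mark on stack `11`. After a timeout the rest of the program is thus
traversed without effect. -/
theorem clocked_empty (P : Prog) (s : ℕ → List Bool) (r : List Bool) : ∃ T,
    Runs O B (clocked P) (simMem z a s r [] [] ω) T (simMem z a s r [] [] ω) := by
  induction P with
  | seq P Q ihP ihQ =>
    obtain ⟨T, hT⟩ := ihP
    obtain ⟨T', hT'⟩ := ihQ
    exact ⟨_, hT.seq hT'⟩
  | branch i P Q R ihP ihQ ihR =>
    obtain ⟨T₁, t₁, -, h₁⟩ := ihP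
    obtain ⟨T₂, t₂, -, h₂⟩ := ihQ
    obtain ⟨T₃, t₃, -, h₃⟩ := ihR
    have hb : ∃ t, Exec O B (.branch (i + 12) (clocked P) (clocked Q) (clocked R))
        (simMem z a s r [] [] ω) t (simMem z a s r [] [] ω) := by
      rcases hi : (simMem z a s r [] [] ω).stack (i + 12) with - | ⟨b, l⟩
      · exact ⟨_, .branch_empty hi h₁⟩
      · cases b
        · exact ⟨_, .branch_false hi h₂⟩
        · exact ⟨_, .branch_true hi h₃⟩
    obtain ⟨t, ht⟩ := hb
    exact ⟨_, (guarded_empty z a ω .skip trivial s r).seq ⟨t, le_rfl, ht⟩⟩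
  | loop i P =>
    refine ⟨_, (guarded_empty z a ω _ ?_ s r).seq (Runs.loop_stop le_rfl ?_)⟩
    · simp [Prog.Straight]
    · simp [simMem, mem_stack]
  | flip i => exact ⟨_, guarded_empty z a ω _ (by simp [Prog.Straight]) s r⟩
  | _ => exact ⟨_, guarded_empty z a ω _ (by simp [Prog.Straight]) s r⟩

/-- The loop condition is turned into a mark on stack `11`, since a loop that looked at stack `i +
12` itself would not stop when the clock is empty. -/
theorem testStack_cons (i : ℕ) (s : ℕ → List Bool) (r k : List Bool) (b : Bool) :
    Runs O B (testStack i) (simMem z a s r (b :: k) [] ω) (testStack i).cost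
      (simMem z a s r k (if s i = [] then [] else [true]) ω) := by
  have := guarded_cons (O := O) (B := B) z a ω
    (.branch (i + 12) .skip (.push 11 true) (.push 11 true)) (by simp [Prog.Straight]) s r k b
  rcases hi : s i with - | ⟨b, l⟩
  · simpa [testStack, effect_branch, simMem, hi, effect_skip] using this
  · cases b <;>
    simpa [testStack, effect_branch, simMem, hi, effect_push] using this

theorem testStack_empty (i : ℕ) (s : ℕ → List Bool) (r : List Bool) :
    Runs O B (testStack i) (simMem z a s r [] [] ω) (testStack i).cost (simMem z a s r [] [] ω) :=
  guarded_empty z a ω _ (by simp [Prog.Straight]) s r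

theorem pop_mark (s : ℕ → List Bool) (r k : List Bool) :
    Runs O B (.pop 11) (simMem z a s r k [true] ω) 1 (simMem z a s r k [] ω) := by
  simpa [effect_pop, simMem, Prog.cost] using
    Prog.Straight.runs (P := .pop 11) (O := O) (B := B) trivial (simMem z a s r k [true] ω)

/-- The clocked program halts from every memory, in time linear in the ticks of the clock. -/
theorem clocked_halts (P : Prog) : ∃ c, ∀ (z a : List Bool) (ω : ℕ → Bool)
    (s : ℕ → List Bool) (r k : List Bool),
    ∃ s' r' k', k'.length ≤ k.length ∧ Runs O B (clocked P) (simMem z a s r k [] ω)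
      (c * (k.length - k'.length) + c) (simMem z a s' r' k' [] ω) := by
  have base : ∀ Q : Prog, Q.Straight →
      (∀ z a ω s r k, ∃ s' r', Q.effect (simMem z a s r k [] ω) = simMem z a s' r' k [] ω) →
      ∃ c, ∀ (z a : List Bool) (ω : ℕ → Bool) (s : ℕ → List Bool) (r k : List Bool),
        ∃ s' r' k', k'.length ≤ k.length ∧ Runs O B (guarded Q) (simMem z a s r k [] ω)
          (c * (k.length - k'.length) + c) (simMem z a s' r' k' [] ω) := by
    intro Q hQ h
    refine ⟨(guarded Q).cost, fun z a ω s r k => ?_⟩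
    rcases k with - | ⟨b, k⟩
    · exact ⟨s, r, [], le_rfl, (guarded_empty z a ω Q hQ s r).mono (by simp)⟩
    · obtain ⟨s', r', h⟩ := h z a ω s r k
      exact ⟨s', r', k, by simp, h ▸ (guarded_cons z a ω Q hQ s r k b).mono (by simp)⟩
  induction P with
  | skip => exact base .skip trivial fun z a ω s r k => ⟨s, r, rfl⟩
  | push i b => exact base _ trivial fun z a ω s r k => ⟨_, _, effect_push_add i b⟩
  | query i => exact base (.push (i + 12) false) trivial fun z a ω s r k => ⟨_, _, effect_push_add i _⟩
  | pop i => exact base _ trivial fun z a ω s r k => ⟨_, _, effect_pop_add i⟩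
  | flip i =>
    refine base _ (by simp [Prog.Straight]) fun z a ω s r k => ?_
    rcases r with - | ⟨b, r⟩
    · exact ⟨s, [], by simp [effect_branch, simMem, mem_stack, effect_skip]⟩
    · refine ⟨Function.update s i (b :: s i), r, ?_⟩
      cases b <;> simp [effect_branch, simMem, mem_stack, effect_seq, effect_pop, effect_push_add]
  | seq P Q ihP ihQ =>
    obtain ⟨c₁, h₁⟩ := ihP
    obtain ⟨c₂, h₂⟩ := ihQ
    refine ⟨c₁ + c₂, fun z a ω s r k => ?_⟩
    obtain ⟨s', r', k', hk, h⟩ := h₁ z a ω s r k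
    obtain ⟨s'', r'', k'', hk', h'⟩ := h₂ z a ω s' r' k'
    refine ⟨s'', r'', k'', hk'.trans hk, (h.seq h').mono ?_⟩
    have e : k.length - k''.length = (k.length - k'.length) + (k'.length - k''.length) := by omega
    rw [e]
    generalize k.length - k'.length = x
    generalize k'.length - k''.length = y
    nlinarith [Nat.zero_le (c₁ * y), Nat.zero_le (c₂ * x)]
  | branch i P Q R ihP ihQ ihR =>
    obtain ⟨c₁, h₁⟩ := ihP
    obtain ⟨c₂, h₂⟩ := ihQ
    obtain ⟨c₃, h₃⟩ := ihR
    have hb : ∀ z a ω s r k, ∃ s' r' k', k'.length ≤ k.length ∧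
        Runs O B (.branch (i + 12) (clocked P) (clocked Q) (clocked R)) (simMem z a s r k [] ω)
          ((c₁ + c₂ + c₃) * (k.length - k'.length) + (c₁ + c₂ + c₃) + 1)
          (simMem z a s' r' k' [] ω) := by
      intro z a ω s r k
      rcases hi : (simMem z a s r k [] ω).stack (i + 12) with - | ⟨b, l⟩
      · obtain ⟨s', r', k', hk, t, ht, h⟩ := h₁ z a ω s r k
        exact ⟨s', r', k', hk, t + 1, by
          nlinarith [Nat.zero_le (c₂ * (k.length - k'.length)),
            Nat.zero_le (c₃ * (k.length - k'.length))], .branch_empty hi h⟩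
      · cases b
        · obtain ⟨s', r', k', hk, t, ht, h⟩ := h₂ z a ω s r k
          exact ⟨s', r', k', hk, t + 1, by
            nlinarith [Nat.zero_le (c₁ * (k.length - k'.length)),
              Nat.zero_le (c₃ * (k.length - k'.length))], .branch_false hi h⟩
        · obtain ⟨s', r', k', hk, t, ht, h⟩ := h₃ z a ω s r k
          exact ⟨s', r', k', hk, t + 1, by
            nlinarith [Nat.zero_le (c₁ * (k.length - k'.length)),
              Nat.zero_le (c₂ * (k.length - k'.length))], .branch_true hi h⟩
    refine ⟨c₁ + c₂ + c₃ + 1 + (guarded .skip).cost, fun z a ω s r k => ?_⟩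
    rcases k with - | ⟨b, k⟩
    · obtain ⟨s', r', k', hk, h⟩ := hb z a ω s r []
      refine ⟨s', r', k', hk, ((guarded_empty z a ω .skip trivial s r).seq h).mono ?_⟩
      simp only [List.length_nil, Nat.le_zero] at hk
      simp [hk]; omega
    · obtain ⟨s', r', k', hk, h⟩ := hb z a ω s r k
      refine ⟨s', r', k', by simp; omega,
        ((guarded_cons z a ω .skip trivial s r k b).seq h).mono ?_⟩
      have e : (b :: k).length - k'.length = k.length - k'.length + 1 := by simp; omega
      rw [e]
      generalize k.length - k'.length = x
      generalize (guarded .skip).cost = y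
      nlinarith [Nat.zero_le (y * x)]
  | loop i P ih =>
    obtain ⟨c, h⟩ := ih
    -- Induction on the clock. If ticks are left after the body, the closing test spends one;
    -- otherwise that test sets no mark and the loop ends.
    have hl : ∀ (z a : List Bool) (ω : ℕ → Bool) (n : ℕ) (s : ℕ → List Bool)
      (r k g : List Bool), k.length = n →
        (g = [] ∨ g = [true]) → ∃ s' r' k', k'.length ≤ k.length ∧
        Runs O B (.loop 11 (.seq (.pop 11) (.seq (clocked P) (testStack i))))
          (simMem z a s r k g ω)
          ((2 * c + (testStack i).cost + 2) * (k.length - k'.length) +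
            (c + (testStack i).cost + 3)) (simMem z a s' r' k' [] ω) := by
      intro z a ω n
      induction n using Nat.strong_induction_on with
      | _ n ihn =>
        intro s r k g hn hg
        rcases hg with rfl | rfl
        · exact ⟨s, r, k, le_rfl, Runs.loop_stop (by omega) (by simp [simMem, mem_stack])⟩
        · obtain ⟨s', r', k', hk, h⟩ := h z a ω s r k
          have hne : (simMem z a s r k [true] ω).stack 11 ≠ [] := by simp [simMem, mem_stack]
          rcases k' with - | ⟨b, k'⟩
          · refine ⟨s', r', [], by simp, Runs.loop_step hne ((pop_mark z a ω s r k).seq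
              (h.seq (testStack_empty z a ω i s' r'))) (Runs.loop_stop le_rfl
                (by simp [simMem, mem_stack])) ?_⟩
            generalize k.length - ([] : List Bool).length = x
            nlinarith [Nat.zero_le (c * x), Nat.zero_le ((testStack i).cost * x)]
          · simp only [List.length_cons] at hk h
            obtain ⟨s'', r'', k'', hk', h'⟩ := ihn k'.length (by omega) s' r' k'
              (if s' i = [] then [] else [true]) rfl (by split <;> simp)
            refine ⟨s'', r'', k'', by omega, Runs.loop_step hne ((pop_mark z a ω s r k).seq
              (h.seq (testStack_cons z a ω i s' r' k' b))) h' ?_⟩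
            have e : k.length - k''.length =
              (k.length - (k'.length + 1)) + (k'.length - k''.length) + 1 := by omega
            rw [e]
            generalize k.length - (k'.length + 1) = x
            generalize k'.length - k''.length = y
            nlinarith [Nat.zero_le (c * x), Nat.zero_le ((testStack i).cost * x)]
    refine ⟨2 * c + 2 * (testStack i).cost + 3, fun z a ω s r k => ?_⟩
    rcases k with - | ⟨b, k⟩
    · obtain ⟨s', r', k', hk, h⟩ := hl z a ω 0 s r [] [] rfl (.inl rfl)
      refine ⟨s', r', k', hk, ((testStack_empty z a ω i s r).seq h).mono ?_⟩
      simp only [List.length_nil, Nat.le_zero] at hk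
      simp [hk]; omega
    · obtain ⟨s', r', k', hk, h⟩ := hl z a ω k.length s r k (if s i = [] then [] else [true]) rfl
        (by split <;> simp)
      refine ⟨s', r', k', by simp; omega, ((testStack_cons z a ω i s r k b).seq h).mono ?_⟩
      have e : (b :: k).length - k'.length = k.length - k'.length + 1 := by simp; omega
      rw [e]
      generalize k.length - k'.length = x
      nlinarith [Nat.zero_le (c * x), Nat.zero_le ((testStack i).cost * x)]

/-- The clocked program follows the original one until the clock runs out. -/
theorem clocked_simulates {P : Prog} {m m' : Mem} {t : ℕ} (h : Exec ∅ 0 P m t m') :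
    ∃ f ≤ t, m'.coins = dropCoins f m.coins ∧ ∀ r k : List Bool,
      (∀ i b, r[i]? = some b → m.coins i = b) → k.length ≤ r.length →
      ∃ T s' r', Runs O B (clocked P) (simMem z a m.stack r k [] ω) T
        (simMem z a s' r' (k.drop t) [] ω) ∧
        (t ≤ k.length → s' = m'.stack ∧ r' = r.drop f) := by
  have base : ∀ (Q : Prog) (m m' : Mem), Q.Straight →
      (∀ r k, Q.effect (simMem z a m.stack r k [] ω) = simMem z a m'.stack r k [] ω) →
      m'.coins = m.coins →
      ∃ f ≤ 1, m'.coins = dropCoins f m.coins ∧ ∀ r k : List Bool,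
      (∀ i b, r[i]? = some b → m.coins i = b) → k.length ≤ r.length →
      ∃ T s' r', Runs O B (guarded Q) (simMem z a m.stack r k [] ω) T
        (simMem z a s' r' (k.drop 1) [] ω) ∧
        (1 ≤ k.length → s' = m'.stack ∧ r' = r.drop f) := by
    intro Q m m' hQ he hc
    refine ⟨0, by omega, by simp [hc], fun r k _ _ => ?_⟩
    rcases k with - | ⟨b, k⟩
    · exact ⟨_, m.stack, r, guarded_empty z a ω Q hQ m.stack r, by simp⟩
    · exact ⟨_, m'.stack, r, he r k ▸ guarded_cons z a ω Q hQ m.stack r k b, by simp⟩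
  induction h with
  | skip m => exact base .skip m m trivial (fun _ _ => rfl) rfl
  | push i b m => exact base _ _ _ trivial (fun _ _ => effect_push_add i b) rfl
  | pop i m => exact base _ _ _ trivial (fun _ _ => effect_pop_add i) rfl
  | query i m =>
    -- The sampler has the empty oracle, so each answer is `false`.
    refine base (.push (i + 12) false) _ _ trivial (fun _ _ => ?_) rfl
    simp [simMem, effect_push_add, Mem.set]
  | flip i m =>
    refine ⟨1, le_rfl, rfl, fun r k hr hk => ?_⟩
    have hQ : (Prog.branch 4 .skip (.seq (.pop 4) (.push (i + 12) false))
      (.seq (.pop 4) (.push (i + 12) true))).Straight := by simp [Prog.Straight]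
    rcases k with - | ⟨b, k⟩
    · exact ⟨_, m.stack, r, guarded_empty z a ω _ hQ m.stack r, by simp⟩
    · rcases r with - | ⟨d, r⟩
      -- With at least as many coins as ticks, the coin stack cannot be empty while the clock is
      -- running.
      · simp at hk
      · have hd : m.coins 0 = d := hr 0 d rfl
        have := guarded_cons (O := O) (B := B) z a ω _ hQ m.stack (d :: r) k b
        refine ⟨(clocked (.flip i)).cost, Function.update m.stack i (m.coins 0 :: m.stack i), r, ?_,
          fun _ => ⟨rfl, rfl⟩⟩
        convert (show Runs O B (clocked (.flip i)) _ (clocked (.flip i)).cost _ from this) using 1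
        rw [hd]
        cases d <;>
          simp [effect_branch, simMem, mem_stack, effect_seq, effect_pop, effect_push_add]
  | @seq P Q m m' m'' t t' hP hQ ihP ihQ =>
    obtain ⟨f, hf, hc, h⟩ := ihP
    obtain ⟨f', hf', hc', h'⟩ := ihQ
    refine ⟨f + f', by omega, by rw [hc', hc, dropCoins_dropCoins, add_comm], fun r k hr hk => ?_⟩
    obtain ⟨T, s', r', hT, he⟩ := h r k hr hk
    by_cases ht : t ≤ k.length
    · obtain ⟨rfl, rfl⟩ := he ht
      obtain ⟨T', s'', r'', hT', he'⟩ := h' (r.drop f) (k.drop t)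
        (fun i b hi => by
          rw [List.getElem?_drop] at hi
          rw [hc, dropCoins_apply, add_comm]
          exact hr _ _ hi) (by simp; omega)
      refine ⟨_, s'', r'', List.drop_drop (i := t') (j := t) (l := k) ▸ hT.seq hT', fun htt => ?_⟩
      obtain ⟨rfl, rfl⟩ := he' (by simp; omega)
      exact ⟨rfl, by rw [List.drop_drop]⟩
    -- The clock ran out during `P`, so `Q` is traversed idly.
    · rw [List.drop_eq_nil_of_le (by omega)] at hT
      obtain ⟨T', hT'⟩ := clocked_empty (O := O) (B := B) z a ω Q s' r'
      refine ⟨T + T', s', r', ?_, fun htt => by omega⟩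
      rw [List.drop_eq_nil_of_le (by omega)]
      exact hT.seq hT'
  | @branch_empty i P Q R m m' t hi hP ih | @branch_false i P Q R m m' t l hi hP ih
  | @branch_true i P Q R m m' t l hi hP ih =>
    obtain ⟨f, hf, hc, h⟩ := ih
    refine ⟨f, by omega, hc, fun r k hr hk => ?_⟩
    rcases k with - | ⟨b, k⟩
    · obtain ⟨T, hT⟩ := clocked_empty (O := O) (B := B) z a ω (.branch i P Q R) m.stack r
      exact ⟨T, m.stack, r, by simpa using hT, by simp⟩
    · obtain ⟨T, s', r', ⟨T', hT', hT⟩, he⟩ := h r k hr (by simp at hk; omega)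
      have hi' : ∀ k, (simMem z a m.stack r k [] ω).stack (i + 12) = m.stack i := by simp [simMem]
      refine ⟨_, s', r', (guarded_cons z a ω .skip trivial m.stack r k b).seq
        ⟨T' + 1, le_rfl, ?_⟩, fun ht => he (by simp at ht; omega)⟩
      simp only [List.drop_succ_cons]
      first
        | exact .branch_empty ((hi' k).trans hi) hT
        | exact .branch_false ((hi' k).trans hi) hT
        | exact .branch_true ((hi' k).trans hi) hT
  | loop_stop hi =>
    rename_i i P m
    refine ⟨0, by omega, rfl, fun r k hr hk => ?_⟩
    have hl : ∀ k, Runs O B (.loop 11 (.seq (.pop 11) (.seq (clocked P) (testStack i))))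
        (simMem z a m.stack r k [] ω) 1 (simMem z a m.stack r k [] ω) := fun k =>
      Runs.loop_stop le_rfl (by simp [simMem, mem_stack])
    rcases k with - | ⟨b, k⟩
    · exact ⟨_, _, _, (testStack_empty z a ω i m.stack r).seq (hl []), by simp⟩
    · refine ⟨(testStack i).cost + 1, m.stack, r, Runs.seq ?_ (hl k), by simp⟩
      simpa [hi] using testStack_cons (O := O) (B := B) z a ω i m.stack r k b
  | @loop_step i P m m' m'' t t' hi hP hL ihP ihL =>
    obtain ⟨f, hf, hc, h⟩ := ihP
    obtain ⟨f', hf', hc', h'⟩ := ihL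
    refine ⟨f + f', by omega, by rw [hc', hc, dropCoins_dropCoins, add_comm], fun r k hr hk => ?_⟩
    rcases k with - | ⟨b, k⟩
    · obtain ⟨T, hT⟩ := clocked_empty (O := O) (B := B) z a ω (.loop i P) m.stack r
      exact ⟨T, m.stack, r, by simpa using hT, by simp⟩
    · have h₁ := testStack_cons (O := O) (B := B) z a ω i m.stack r k b
      rw [if_neg hi] at h₁
      have hne : ∀ s r k, (simMem z a s r k [true] ω).stack 11 ≠ [] := fun s r k => by
        simp [simMem, mem_stack]
      obtain ⟨T, s', r', hT, he⟩ := h r k hr (by simp at hk; omega)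
      by_cases ht : t ≤ k.length
      · obtain ⟨rfl, rfl⟩ := he ht
        obtain ⟨T', s'', r'', ⟨T'', -, hT'⟩, he'⟩ := h' (r.drop f) (k.drop t)
          (fun i b hi => by
            rw [List.getElem?_drop] at hi
            rw [hc, dropCoins_apply, add_comm]
            exact hr _ _ hi) (by simp at hk ⊢; omega)
        -- The simulation of the remaining loop begins with a test, which in the simulation of the
        -- whole loop closes the current round: it is split off and attached to the body.
        cases hT' with
        | @seq _ _ _ mm _ t₁ t₂ hT₁ hT₂ =>
          refine ⟨_, s'', r'', h₁.seq (Runs.loop_step (hne _ _ _) ((pop_mark z a ω _ _ _).seq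
            (hT.seq ⟨t₁, le_rfl, hT₁⟩)) ⟨t₂, le_rfl, ?_⟩ le_rfl), fun htt => ?_⟩
          · rw [show t + t' + 1 = (t + t') + 1 from rfl, List.drop_succ_cons, ← List.drop_drop]
            exact hT₂
          · simp at htt
            obtain ⟨rfl, rfl⟩ := he' (by simp; omega)
            exact ⟨rfl, by rw [List.drop_drop]⟩
      · rw [List.drop_eq_nil_of_le (by omega)] at hT
        refine ⟨(testStack i).cost + (1 + (T + (testStack i).cost) + 1 + 1), s', r', ?_,
          fun htt => by simp at htt; omega⟩
        rw [List.drop_eq_nil_of_le (by simp; omega)]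
        exact h₁.seq (Runs.loop_step (hne _ _ _) ((pop_mark z a ω _ _ _).seq
          (hT.seq (testStack_empty z a ω i s' r'))) (Runs.loop_stop le_rfl
            (by simp [simMem, mem_stack])) le_rfl)

end clocked

end FineGrained

/-! ### The components of the oracle machine: parsing, hashing, comparing. -/

namespace FineGrained

open scoped Classical

variable {O : Set (List Bool)} {B : ℕ}

/-! # The verifier -/

/-- Move the content of stack `i` to stack `j`, in reverse order. -/
def moveStack (i j : ℕ) : Prog :=
  .loop i (.seq (.branch i .skip (.push j false) (.push j true)) (.pop i))

theorem moveStack_runs {i j : ℕ} (hi : i < 12) (hj : j < 12) (hij : i ≠ j) (s : ℕ → List Bool)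
    (ω : ℕ → Bool) (l p : List Bool) (L : List (List Bool)) (hL : L.length = 12) :
    Runs O B (moveStack i j) (mem ((L.set i l).set j p) s ω) (6 * l.length + 1)
      (mem ((L.set i []).set j (l.reverse ++ p)) s ω) := by
  have hg : ∀ l p : List Bool, ((L.set i l).set j p).getD i [] = l := fun l p => by
    simp [hij.symm, hL, hi]
  have hg' : ∀ l p : List Bool, ((L.set i l).set j p).getD j [] = p := fun l p => by
    simp [hL, hj]
  have hs : ∀ l p p' : List Bool, ((L.set i l).set j p).set j p' = (L.set i l).set j p' :=
    fun l p p' => by simp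
  have hs' : ∀ l p l' : List Bool, ((L.set i l).set j p).set i l' = (L.set i l').set j p :=
    fun l p l' => by rw [List.set_comm _ _ hij.symm, List.set_set]
  induction l generalizing p with
  | nil =>
    refine Runs.loop_stop (by simp) ?_
    rw [mem_stack _ _ _ hi, hg]
  | cons b l ih =>
    have hb : Runs O B (.seq (.branch i .skip (.push j false) (.push j true)) (.pop i))
        (mem ((L.set i (b :: l)).set j p) s ω) 5 (mem ((L.set i l).set j (b :: p)) s ω) := by
      have := Prog.Straight.runs (P := .seq (.branch i .skip (.push j false) (.push j true)) (.pop i))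
        (O := O) (B := B) (by simp [Prog.Straight]) (mem ((L.set i (b :: l)).set j p) s ω)
      rw [effect_seq, effect_branch, mem_stack _ _ _ hi, hg] at this
      cases b <;> simp only [Prog.cost] at this <;>
        rw [effect_push _ hj (by simp [hL, hj]), effect_pop hi (by simp [hL, hi]), hg', hs, hg,
          hs'] at this <;> exact this
    have h := Runs.loop_step (by rw [mem_stack _ _ _ hi, hg]; simp) hb (ih (b :: p))
      (T'' := 6 * (b :: l).length + 1) (by simp only [List.length_cons]; omega)
    simpa [moveStack] using h

/-- The content of the query tape, sorted: the input of the sampler, the seed of the hash function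
(two parts), the index, the target, the mark that enables acceptance, and the clock. -/
structure Query : Type where
  x : List Bool
  t : List Bool
  r : List Bool
  s : List Bool
  z : List Bool
  a : List Bool
  k : List Bool

/-- Add an item to a query; the last coordinate holds the coins for the guesses. -/
def Query.add : Bool → Bool → Bool → Bool → Query × (ℕ → Bool) → Query × (ℕ → Bool)
  | false, false, false, d, (q, ω) => ({ q with x := d :: q.x }, ω)
  | false, false, true, d, (q, ω) => ({ q with t := d :: q.t }, ω)
  | false, true, false, d, (q, ω) => ({ q with r := d :: q.r, k := true :: q.k }, ω)
  | false, true, true, _, (q, ω) =>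
    ({ q with r := ω 0 :: q.r, k := true :: q.k }, dropCoins 1 ω)
  | true, false, false, d, (q, ω) => ({ q with s := d :: q.s }, ω)
  | true, false, true, _, (q, ω) => ({ q with s := ω 0 :: q.s }, dropCoins 1 ω)
  | true, true, false, d, (q, ω) => ({ q with z := d :: q.z }, ω)
  | true, true, true, _, (q, ω) => ({ q with a := true :: q.a }, ω)

/-- Read a string of items. -/
def Query.read : List Bool → Query × (ℕ → Bool) → Query × (ℕ → Bool)
  | a :: b :: c :: d :: l, q => Query.read l (Query.add a b c d q)
  | _, q => q

/-- Read a bit from the input and branch on it. -/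
def readBit (P Q : Prog) : Prog := .branch 0 .skip (.seq (.pop 0) P) (.seq (.pop 0) Q)

/-- Read an item from the input. -/
def readItem : Prog :=
  readBit
    (readBit
      (readBit (readBit (.push 12 false) (.push 12 true)) (readBit (.push 3 false) (.push 3 true)))
      (readBit (readBit (.seq (.push 4 false) (.push 8 true)) (.seq (.push 4 true) (.push 8 true)))
        (readBit (.seq (.flip 4) (.push 8 true)) (.seq (.flip 4) (.push 8 true)))))
    (readBit
      (readBit (readBit (.push 5 false) (.push 5 true)) (readBit (.flip 5) (.flip 5)))
      (readBit (readBit (.push 6 false) (.push 6 true)) (readBit (.push 7 true) (.push 7 true))))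

/-- The memory of the verifier while it reads its input. -/
def Query.mem (l : List Bool) (q : Query × (ℕ → Bool)) : Mem :=
  FineGrained.mem [l, [], [], q.1.t, q.1.r, q.1.s, q.1.z, q.1.a, q.1.k, [], [], []]
    (Function.update (fun _ => []) 0 q.1.x) q.2

theorem effect_push_twelve (b : Bool) (L : List (List Bool)) (s : ℕ → List Bool) (ω : ℕ → Bool) :
    (Prog.push 12 b).effect (mem L s ω) = mem L (Function.update s 0 (b :: s 0)) ω :=
  effect_push_add 0 b

theorem readItem_runs (a b c d : Bool) (l : List Bool) (q : Query × (ℕ → Bool)) :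
    Runs O B readItem (Query.mem (a :: b :: c :: d :: l) q) readItem.cost
      (Query.mem l (Query.add a b c d q)) := by
  have h : readItem.Straight := by simp [readItem, readBit, Prog.Straight]
  have := h.runs (O := O) (B := B) (Query.mem (a :: b :: c :: d :: l) q)
  convert this using 1
  obtain ⟨q, ω⟩ := q
  cases a <;> cases b <;> cases c <;> cases d <;>
  simp [Query.mem, Query.add, readItem, readBit, effect_branch, mem_stack, effect_seq, effect_pop,
    effect_push, effect_flip, effect_push_twelve]

/-- An incomplete last item is discarded. The machine must halt on every string, not only on the
queries that are actually asked. -/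
theorem readItem_short (l : List Bool) (q : Query × (ℕ → Bool)) (hl : l.length < 4) :
    Runs O B readItem (Query.mem l q) readItem.cost (Query.mem [] q) := by
  have h : readItem.Straight := by simp [readItem, readBit, Prog.Straight]
  have := h.runs (O := O) (B := B) (Query.mem l q)
  convert this using 1
  match l, hl with
  | [], _ => simp [Query.mem, readItem, readBit, effect_branch, mem_stack, effect_skip]
  | [a], _ =>
    cases a <;>
    simp [Query.mem, readItem, readBit, effect_branch, mem_stack, effect_seq, effect_pop,
      effect_skip]
  | [a, b], _ =>
    cases a <;> cases b <;>
    simp [Query.mem, readItem, readBit, effect_branch, mem_stack, effect_seq, effect_pop,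
      effect_skip]
  | [a, b, c], _ =>
    cases a <;> cases b <;> cases c <;>
    simp [Query.mem, readItem, readBit, effect_branch, mem_stack, effect_seq, effect_pop,
      effect_skip]

theorem read_runs (l : List Bool) (q : Query × (ℕ → Bool)) :
    Runs O B (.loop 0 readItem) (Query.mem l q) ((readItem.cost + 1) * l.length + 1)
      (Query.mem [] (Query.read l q)) := by
  match l with
  | [] => exact Runs.loop_stop (by simp) (by simp [Query.mem, mem_stack])
  | a :: b :: c :: d :: l =>
    refine Runs.loop_step (by simp [Query.mem, mem_stack]) (readItem_runs a b c d l q)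
      (read_runs l _) ?_
    simp only [List.length_cons]; ring_nf; omega
  | [_] | [_, _] | [_, _, _] =>
    refine Runs.loop_step (by simp [Query.mem, mem_stack]) (readItem_short _ q (by simp))
      (Runs.loop_stop le_rfl (by simp [Query.mem, mem_stack])) ?_
    simp only [List.length_cons]; ring_nf; omega

/-- An item of four bits lengthens the counted parts of the query by at most one bit in total, so
time bounds in terms of these parts become bounds in the length of the query. -/
theorem read_length (l : List Bool) (q : Query × (ℕ → Bool)) :
    (Query.read l q).1.t.length + (Query.read l q).1.s.length + (Query.read l q).1.z.length +
      (Query.read l q).1.r.length ≤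
      q.1.t.length + q.1.s.length + q.1.z.length + q.1.r.length + l.length ∧
    (Query.read l q).1.k.length ≤ q.1.k.length + l.length := by
  match l with
  | [] | [_] | [_, _] | [_, _, _] => simp [Query.read]
  | a :: b :: c :: d :: l =>
    rw [Query.read]
    have := read_length l (Query.add a b c d q)
    obtain ⟨q, ω⟩ := q
    revert this
    cases a <;> cases b <;> cases c <;> simp [Query.add] <;> omega

/-- The bitwise sum of `r` and `t`, of the length of `r`. -/
def xorList : List Bool → List Bool → List Bool
  | [], _ => []
  | a :: r, [] => a :: xorList r []
  | a :: r, b :: t => (a ^^ b) :: xorList r t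

/-- The hash function with the seed `(t, r)`, at the index `s`: the product of a Toeplitz matrix
and `s`, plus `r`. -/
def hash : List Bool → List Bool → List Bool → List Bool
  | _, [], r => r
  | t, c :: s, r => hash t.tail s (if c then xorList r t else r)

@[simp] theorem xorList_length (r t : List Bool) : (xorList r t).length = r.length := by
  induction r generalizing t with
  | nil => rfl
  | cons a r ih => cases t <;> simp [xorList, ih]

@[simp] theorem hash_length (t s r : List Bool) : (hash t s r).length = r.length := by
  induction s generalizing t r with
  | nil => rfl
  | cons c s ih => rw [hash, ih]; split <;> simp

/-- Add the top of stack `3` to the top of stack `4`, and move both to stacks `10` and `9`. -/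
def xorBit : Prog :=
  .seq (.branch 3 (.branch 4 .skip (.push 9 false) (.push 9 true))
    (.seq (.branch 4 .skip (.push 9 false) (.push 9 true)) (.seq (.pop 3) (.push 10 false)))
    (.seq (.branch 4 .skip (.push 9 true) (.push 9 false)) (.seq (.pop 3) (.push 10 true))))
    (.pop 4)

/-- The used part of `t` is saved on stack `10` because the next bits of the index need it again,
shifted by one. -/
theorem xorLoop_runs (t r s z a k p q : List Bool) (i : ℕ → List Bool) (ω : ℕ → Bool) :
    Runs O B (.loop 4 xorBit) (mem [[], [], [], t, r, s, z, a, k, p, q, []] i ω)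
      ((xorBit.cost + 1) * r.length + 1)
      (mem [[], [], [], t.drop r.length, [], s, z, a, k, (xorList r t).reverse ++ p,
        (t.take r.length).reverse ++ q, []] i ω) := by
  induction r generalizing t p q with
  | nil => exact Runs.loop_stop (by simp) (by simp [mem_stack])
  | cons b r ih =>
    have hb := Prog.Straight.runs (P := xorBit) (O := O) (B := B)
      (by simp [xorBit, Prog.Straight]) (mem [[], [], [], t, b :: r, s, z, a, k, p, q, []] i ω)
    have e : xorBit.effect (mem [[], [], [], t, b :: r, s, z, a, k, p, q, []] i ω) =
        mem [[], [], [], t.tail, r, s, z, a, k, (xorList (b :: r) t).headD false :: p,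
          t.take 1 ++ q, []] i ω := by
      rcases t with - | ⟨d, t⟩
      · cases b <;>
        simp [xorBit, effect_branch, mem_stack, effect_seq, effect_push, effect_pop, xorList]
      · cases b <;> cases d <;>
        simp [xorBit, effect_branch, mem_stack, effect_seq, effect_push, effect_pop, xorList]
    rw [e] at hb
    have h := Runs.loop_step (by simp [mem_stack]) hb (ih _ _ _) le_rfl
    convert h.mono ?_ using 1
    · rcases t with - | ⟨d, t⟩ <;> simp [xorList]
    · simp only [List.length_cons]; ring_nf; omega

/-- One bit of the hash function. -/
def hashBit : Prog :=
  .seq (.branch 5 .skip (.pop 3)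
    (.seq (.loop 4 xorBit) (.seq (moveStack 9 4) (.seq (moveStack 10 3) (.pop 3))))) (.pop 5)

/-- Popping `t` once per bit of the index makes the matrix Toeplitz. The cost is linear in the
length of `r`; repeated for every bit of `s`, it is the quadratic term of the running time. -/
theorem hashBit_runs (t r s z a k : List Bool) (i : ℕ → List Bool) (ω : ℕ → Bool) (c : Bool) :
    Runs O B hashBit (mem [[], [], [], t, r, c :: s, z, a, k, [], [], []] i ω)
      ((xorBit.cost + 13) * r.length + 10)
      (mem [[], [], [], t.tail, if c then xorList r t else r, s, z, a, k, [], [], []] i ω) := by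
  cases c
  · have hb := Prog.Straight.runs (P := .seq (.pop 3) (.pop 5)) (O := O) (B := B)
      (by simp [Prog.Straight]) (mem [[], [], [], t, r, false :: s, z, a, k, [], [], []] i ω)
    obtain ⟨_, h, hb⟩ := hb
    cases hb with
    | @seq _ _ _ _ _ t₁ t₂ h₁ h₂ =>
      simp only [Prog.cost] at h
      refine ⟨t₁ + 1 + t₂, by omega, .seq (.branch_false (l := s) (by simp [mem_stack]) h₁) ?_⟩
      simpa [effect_pop, effect_seq] using h₂
  · have h₁ := xorLoop_runs (O := O) (B := B) t r (true :: s) z a k [] [] i ω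
    have h₂ := moveStack_runs (O := O) (B := B) (i := 9) (j := 4) (by simp) (by simp) (by simp) i ω
      (xorList r t).reverse [] [[], [], [], t.drop r.length, [], true :: s, z, a, k, [],
        (t.take r.length).reverse, []] rfl
    have h₃ := moveStack_runs (O := O) (B := B) (i := 10) (j := 3) (by simp) (by simp) (by simp) i ω
      (t.take r.length).reverse (t.drop r.length)
      [[], [], [], [], xorList r t, true :: s, z, a, k, [], [], []] rfl
    have h₄ := Prog.Straight.runs (P := .pop 3) (O := O) (B := B)
      (by simp [Prog.Straight]) (mem [[], [], [], t, xorList r t, true :: s, z, a, k, [], [], []] i ω)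
    have h₅ := Prog.Straight.runs (P := .pop 5) (O := O) (B := B)
      (by simp [Prog.Straight])
      (mem [[], [], [], t.tail, xorList r t, true :: s, z, a, k, [], [], []] i ω)
    simp [effect_pop] at h₁ h₂ h₃ h₄ h₅
    obtain ⟨T, hT, h⟩ := h₁.seq (h₂.seq (h₃.seq h₄))
    have := Runs.seq (P := .branch 5 .skip (.pop 3)
      (.seq (.loop 4 xorBit) (.seq (moveStack 9 4) (.seq (moveStack 10 3) (.pop 3)))))
      ⟨T + 1, le_rfl, .branch_true (l := s) (by simp [mem_stack]) h⟩ h₅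
    simp only [if_true]
    refine this.mono ?_
    simp only [Prog.cost] at hT ⊢
    have := Nat.min_le_left r.length t.length
    ring_nf at hT ⊢
    omega

theorem hashLoop_runs (t r s z a k : List Bool) (i : ℕ → List Bool) (ω : ℕ → Bool) :
    Runs O B (.loop 5 hashBit) (mem [[], [], [], t, r, s, z, a, k, [], [], []] i ω)
      (s.length * ((xorBit.cost + 13) * r.length + 11) + 1)
      (mem [[], [], [], t.drop s.length, hash t s r, [], z, a, k, [], [], []] i ω) := by
  induction s generalizing t r with
  | nil => exact Runs.loop_stop (by simp) (by simp [mem_stack])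
  | cons c s ih =>
    have hr : (if c = true then xorList r t else r).length = r.length := by split <;> simp
    have h := Runs.loop_step (by simp [mem_stack]) (hashBit_runs t r s z a k i ω c) (ih _ _)
      (T'' := (c :: s).length * ((xorBit.cost + 13) * r.length + 11) + 1)
      (by rw [hr]; simp only [List.length_cons]; ring_nf; omega)
    simpa [hash] using h

/-- The mark `a` is removed if `z` and `o` differ. -/
def compareMark : List Bool → List Bool → List Bool → List Bool
  | [], [], a => a
  | [], _ :: _, a => a.tail
  | _ :: z, [], a => compareMark z [] a.tail
  | b :: z, c :: o, a => compareMark z o (if b = c then a else a.tail)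

theorem compareMark_nil (z o : List Bool) : compareMark z o [] = [] := by
  induction z generalizing o with
  | nil => cases o <;> rfl
  | cons b z ih => cases o <;> simp [compareMark, ih]

/-- The mark is popped at the first mismatch and never restored, and further pops of the empty stack
do nothing. -/
theorem compareMark_true (z o : List Bool) :
    compareMark z o [true] = if o = z then [true] else [] := by
  induction z generalizing o with
  | nil => cases o <;> simp [compareMark]
  | cons b z ih =>
    cases o with
    | nil => simp [compareMark, compareMark_nil]
    | cons c o =>
      by_cases h : b = c
      · simp [compareMark, ih, h]
      · simp [compareMark, compareMark_nil, h, Ne.symm h]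

/-- Compare a bit of the target with a bit of the output of the simulated program. -/
def compareBit : Prog :=
  .seq (.branch 6 .skip (.branch 13 (.pop 7) .skip (.pop 7)) (.branch 13 (.pop 7) (.pop 7) .skip))
    (.seq (.pop 13) (.pop 6))

/-- Compare the target with the output of the simulated program. -/
def compareLoop : Prog := .seq (.loop 6 compareBit) (.branch 13 .skip (.pop 7) (.pop 7))

/-- Accept if the clock has run out or if the mark is still there. -/
def acceptIf : Prog :=
  .branch 8 (.push 1 true) (.branch 7 .skip (.push 1 true) (.push 1 true))
    (.branch 7 .skip (.push 1 true) (.push 1 true))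

theorem effect_pop_thirteen (L : List (List Bool)) (s : ℕ → List Bool) (ω : ℕ → Bool) :
    (Prog.pop 13).effect (mem L s ω) = mem L (Function.update s 1 (s 1).tail) ω :=
  effect_pop_add 1

theorem compareLoop_runs (z a r k : List Bool) (i : ℕ → List Bool) (ω : ℕ → Bool) :
    ∃ i', Runs O B compareLoop (simMem z a i r k [] ω) ((compareBit.cost + 1) * z.length + 5)
      (simMem [] (compareMark z (i 1) a) i' r k [] ω) := by
  -- Invariant: what is left to compare, with the current mark, leads to the same final mark.
  -- Surplus output of the sampler is detected by the branch after the loop.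
  have hl : ∃ i' a', Runs O B (.loop 6 compareBit) (simMem z a i r k [] ω)
      ((compareBit.cost + 1) * z.length + 1) (simMem [] a' i' r k [] ω) ∧
      compareMark [] (i' 1) a' = compareMark z (i 1) a := by
    induction z generalizing a i with
    | nil => exact ⟨i, a, Runs.loop_stop (by simp) (by simp [simMem, mem_stack]), rfl⟩
    | cons b z ih =>
      have hb := Prog.Straight.runs (P := compareBit) (O := O) (B := B)
        (by simp [compareBit, Prog.Straight]) (simMem (b :: z) a i r k [] ω)
      obtain ⟨i', a', h, e⟩ := ih
        (match i 1 with | [] => a.tail | c :: _ => if b = c then a else a.tail)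
        (Function.update i 1 (i 1).tail)
      refine ⟨i', a', Runs.loop_step (by simp [simMem, mem_stack]) hb
        (T' := (compareBit.cost + 1) * z.length + 1) ?_
        (by simp only [List.length_cons]; ring_nf; omega), ?_⟩
      · convert h using 1
        rcases hi : i 1 with - | ⟨c, o⟩
        · cases b <;> simp [compareBit, simMem, effect_branch, mem_stack, effect_seq,
            effect_pop, effect_pop_thirteen, hi]
        · cases b <;> cases c <;> simp [compareBit, simMem, effect_branch, mem_stack, effect_seq,
            effect_pop, effect_pop_thirteen, effect_skip, hi]
      · rw [e]
        rcases hi : i 1 with - | ⟨c, o⟩ <;> simp [compareMark]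
  obtain ⟨i', a', h, e⟩ := hl
  have hf := Prog.Straight.runs (P := .branch 13 .skip (.pop 7) (.pop 7)) (O := O) (B := B)
    (by simp [Prog.Straight]) (simMem [] a' i' r k [] ω)
  have h' := h.seq (hf.mono (T' := 4) (by simp [Prog.cost]))
  refine ⟨i', ?_⟩
  convert (show Runs O B compareLoop _ _ _ from h') using 1
  rw [← e]
  rcases hi : i' 1 with - | ⟨c, o⟩
  · simp [effect_branch, simMem, hi, effect_skip, compareMark]
  · cases c <;>
    simp [effect_branch, simMem, hi, effect_pop, compareMark]

theorem acceptIf_runs (a r k : List Bool) (i : ℕ → List Bool) (ω : ℕ → Bool) :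
    Runs O B acceptIf (simMem [] a i r k [] ω) acceptIf.cost
      (mem [[], if k = [] ∨ a ≠ [] then [true] else [], [], [], r, [], [], a, k, [], [], []]
        i ω) := by
  have := Prog.Straight.runs (P := acceptIf) (O := O) (B := B)
    (by simp [acceptIf, Prog.Straight]) (simMem [] a i r k [] ω)
  convert this using 1
  rcases k with - | ⟨_ | _, k⟩ <;> rcases a with - | ⟨_ | _, a⟩ <;>
  simp [acceptIf, simMem, effect_branch, mem_stack, effect_push, effect_skip]

end FineGrained

/-! ### The oracle language: its running time and its acceptance condition. -/

namespace FineGrained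

open scoped Classical

variable {O : Set (List Bool)} {B : ℕ}

/-- Remove what is left of the seed. -/
def clearSeed : Prog := .loop 3 (.pop 3)

theorem clearSeed_runs (t r z a k : List Bool) (s : ℕ → List Bool) (ω : ℕ → Bool) :
    Runs O B clearSeed (mem [[], [], [], t, r, [], z, a, k, [], [], []] s ω) (2 * t.length + 1)
      (simMem z a s r k [] ω) := by
  induction t with
  | nil => exact Runs.loop_stop (by simp) (by simp [mem_stack])
  | cons b t ih =>
    have hb := Prog.Straight.runs (P := .pop 3) (O := O) (B := B) trivial
      (mem [[], [], [], b :: t, r, [], z, a, k, [], [], []] s ω)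
    rw [effect_pop (by simp) (by simp)] at hb
    exact Runs.loop_step (by simp [mem_stack]) hb ih
      (by simp only [Prog.cost, List.length_cons]; omega)

/-- The verifier for the program `S`: read the query, compute the hash value, run `S` with the hash
value as the coins, and compare the output with the target. -/
def verifier (S : Prog) : Prog :=
  .seq (.loop 0 readItem) (.seq (.loop 5 hashBit) (.seq clearSeed
    (.seq (clocked S) (.seq compareLoop acceptIf))))

/-- The query before anything has been read. -/
def Query.empty : Query := ⟨[], [], [], [], [], [], []⟩

theorem Query.mem_empty (x : List Bool) (ω : ℕ → Bool) :
    Query.mem x (Query.empty, ω) = Mem.init x ω := by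
  rw [mem_init]
  simp [Query.mem, Query.empty]

/-- The clock is written in unary in the query, so parsing, simulation and comparison take linear
time; only the hash function needs quadratic time. The bound makes no assumption on the running time
of `S`. -/
theorem verifier_halts (S : Prog) : ∃ c : ℕ, ∀ x : List Bool,
    HaltsWithin O B (verifier S) x (c * x.length ^ 2 + c) := by
  obtain ⟨c, hc⟩ := clocked_halts (O := O) (B := B) S
  refine ⟨readItem.cost + xorBit.cost + compareBit.cost + acceptIf.cost + c + 50, fun x ω => ?_⟩
  have h₁ := read_runs (O := O) (B := B) x (Query.empty, ω)
  obtain ⟨hl, hk⟩ := read_length x (Query.empty, ω)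
  generalize hq : Query.read x (Query.empty, ω) = q at *
  obtain ⟨q, ω'⟩ := q
  have h₂ := hashLoop_runs (O := O) (B := B) q.t q.r q.s q.z q.a q.k
    (Function.update (fun _ => []) 0 q.x) ω'
  obtain ⟨s', r', k', hk', h₃⟩ := hc q.z q.a ω' (Function.update (fun _ => []) 0 q.x)
    (hash q.t q.s q.r) q.k
  obtain ⟨i, h₄⟩ := compareLoop_runs (O := O) (B := B) q.z q.a r' k' s' ω'
  have h₅ := acceptIf_runs (O := O) (B := B) (compareMark q.z (s' 1) q.a) r' k' i ω'
  have h₆ := clearSeed_runs (O := O) (B := B) (q.t.drop q.s.length) (hash q.t q.s q.r) q.z q.a q.k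
    (Function.update (fun _ => []) 0 q.x) ω'
  have h := h₁.seq ((h₂.seq (h₆.seq (h₃.seq (h₄.seq h₅)))))
  rw [Query.mem_empty] at h
  obtain ⟨t, ht, h⟩ := h
  refine ⟨t, ht.trans ?_, _, h⟩
  simp only [Query.empty, List.length_nil, zero_add] at hl hk
  generalize x.length = N at *
  have hN : N ≤ N ^ 2 := Nat.le_self_pow two_ne_zero N
  have b₁ : (readItem.cost + 1) * N ≤ (readItem.cost + 1) * N ^ 2 := Nat.mul_le_mul_left _ hN
  have b₂ : q.s.length * ((xorBit.cost + 13) * q.r.length + 11) ≤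
      (xorBit.cost + 24) * N ^ 2 := by
    calc q.s.length * ((xorBit.cost + 13) * q.r.length + 11)
        ≤ N * ((xorBit.cost + 13) * N + 11) := by gcongr <;> omega
      _ = (xorBit.cost + 13) * N ^ 2 + 11 * N := by ring
      _ ≤ _ := by nlinarith
  have b₃ : c * (q.k.length - k'.length) ≤ c * N ^ 2 := Nat.mul_le_mul_left _ (by omega)
  have b₄ : (compareBit.cost + 1) * q.z.length ≤ (compareBit.cost + 1) * N ^ 2 :=
    Nat.mul_le_mul_left _ (by omega)
  have b₅ : (q.t.drop q.s.length).length ≤ N := by simp; omega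
  generalize (q.t.drop q.s.length).length = y₅ at *
  generalize c * (q.k.length - k'.length) = y₃ at *
  generalize q.s.length * ((xorBit.cost + 13) * q.r.length + 11) = y₂ at *
  generalize (readItem.cost + 1) * N = y₁ at *
  generalize (compareBit.cost + 1) * q.z.length = y₄ at *
  nlinarith [Nat.zero_le (N ^ 2)]

/-- The language of the verifier. -/
def oracle (S : Prog) : Set (List Bool) :=
  {x | ∃ ω : ℕ → Bool, Outputs ∅ 0 (verifier S) x ω [true]}

theorem oracle_mem (S : Prog) : oracle S ∈ NTIMESq := by
  obtain ⟨c, hc⟩ := verifier_halts (O := ∅) (B := 0) S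
  exact ⟨verifier S, c, fun x => ⟨hc x, Iff.rfl⟩⟩

/-- What the verifier accepts, in terms of the run of `S` on the given input and coins. -/
theorem verifier_outputs {S : Prog} {x : List Bool} {ω ω₁ ω' : ℕ → Bool} {q : Query} {m' : Mem}
    {t : ℕ} (hq : Query.read x (Query.empty, ω) = (q, ω₁))
    (hS : Exec ∅ 0 S (Mem.init q.x ω') t m')
    (hω : ∀ i b, (hash q.t q.s q.r)[i]? = some b → ω' i = b) (hk : q.k.length ≤ q.r.length)
    (ha : q.a = [] ∨ q.a = [true]) :
    Outputs ∅ 0 (verifier S) x ω [true] ↔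
      q.k.length ≤ t ∨ (q.a = [true] ∧ m'.stack 1 = q.z) := by
  obtain ⟨f, hf, -, h⟩ := clocked_simulates (O := ∅) (B := 0) q.z q.a ω₁ hS
  obtain ⟨T, s', r', h₃, he⟩ := h (hash q.t q.s q.r) q.k hω (by simpa using hk)
  have h₁ := read_runs (O := ∅) (B := 0) x (Query.empty, ω)
  rw [hq, Query.mem_empty] at h₁
  have h₂ := hashLoop_runs (O := ∅) (B := 0) q.t q.r q.s q.z q.a q.k
    (Function.update (fun _ => []) 0 q.x) ω₁
  obtain ⟨i, h₄⟩ := compareLoop_runs (O := ∅) (B := 0) q.z q.a r' (q.k.drop t) s' ω₁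
  have h₅ := acceptIf_runs (O := ∅) (B := 0) (compareMark q.z (s' 1) q.a) r' (q.k.drop t) i ω₁
  have h₆ := clearSeed_runs (O := ∅) (B := 0) (q.t.drop q.s.length) (hash q.t q.s q.r) q.z q.a q.k
    (Function.update (fun _ => []) 0 q.x) ω₁
  obtain ⟨t', -, h⟩ := h₁.seq (h₂.seq (h₆.seq (h₃.seq (h₄.seq h₅))))
  have hout : Outputs ∅ 0 (verifier S) x ω [true] ↔
      q.k.drop t = [] ∨ compareMark q.z (s' 1) q.a ≠ [] := by
    constructor
    · rintro ⟨t'', m, hm, hm'⟩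
      obtain ⟨-, rfl⟩ := hm.det h
      by_contra hcon
      rw [if_neg hcon] at hm'
      simp [mem_stack] at hm'
    · intro hcon
      refine ⟨_, _, h, ?_⟩
      rw [if_pos hcon]
      simp [mem_stack]
  rw [hout, List.drop_eq_nil_iff]
  by_cases ht : q.k.length ≤ t
  · simp [ht]
  · obtain ⟨rfl, -⟩ := he (by omega)
    rcases ha with ha | ha
    · simp [ht, ha, compareMark_nil]
    · simp [ht, ha, compareMark_true]

end FineGrained

/-! ### Writing queries, and shifting the polynomial while it is copied. -/

namespace FineGrained

open scoped Classical

variable {O : Set (List Bool)} {B : ℕ}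

/-! # Building queries -/

/-- The items with the tag `a b c` and the given data, as they are found on the query tape after
they have been written in this order. -/
def pack (a b c : Bool) : List Bool → List Bool
  | [] => []
  | d :: l => pack a b c l ++ [a, b, c, d]

theorem pack_append (a b c : Bool) (l l' : List Bool) :
    pack a b c (l ++ l') = pack a b c l' ++ pack a b c l := by
  induction l with
  | nil => simp [pack]
  | cons d l ih => simp [pack, ih]

theorem pack_append_singleton (a b c : Bool) (l : List Bool) (d : Bool) :
    pack a b c (l ++ [d]) = a :: b :: c :: d :: pack a b c l := by
  simp [pack_append, pack]

@[simp] theorem pack_length (a b c : Bool) (l : List Bool) :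
    (pack a b c l).length = 4 * l.length := by
  induction l with
  | nil => rfl
  | cons d l ih => simp only [pack, List.length_append, ih, List.length_cons, List.length_nil]; ring

/-- The first `k` coins. -/
def coinList (k : ℕ) (ω : ℕ → Bool) : List Bool := (List.range k).map ω

@[simp] theorem coinList_length (k : ℕ) (ω : ℕ → Bool) : (coinList k ω).length = k := by
  simp [coinList]

theorem coinList_succ (k : ℕ) (ω : ℕ → Bool) :
    coinList (k + 1) ω = ω 0 :: coinList k (dropCoins 1 ω) := by
  simp only [coinList, List.range_succ_eq_map, List.map_cons, List.map_map]
  rfl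

/-- The item written last is read first, and each item is pushed on a stack, so the two reversals
cancel. -/
theorem read_pack_x (l rest : List Bool) (q : Query) (ω : ℕ → Bool) :
    Query.read (pack false false false l ++ rest) (q, ω) =
      Query.read rest ({ q with x := l ++ q.x }, ω) := by
  induction l using List.reverseRecOn generalizing q with
  | nil => simp [pack]
  | append_singleton l d ih => simp [pack_append_singleton, Query.read, Query.add, ih]

theorem read_pack_t (l rest : List Bool) (q : Query) (ω : ℕ → Bool) :
    Query.read (pack false false true l ++ rest) (q, ω) =
      Query.read rest ({ q with t := l ++ q.t }, ω) := by
  induction l using List.reverseRecOn generalizing q with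
  | nil => simp [pack]
  | append_singleton l d ih => simp [pack_append_singleton, Query.read, Query.add, ih]

theorem read_pack_r (l rest : List Bool) (q : Query) (ω : ℕ → Bool) :
    Query.read (pack false true false l ++ rest) (q, ω) =
      Query.read rest ({ q with r := l ++ q.r, k := List.replicate l.length true ++ q.k }, ω) := by
  induction l using List.reverseRecOn generalizing q with
  | nil => simp [pack]
  | append_singleton l d ih =>
    simp [pack_append_singleton, Query.read, Query.add, ih, List.replicate_succ']

/-- The data of such items are ignored in favour of guesses. These arrive reversed, which is
harmless under an existential quantifier. -/
theorem read_pack_guess_r (l rest : List Bool) (q : Query) (ω : ℕ → Bool) :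
    Query.read (pack false true true l ++ rest) (q, ω) =
      Query.read rest ({ q with
        r := (coinList l.length ω).reverse ++ q.r
        k := List.replicate l.length true ++ q.k }, dropCoins l.length ω) := by
  induction l using List.reverseRecOn generalizing q ω with
  | nil => simp [pack, coinList]
  | append_singleton l d ih =>
    simp [pack_append_singleton, Query.read, Query.add, ih, List.replicate_succ', coinList_succ]

theorem read_pack_s (l rest : List Bool) (q : Query) (ω : ℕ → Bool) :
    Query.read (pack true false false l ++ rest) (q, ω) =
      Query.read rest ({ q with s := l ++ q.s }, ω) := by
  induction l using List.reverseRecOn generalizing q with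
  | nil => simp [pack]
  | append_singleton l d ih => simp [pack_append_singleton, Query.read, Query.add, ih]

theorem read_pack_guess_s (l rest : List Bool) (q : Query) (ω : ℕ → Bool) :
    Query.read (pack true false true l ++ rest) (q, ω) =
      Query.read rest ({ q with s := (coinList l.length ω).reverse ++ q.s },
        dropCoins l.length ω) := by
  induction l using List.reverseRecOn generalizing q ω with
  | nil => simp [pack, coinList]
  | append_singleton l d ih =>
    simp [pack_append_singleton, Query.read, Query.add, ih, coinList_succ]

theorem read_pack_z (l rest : List Bool) (q : Query) (ω : ℕ → Bool) :
    Query.read (pack true true false l ++ rest) (q, ω) =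
      Query.read rest ({ q with z := l ++ q.z }, ω) := by
  induction l using List.reverseRecOn generalizing q with
  | nil => simp [pack]
  | append_singleton l d ih => simp [pack_append_singleton, Query.read, Query.add, ih]

theorem read_pack_a (l rest : List Bool) (q : Query) (ω : ℕ → Bool) :
    Query.read (pack true true true l ++ rest) (q, ω) =
      Query.read rest ({ q with a := List.replicate l.length true ++ q.a }, ω) := by
  induction l using List.reverseRecOn generalizing q with
  | nil => simp [pack]
  | append_singleton l d ih =>
    simp [pack_append_singleton, Query.read, Query.add, ih, List.replicate_succ']

/-- The query `o` consists of the input `x` and of the target `z`. -/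
def IsInput (o x z : List Bool) : Prop :=
  o.length = 4 * (x.length + z.length) ∧ ∀ (rest : List Bool) (q : Query) (ω : ℕ → Bool),
    Query.read (o ++ rest) (q, ω) = Query.read rest ({ q with x := x ++ q.x, z := z ++ q.z }, ω)

theorem isInput_nil : IsInput [] [] [] := ⟨rfl, fun _ _ _ => rfl⟩

/-- The items of the input and of the target are interleaved on the tape, since each random bit is
written as a target bit and also enters a coefficient. Only the parsed result and the length are
remembered. -/
theorem IsInput.pack_x {o x z : List Bool} (h : IsInput o x z) (l : List Bool) :
    IsInput (pack false false false l ++ o) (x ++ l) z := by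
  refine ⟨by simp [h.1]; ring, fun rest q ω => ?_⟩
  rw [List.append_assoc, read_pack_x, h.2]
  simp

theorem IsInput.pack_z {o x z : List Bool} (h : IsInput o x z) (l : List Bool) :
    IsInput (pack true true false l ++ o) x (z ++ l) := by
  refine ⟨by simp [h.1]; ring, fun rest q ω => ?_⟩
  rw [List.append_assoc, read_pack_z, h.2]
  simp

/-! # The estimator: reading the input -/

/-- Write an item on the query tape. -/
def put (a b c d : Bool) : Prog := .seq (.push 2 d) (.seq (.push 2 c) (.seq (.push 2 b) (.push 2 a)))

/-- Write an item with random data on the query tape. -/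
def putFlip (a b c : Bool) : Prog :=
  .seq (.flip 2) (.seq (.push 2 c) (.seq (.push 2 b) (.push 2 a)))

/-- Copy the digit of a number in unary. -/
def unaryStep : Prog :=
  .branch 0 (.pop 3) (.seq (.pop 0) (.seq (.pop 3) (put false false false false)))
    (.seq (.pop 0) (.seq (put false false false true)
      (.seq (.push 4 true) (.seq (.push 10 true) (.push 11 true)))))

theorem pack_cons_append (a b c d : Bool) (l o : List Bool) :
    pack a b c (d :: l) ++ o = pack a b c l ++ (a :: b :: c :: d :: o) := by
  simp [pack]

section

variable (s : ℕ → List Bool)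

/-- The number `n` is copied to three counters: stack `4` for the rows, stack `10` for the length of
the seed, stack `11` for the zeros of the output. The mark on stack `3` keeps the loop going until
the end marker has been copied. -/
theorem unaryLoop_runs (n : ℕ) (x o N E F : List Bool) (ω : ℕ → Bool) :
    Runs O B (.loop 3 unaryStep)
      (mem [unary n ++ x, [], o, [true], N, [], [], [], [], [], E, F] s ω)
      ((unaryStep.cost + 1) * (n + 1) + 1)
      (mem [x, [], pack false false false (unary n) ++ o, [], List.replicate n true ++ N, [], [],
        [], [], [], List.replicate n true ++ E, List.replicate n true ++ F] s ω) := by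
  have hs : unaryStep.Straight := by simp [unaryStep, put, Prog.Straight]
  induction n generalizing o N E F with
  | zero =>
    have hb := hs.runs (O := O) (B := B)
      (mem [unary 0 ++ x, [], o, [true], N, [], [], [], [], [], E, F] s ω)
    have e : unaryStep.effect (mem [unary 0 ++ x, [], o, [true], N, [], [], [], [], [], E, F] s ω) =
        mem [x, [], pack false false false (unary 0) ++ o, [], N, [], [], [], [], [], E, F] s ω := by
      simp [unary, unaryStep, put, effect_branch, mem_stack, effect_seq, effect_push, effect_pop,
        pack]
    rw [e] at hb
    simpa using Runs.loop_step (by simp [mem_stack]) hb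
      (Runs.loop_stop le_rfl (by simp [mem_stack])) (T'' := unaryStep.cost + 1 + 1) le_rfl
  | succ n ih =>
    have hb := hs.runs (O := O) (B := B)
      (mem [unary (n + 1) ++ x, [], o, [true], N, [], [], [], [], [], E, F] s ω)
    have e : unaryStep.effect
        (mem [unary (n + 1) ++ x, [], o, [true], N, [], [], [], [], [], E, F] s ω) =
        mem [unary n ++ x, [], false :: false :: false :: true :: o, [true], true :: N,
          [], [], [], [], [], true :: E, true :: F] s ω := by
      simp [unary, List.replicate_succ, unaryStep, put, effect_branch, mem_stack, effect_seq,
        effect_push, effect_pop]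
    rw [e] at hb
    have h := Runs.loop_step (by simp [mem_stack]) hb (ih _ _ _ _)
      (T'' := (unaryStep.cost + 1) * (n + 1 + 1) + 1) (by ring_nf; omega)
    convert h using 3
    rw [show unary (n + 1) = true :: unary n by simp [unary, List.replicate_succ], pack_cons_append]
    simp [List.replicate_succ']

/-- Copy a bit of the input. -/
def copyBit : Prog :=
  .seq (.branch 0 .skip (put false false false false) (put false false false true)) (.pop 0)

/-- Copy a bit of the input, and move the mark that counts it. -/
def countBit : Prog := .seq (.pop 5) (.seq (.push 6 true) copyBit)

theorem countLoop_runs (l x o N D b E F : List Bool) (ω : ℕ → Bool) :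
    Runs O B (.loop 5 countBit)
      (mem [l ++ x, [], o, [], N, List.replicate l.length true, D, b, [], [], E, F] s ω)
      ((countBit.cost + 1) * l.length + 1)
      (mem [x, [], pack false false false l ++ o, [], N, [], List.replicate l.length true ++ D, b,
        [], [], E, F] s ω) := by
  have hs : countBit.Straight := by simp [countBit, copyBit, put, Prog.Straight]
  induction l generalizing o D with
  | nil => exact Runs.loop_stop (by simp) (by simp [mem_stack])
  | cons d l ih =>
    have hb := hs.runs (O := O) (B := B) (mem [(d :: l) ++ x, [], o, [], N,
      List.replicate (d :: l).length true, D, b, [], [], E, F] s ω)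
    have e : countBit.effect (mem [(d :: l) ++ x, [], o, [], N,
        List.replicate (d :: l).length true, D, b, [], [], E, F] s ω) =
        mem [l ++ x, [], false :: false :: false :: d :: o, [], N,
          List.replicate l.length true, true :: D, b, [], [], E, F] s ω := by
      cases d <;> simp [countBit, copyBit, List.replicate_succ, put, effect_branch, mem_stack,
        effect_seq, effect_push, effect_pop]
    rw [e] at hb
    have h := Runs.loop_step (by simp [mem_stack, List.replicate_succ]) hb (ih _ _)
      (T'' := (countBit.cost + 1) * (d :: l).length + 1)
      (by simp only [List.length_cons]; ring_nf; omega)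
    convert h using 3
    rw [pack_cons_append]
    simp [List.replicate_succ']

theorem copyLoop_runs (x o N C b E F : List Bool) (ω : ℕ → Bool) :
    Runs O B (.loop 0 copyBit) (mem [x, [], o, [], N, C, [], b, [], [], E, F] s ω)
      ((copyBit.cost + 1) * x.length + 1)
      (mem [[], [], pack false false false x ++ o, [], N, C, [], b, [], [], E, F] s ω) := by
  have hs : copyBit.Straight := by simp [copyBit, put, Prog.Straight]
  induction x generalizing o with
  | nil => exact Runs.loop_stop (by simp) (by simp [mem_stack])
  | cons d x ih =>
    have hb := hs.runs (O := O) (B := B) (mem [d :: x, [], o, [], N, C, [], b, [], [], E, F] s ω)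
    have e : copyBit.effect (mem [d :: x, [], o, [], N, C, [], b, [], [], E, F] s ω) =
        mem [x, [], false :: false :: false :: d :: o, [], N, C, [], b, [], [], E, F] s ω := by
      cases d <;> simp [copyBit, put, effect_branch, mem_stack, effect_seq, effect_push, effect_pop]
    rw [e] at hb
    have h := Runs.loop_step (by simp [mem_stack]) hb (ih _)
      (T'' := (copyBit.cost + 1) * (d :: x).length + 1)
      (by simp only [List.length_cons]; ring_nf; omega)
    convert h using 3
    rw [pack_cons_append]

/-- Add a random bit to the next bit of the input. -/
def shiftBit : Prog :=
  .seq (.pop 4) (.seq (.flip 7) (.seq (.branch 7 .skip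
    (.seq (put true true false false)
      (.branch 0 .skip (put false false false false) (put false false false true)))
    (.seq (put true true false true)
      (.branch 0 .skip (put false false false true) (put false false false false))))
    (.seq (.pop 7) (.pop 0))))

/-- Add a random bit to the diagonal entry of a row of coefficients, and copy the rest. -/
def shiftRow : Prog :=
  .seq shiftBit (.seq (.loop 5 countBit) (.seq (moveStack 6 5) (.push 5 true)))

/-- One coin serves both as the bit `z i` of the target and as the change of the coefficient of `x
i`. Stack `5` counts the rest of the row; its marks are moved to stack `6` and back, and one more
makes the count for the next, longer row. After all rows it holds `n` marks, from which the number
of index bits is made. -/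
theorem shiftRow_runs (a : Bool) (l x o N E F : List Bool) (ω : ℕ → Bool) :
    Runs O B shiftRow
      (mem [a :: l ++ x, [], o, [], true :: N, List.replicate l.length true, [], [], [], [], E, F]
        s ω) (shiftBit.cost + (countBit.cost + 7) * l.length + 3)
      (mem [x, [], pack false false false ((a ^^ ω 0) :: l) ++ (pack true true false [ω 0] ++ o),
        [], N, List.replicate (l.length + 1) true, [], [], [], [], E, F] s (dropCoins 1 ω)) := by
  have h₁ := Prog.Straight.runs (P := shiftBit) (O := O) (B := B)
    (by simp [shiftBit, put, Prog.Straight])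
    (mem [a :: l ++ x, [], o, [], true :: N, List.replicate l.length true, [], [], [], [], E, F] s ω)
  have e : shiftBit.effect (mem [a :: l ++ x, [], o, [], true :: N, List.replicate l.length true,
      [], [], [], [], E, F] s ω) = mem [l ++ x, [], false :: false :: false :: (a ^^ ω 0) ::
        (pack true true false [ω 0] ++ o), [], N, List.replicate l.length true, [], [], [], [], E,
        F] s (dropCoins 1 ω) := by
    cases h : ω 0 <;> cases a <;>
    simp [h, shiftBit, put, effect_branch, mem_stack, effect_seq, effect_push, effect_pop,
      effect_flip, pack]
  rw [e] at h₁
  have h₂ := countLoop_runs (O := O) (B := B) s l x (false :: false :: false :: (a ^^ ω 0) ::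
        (pack true true false [ω 0] ++ o)) N [] [] E F (dropCoins 1 ω)
  have h₃ := moveStack_runs (O := O) (B := B) (i := 6) (j := 5) (by simp) (by simp) (by simp) s
    (dropCoins 1 ω) (List.replicate l.length true) []
    [x, [], pack false false false ((a ^^ ω 0) :: l) ++ (pack true true false [ω 0] ++ o),
        [], N, [], List.replicate l.length true, [], [], [], E, F] rfl
  have h₄ := Prog.Straight.runs (P := .push 5 true) (O := O) (B := B) trivial
    (mem [x, [], pack false false false ((a ^^ ω 0) :: l) ++ (pack true true false [ω 0] ++ o),
        [], N, List.replicate l.length true, [], [], [], [], E, F] s (dropCoins 1 ω))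
  rw [← pack_cons_append] at h₂
  simp only [List.append_nil, List.set_cons_succ, List.set_cons_zero, List.reverse_replicate,
    effect_push, List.length_cons, List.length_nil, Nat.reduceAdd, Nat.reduceLT,
    List.getD_cons_succ, List.getD_cons_zero, ← List.replicate_succ] at h₂ h₃ h₄
  refine (h₁.seq (h₂.seq (h₃.seq h₄))).mono ?_
  simp only [Prog.cost, List.length_replicate]; ring_nf; omega

/-- Add bits to the diagonal entries of the rows of coefficients. -/
def shiftRows : List (Bool × List Bool) → (ℕ → Bool) → List Bool
  | [], _ => []
  | r :: R, ω => (r.1 ^^ ω 0) :: r.2 ++ shiftRows R (dropCoins 1 ω)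

/-- The rows of coefficients as a list of bits. -/
def joinRows : List (Bool × List Bool) → List Bool
  | [] => []
  | r :: R => r.1 :: r.2 ++ joinRows R

/-- The lengths of the rows increase by one from row to row, starting with `i`. -/
def RowsFrom : ℕ → List (Bool × List Bool) → Prop
  | _, [] => True
  | i, r :: R => r.2.length = i ∧ RowsFrom (i + 1) R

theorem shiftLoop_runs (R : List (Bool × List Bool)) (i : ℕ) (hR : RowsFrom i R)
    (x o X Z E F : List Bool) (ω : ℕ → Bool) (ho : IsInput o X Z) : ∃ o',
    IsInput o' (X ++ shiftRows R ω) (Z ++ coinList R.length ω) ∧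
    Runs O B (.loop 4 shiftRow)
      (mem [joinRows R ++ x, [], o, [], List.replicate R.length true, List.replicate i true, [],
        [], [], [], E, F] s ω)
      (R.length * (shiftBit.cost + (countBit.cost + 7) * (i + R.length) + 4) + 1)
      (mem [x, [], o', [], [], List.replicate (i + R.length) true, [], [], [], [], E, F] s
        (dropCoins R.length ω)) := by
  induction R generalizing i o X Z ω with
  | nil =>
    exact ⟨o, by simpa [shiftRows, coinList] using ho,
      Runs.loop_stop (by simp) (by simp [mem_stack])⟩
  | cons r R ih =>
    obtain ⟨a, l⟩ := r
    obtain ⟨rfl, hR⟩ := hR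
    simp only [] at hR
    have h₁ := shiftRow_runs (O := O) (B := B) s a l (joinRows R ++ x) o
      (List.replicate R.length true) E F ω
    obtain ⟨o', ho', h₂⟩ := ih (l.length + 1) hR _ _ _ (dropCoins 1 ω)
      ((ho.pack_z [ω 0]).pack_x ((a ^^ ω 0) :: l))
    refine ⟨o', ?_, ?_⟩
    · simpa [shiftRows, coinList_succ] using ho'
    · have h := Runs.loop_step (by simp [mem_stack]) h₁ h₂ (T'' := ((a, l) :: R).length *
        (shiftBit.cost + (countBit.cost + 7) * (l.length + ((a, l) :: R).length) + 4) + 1) ?_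
      · convert h using 2
        · simp [joinRows, List.replicate_succ]
        · simp [add_assoc, add_comm 1]
        · simp
      · simp only [List.length_cons]
        generalize R.length = y
        ring_nf; omega

/-- Read the input, add random bits to the linear coefficients, and write the result, and the
random bits, on the query tape. -/
def readInput : Prog :=
  .seq (.push 3 true) (.seq (.loop 3 unaryStep) (.seq (.loop 4 shiftRow) (.loop 0 copyBit)))

theorem readInput_runs (R : List (Bool × List Bool)) (hR : RowsFrom 0 R) (x : List Bool)
    (ω : ℕ → Bool) : ∃ o,
    IsInput o (unary R.length ++ shiftRows R ω ++ x) (coinList R.length ω) ∧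
    Runs O B readInput
      (mem [unary R.length ++ joinRows R ++ x, [], [], [], [], [], [], [], [], [], [], []] s ω)
      ((unaryStep.cost + shiftBit.cost + countBit.cost + copyBit.cost + 20) *
        ((R.length + 1) ^ 2 + x.length))
      (mem [[], [], o, [], [], List.replicate R.length true, [], [], [], [],
        List.replicate R.length true, List.replicate R.length true] s
        (dropCoins R.length ω)) := by
  have h₀ := Prog.Straight.runs (P := .push 3 true) (O := O) (B := B) trivial
    (mem [unary R.length ++ joinRows R ++ x, [], [], [], [], [], [], [], [], [], [], []] s ω)
  have h₁ := unaryLoop_runs (O := O) (B := B) s R.length (joinRows R ++ x) [] [] [] [] ω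
  obtain ⟨o, ho, h₂⟩ := shiftLoop_runs (O := O) (B := B) s R 0 hR x
    (pack false false false (unary R.length) ++ []) (unary R.length) []
    (List.replicate R.length true ++ []) (List.replicate R.length true ++ []) ω (by
      simpa using isInput_nil.pack_x (unary R.length))
  have h₃ := copyLoop_runs (O := O) (B := B) s x o [] (List.replicate (0 + R.length) true) []
    (List.replicate R.length true ++ []) (List.replicate R.length true ++ [])
    (dropCoins R.length ω)
  refine ⟨_, by simpa using ho.pack_x x, ?_⟩
  simp only [List.append_nil, zero_add, List.replicate_zero, List.set_cons_succ,
    List.set_cons_zero, List.getD_cons_succ, List.getD_cons_zero, effect_push, List.length_cons,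
    List.length_nil, Nat.reduceAdd, Nat.reduceLT, List.append_assoc] at h₀ h₁ h₂ h₃ ⊢
  refine (h₀.seq (h₁.seq (h₂.seq h₃))).mono ?_
  simp only [Prog.cost]
  generalize R.length = y
  generalize x.length = y'
  generalize unaryStep.cost = c₁
  generalize shiftBit.cost = c₂
  generalize countBit.cost = c₃
  generalize copyBit.cost = c₄
  ring_nf
  nlinarith [Nat.zero_le (c₁ * y), Nat.zero_le (c₁ * y ^ 2), Nat.zero_le (c₁ * y'),
    Nat.zero_le (c₂ * y), Nat.zero_le (c₂ * y ^ 2), Nat.zero_le (c₂ * y'),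
    Nat.zero_le (c₃ * y), Nat.zero_le (c₃ * y ^ 2), Nat.zero_le (c₃ * y'),
    Nat.zero_le (c₄ * y), Nat.zero_le (c₄ * y ^ 2), Nat.zero_le (c₄ * y')]

end

end FineGrained

/-! ### Measuring the running time with the oracle, drawing a seed, counting the hits. -/

namespace FineGrained

open scoped Classical

variable {O : Set (List Bool)} {B : ℕ}

/-! # The estimator: finding the running time -/

/-- Let the clock of the query tick once more, and ask whether it runs out. -/
def haltStep : Prog :=
  .seq (.seq (.pop 3) (.seq (put false true true false) (.push 8 true)))
    (.seq (.query 3) (.branch 3 .skip (.pop 3) .skip))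

/-- The constant tag of items whose data are guesses. -/
def guessItems (k : ℕ) : List Bool := pack false true true (List.replicate k false)

theorem guessItems_succ (k : ℕ) :
    guessItems (k + 1) = false :: true :: true :: false :: guessItems k := by
  rw [guessItems, List.replicate_succ', pack_append_singleton]; rfl

theorem replicate_append_cons_self (k : ℕ) (b : Bool) (l : List Bool) :
    List.replicate k b ++ b :: l = List.replicate (k + 1) b ++ l := by
  simp [List.replicate_succ']

theorem Runs.query_three (L : List (List Bool)) (hL : 3 < L.length) (s : ℕ → List Bool)
    (ω : ℕ → Bool) (hB : (L.getD 2 []).length ≤ B) :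
    Runs O B (.query 3) (mem L s ω) 1
      (mem (L.set 3 (decide (L.getD 2 [] ∈ O) :: L.getD 3 [])) s ω) := by
  have h := Exec.query (O := O) (B := B) 3 (mem L s ω) (by rwa [mem_stack _ _ _ (by simp)])
  rw [mem_set _ _ _ _ (by simp) hL, mem_stack _ _ _ (by simp), mem_stack _ _ _ (by simp)] at h
  exact ⟨1, le_rfl, h⟩

section

variable (s : ℕ → List Bool) (ω : ℕ → Bool)

theorem haltStep_runs (o C k E F : List Bool) (hB : o.length + 4 ≤ B) :
    Runs O B haltStep (mem [[], [], o, [true], [], C, [], [], k, [], E, F] s ω) haltStep.cost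
      (mem [[], [], false :: true :: true :: false :: o,
        if false :: true :: true :: false :: o ∈ O then [true] else [], [], C, [], [], true :: k,
        [], E, F] s ω) := by
  have h₁ := Prog.Straight.runs (P := .seq (.pop 3) (.seq (put false true true false)
      (.push 8 true))) (O := O) (B := B) (by simp [put, Prog.Straight])
    (mem [[], [], o, [true], [], C, [], [], k, [], E, F] s ω)
  simp only [put, effect_seq, effect_pop, effect_push, List.set_cons_succ, List.set_cons_zero,
    List.getD_cons_succ, List.getD_cons_zero, List.length_cons, List.length_nil, Nat.reduceAdd,
    Nat.reduceLT, List.tail_cons] at h₁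
  have h₂ := Runs.query_three (O := O) (B := B) [[], [], false :: true :: true :: false :: o, [],
    [], C, [], [], true :: k, [], E, F] (by simp) s ω (by simp; omega)
  have h₃ := Prog.Straight.runs (P := .branch 3 .skip (.pop 3) .skip) (O := O) (B := B)
    (by simp [Prog.Straight]) (mem [[], [], false :: true :: true :: false :: o,
      [decide (false :: true :: true :: false :: o ∈ O)], [], C, [], [], true :: k, [], E, F] s ω)
  have h := h₁.seq (h₂.seq h₃)
  convert (show Runs O B haltStep _ haltStep.cost _ from h) using 1
  by_cases hO : false :: true :: true :: false :: o ∈ O <;>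
  simp [hO, effect_branch, mem_stack, effect_pop, effect_skip]

/-- Linear search for the running time: each round adds an item, hence a tick and a guessed coin,
before it asks. The first negative answer comes at `t` items. In the induction, `d + 1` is the
number of rounds still to come. -/
theorem haltLoop_runs {t : ℕ} (o C E F : List Bool)
    (hO : ∀ k, 1 ≤ k → k ≤ t → (guessItems k ++ o ∈ O ↔ k < t)) (hB : 4 * t + o.length ≤ B)
    (d k : ℕ) (hk : k + d + 1 = t) :
    Runs O B (.loop 3 haltStep) (mem [[], [], guessItems k ++ o, [true], [], C, [], [],
        List.replicate k true, [], E, F] s ω) ((haltStep.cost + 1) * (d + 1) + 1)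
      (mem [[], [], guessItems t ++ o, [], [], C, [], [], List.replicate t true, [], E, F] s ω) := by
  induction d generalizing k with
  | zero =>
    have h := haltStep_runs (O := O) (B := B) s ω (guessItems k ++ o) C (List.replicate k true) E F
      (by simp [guessItems]; omega)
    have hO' := hO (k + 1) (by omega) (by omega)
    rw [guessItems_succ, List.cons_append, List.cons_append, List.cons_append,
      List.cons_append] at hO'
    rw [if_neg (fun h => by simpa [← hk] using hO'.1 h)] at h
    subst hk
    rw [guessItems_succ, List.replicate_succ]
    exact Runs.loop_step (by simp [mem_stack]) h (Runs.loop_stop le_rfl (by simp [mem_stack]))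
      (by simp)
  | succ d ih =>
    have h := haltStep_runs (O := O) (B := B) s ω (guessItems k ++ o) C (List.replicate k true) E F
      (by simp [guessItems]; omega)
    have hO' := hO (k + 1) (by omega) (by omega)
    rw [guessItems_succ, List.cons_append, List.cons_append, List.cons_append,
      List.cons_append] at hO'
    rw [if_pos (hO'.2 (by omega))] at h
    have h' := ih (k + 1) (by omega)
    rw [guessItems_succ, List.replicate_succ] at h'
    exact Runs.loop_step (by simp [mem_stack]) h h' (by ring_nf; omega)

/-- Remove the last item from the query tape. -/
def dropItem : Prog := .seq (.pop 2) (.seq (.pop 2) (.seq (.pop 2) (.pop 2)))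

/-- Remove the last item from the query tape, and move the mark that counts it. -/
def uncountItem : Prog := .seq (.pop 8) (.seq dropItem (.push 9 true))

/-- The query tape is restored to input and target, and the measured time goes to stack `9`, where
further marks turn it into the length of the seed. -/
theorem uncountLoop_runs (k : ℕ) (o C l E F : List Bool) :
    Runs O B (.loop 8 uncountItem) (mem [[], [], guessItems k ++ o, [], [], C, [], [],
        List.replicate k true, l, E, F] s ω) ((uncountItem.cost + 1) * k + 1)
      (mem [[], [], o, [], [], C, [], [], [], List.replicate k true ++ l, E, F] s ω) := by
  induction k generalizing l with
  | zero => exact Runs.loop_stop (by simp) (by simp [mem_stack])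
  | succ k ih =>
    have hb := Prog.Straight.runs (P := uncountItem) (O := O) (B := B)
      (by simp [uncountItem, dropItem, Prog.Straight])
      (mem [[], [], guessItems (k + 1) ++ o, [], [], C, [], [], List.replicate (k + 1) true, l, E,
        F] s ω)
    simp only [uncountItem, dropItem, effect_seq, effect_pop, effect_push, List.set_cons_succ,
      List.set_cons_zero, List.getD_cons_succ, List.getD_cons_zero, List.length_cons,
      List.length_nil, Nat.reduceAdd, Nat.reduceLT, List.tail_cons, guessItems_succ,
      List.cons_append, List.replicate_succ] at hb
    have h := Runs.loop_step (by simp [mem_stack]) hb (ih (true :: l))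
      (T'' := (uncountItem.cost + 1) * (k + 1) + 1) (by
        rw [show (Prog.seq (.pop 8) (.seq (.seq (.pop 2) (.seq (.pop 2) (.seq (.pop 2) (.pop 2))))
          (.push 9 true))).cost = uncountItem.cost from rfl]
        ring_nf; omega)
    rw [replicate_append_cons_self] at h
    rwa [guessItems_succ, List.replicate_succ (n := k), List.cons_append, List.cons_append,
      List.cons_append, List.cons_append]

/-! # The estimator: the final queries -/

/-- Run `P` as often as indicated. -/
def Prog.times (P : Prog) : ℕ → Prog
  | 0 => .skip
  | n + 1 => .seq P (P.times n)

theorem pushTimes_runs (r : ℕ) (o C l E F : List Bool) :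
    Runs O B ((Prog.push 9 true).times r) (mem [[], [], o, [], [], C, [], [], [], l, E, F] s ω)
      (r + 1) (mem [[], [], o, [], [], C, [], [], [], List.replicate r true ++ l, E, F] s ω) := by
  induction r generalizing l with
  | zero => exact ⟨1, le_rfl, .skip _⟩
  | succ r ih =>
    have hb := Prog.Straight.runs (P := .push 9 true) (O := O) (B := B) trivial
      (mem [[], [], o, [], [], C, [], [], [], l, E, F] s ω)
    rw [effect_push true (by simp) (by simp)] at hb
    have h := (hb.seq (ih (true :: l))).mono (T' := r + 1 + 1) (by simp [Prog.cost]; omega)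
    rwa [replicate_append_cons_self] at h

theorem popTimes_five_runs (j : ℕ) (o C l E F : List Bool) :
    Runs O B ((Prog.pop 5).times j) (mem [[], [], o, [], [], C, [], [], [], l, E, F] s ω)
      (j + 1) (mem [[], [], o, [], [], C.drop j, [], [], [], l, E, F] s ω) := by
  induction j generalizing C with
  | zero => exact ⟨1, le_rfl, .skip _⟩
  | succ j ih =>
    have hb := Prog.Straight.runs (P := .pop 5) (O := O) (B := B) trivial
      (mem [[], [], o, [], [], C, [], [], [], l, E, F] s ω)
    rw [effect_pop (by simp) (by simp)] at hb
    have h := (hb.seq (ih C.tail)).mono (T' := j + 1 + 1) (by simp [Prog.cost]; omega)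
    rwa [List.drop_tail] at h

/-- Write an item that asks for a guess. -/
def guessIndexBit : Prog := .seq (.pop 5) (put true false true false)

theorem guessLoop_runs (m : ℕ) (o l E F : List Bool) :
    Runs O B (.loop 5 guessIndexBit)
      (mem [[], [], o, [], [], List.replicate m true, [], [], [], l, E, F] s ω)
      ((guessIndexBit.cost + 1) * m + 1)
      (mem [[], [], pack true false true (List.replicate m false) ++ o, [], [], [], [], [], [], l,
        E, F] s ω) := by
  induction m generalizing o with
  | zero => exact Runs.loop_stop (by simp) (by simp [mem_stack])
  | succ m ih =>
    have hb := Prog.Straight.runs (P := guessIndexBit) (O := O) (B := B)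
      (by simp [guessIndexBit, put, Prog.Straight])
      (mem [[], [], o, [], [], List.replicate (m + 1) true, [], [], [], l, E, F] s ω)
    have e : guessIndexBit.effect
        (mem [[], [], o, [], [], List.replicate (m + 1) true, [], [], [], l, E, F] s ω) =
        mem [[], [], true :: false :: true :: false :: o, [], [], List.replicate m true, [], [],
          [], l, E, F] s ω := by
      simp [guessIndexBit, put, List.replicate_succ, effect_seq, effect_pop, effect_push]
    rw [e] at hb
    have h := Runs.loop_step (by simp [mem_stack, List.replicate_succ]) hb (ih _)
      (T'' := (guessIndexBit.cost + 1) * (m + 1) + 1) (by ring_nf; omega)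
    convert h using 3
    rw [List.replicate_succ, pack_cons_append]

/-- Write a random bit of the first part of the seed. -/
def seedBitT : Prog := .seq (.pop 9) (.seq (.push 6 true) (putFlip false false true))

/-- Write a random bit of the second part of the seed. -/
def seedBitR : Prog := .seq (.pop 6) (putFlip false true false)

/-- The marks are kept on stack `6`, so that the second half of the seed gets the same length. -/
theorem seedLoopT_runs (k : ℕ) (o D E F : List Bool) :
    Runs O B (.loop 9 seedBitT)
      (mem [[], [], o, [], [], [], D, [], [], List.replicate k true, E, F] s ω)
      ((seedBitT.cost + 1) * k + 1)
      (mem [[], [], pack false false true (coinList k ω) ++ o, [], [], [],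
        List.replicate k true ++ D, [], [], [], E, F] s (dropCoins k ω)) := by
  induction k generalizing o D ω with
  | zero => exact Runs.loop_stop (by simp) (by simp [mem_stack])
  | succ k ih =>
    have hb := Prog.Straight.runs (P := seedBitT) (O := O) (B := B)
      (by simp [seedBitT, putFlip, Prog.Straight])
      (mem [[], [], o, [], [], [], D, [], [], List.replicate (k + 1) true, E, F] s ω)
    have e : seedBitT.effect
        (mem [[], [], o, [], [], [], D, [], [], List.replicate (k + 1) true, E, F] s ω) =
        mem [[], [], false :: false :: true :: ω 0 :: o, [], [], [], true :: D, [], [],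
          List.replicate k true, E, F] s (dropCoins 1 ω) := by
      simp [seedBitT, putFlip, List.replicate_succ, effect_seq, effect_pop, effect_push,
        effect_flip]
    rw [e] at hb
    have h := Runs.loop_step (by simp [mem_stack, List.replicate_succ]) hb (ih _ _ _)
      (T'' := (seedBitT.cost + 1) * (k + 1) + 1) (by ring_nf; omega)
    convert h using 2
    · rw [coinList_succ, pack_cons_append]
      rw [replicate_append_cons_self]
    · simp

theorem seedLoopR_runs (k : ℕ) (o E F : List Bool) :
    Runs O B (.loop 6 seedBitR)
      (mem [[], [], o, [], [], [], List.replicate k true, [], [], [], E, F] s ω)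
      ((seedBitR.cost + 1) * k + 1)
      (mem [[], [], pack false true false (coinList k ω) ++ o, [], [], [], [], [], [], [], E, F] s
        (dropCoins k ω)) := by
  induction k generalizing o ω with
  | zero => exact Runs.loop_stop (by simp) (by simp [mem_stack])
  | succ k ih =>
    have hb := Prog.Straight.runs (P := seedBitR) (O := O) (B := B)
      (by simp [seedBitR, putFlip, Prog.Straight])
      (mem [[], [], o, [], [], [], List.replicate (k + 1) true, [], [], [], E, F] s ω)
    have e : seedBitR.effect
        (mem [[], [], o, [], [], [], List.replicate (k + 1) true, [], [], [], E, F] s ω) =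
        mem [[], [], false :: true :: false :: ω 0 :: o, [], [], [], List.replicate k true, [], [],
          [], E, F] s (dropCoins 1 ω) := by
      simp [seedBitR, putFlip, List.replicate_succ, effect_seq, effect_pop, effect_push,
        effect_flip]
    rw [e] at hb
    have h := Runs.loop_step (by simp [mem_stack, List.replicate_succ]) hb (ih _ _)
      (T'' := (seedBitR.cost + 1) * (k + 1) + 1) (by ring_nf; omega)
    convert h using 2
    · rw [coinList_succ, pack_cons_append]
    · simp

/-- Ask a query for every string of length `r`, and count the positive answers on stack `8`. -/
def queryAll : ℕ → Prog
  | 0 => .seq (.query 3) (.seq (.branch 3 .skip .skip (.push 8 true)) (.pop 3))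
  | r + 1 => .seq (.seq (put true false false false) (.seq (queryAll r) dropItem))
      (.seq (put true false false true) (.seq (queryAll r) dropItem))

/-- The number of positive answers. -/
noncomputable def answerCount (O : Set (List Bool)) (o : List Bool) : ℕ → List Bool → ℕ
  | 0, σ => if pack true false false σ ++ o ∈ O then 1 else 0
  | r + 1, σ => answerCount O o r (σ ++ [false]) + answerCount O o r (σ ++ [true])

/-- A depth-first walk through the binary tree of prefixes, with each item removed after its
subtree. As `r` is a constant, the recursion is unrolled in the program and its cost is a constant.
-/
theorem queryAll_runs (r : ℕ) (o σ c E F : List Bool)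
    (hB : 4 * (σ.length + r) + o.length ≤ B) :
    Runs O B (queryAll r)
      (mem [[], [], pack true false false σ ++ o, [], [], [], [], [], c, [], E, F] s ω)
      (queryAll r).cost
      (mem [[], [], pack true false false σ ++ o, [], [], [], [], [],
        List.replicate (answerCount O o r σ) true ++ c, [], E, F] s ω) := by
  induction r generalizing σ c with
  | zero =>
    have h₂ := Runs.query_three (O := O) (B := B) [[], [], pack true false false σ ++ o, [],
      [], [], [], [], c, [], E, F] (by simp) s ω (by simpa using hB)
    have h₃ := Prog.Straight.runs (P := .seq (.branch 3 .skip .skip (.push 8 true)) (.pop 3))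
      (O := O) (B := B) (by simp [Prog.Straight]) (mem [[], [], pack true false false σ ++ o,
        [decide (pack true false false σ ++ o ∈ O)], [], [], [], [], c, [], E, F] s ω)
    have h := h₂.seq h₃
    convert (show Runs O B (queryAll 0) _ (queryAll 0).cost _ from h) using 1
    by_cases hO : pack true false false σ ++ o ∈ O <;>
    simp [hO, effect_branch, mem_stack, effect_pop, effect_push, effect_skip, answerCount,
      effect_seq]
  | succ r ih =>
    have hp : ∀ (b : Bool) (c : List Bool), Runs O B (put true false false b)
        (mem [[], [], pack true false false σ ++ o, [], [], [], [], [], c, [], E, F] s ω) 4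
        (mem [[], [], pack true false false (σ ++ [b]) ++ o, [], [], [], [], [], c, [], E, F]
          s ω) := fun b c => by
      have := Prog.Straight.runs (P := put true false false b) (O := O) (B := B)
        (by simp [put, Prog.Straight])
        (mem [[], [], pack true false false σ ++ o, [], [], [], [], [], c, [], E, F] s ω)
      simpa [put, effect_seq, effect_push, pack_append_singleton, Prog.cost] using this
    have hd : ∀ (b : Bool) (c : List Bool), Runs O B dropItem
        (mem [[], [], pack true false false (σ ++ [b]) ++ o, [], [], [], [], [], c, [], E, F]
          s ω) 4
        (mem [[], [], pack true false false σ ++ o, [], [], [], [], [], c, [], E, F] s ω) :=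
      fun b c => by
      have := Prog.Straight.runs (P := dropItem) (O := O) (B := B)
        (by simp [dropItem, Prog.Straight])
        (mem [[], [], pack true false false (σ ++ [b]) ++ o, [], [], [], [], [], c, [], E, F] s ω)
      simpa [dropItem, effect_seq, effect_pop, pack_append_singleton, Prog.cost] using this
    have h₁ := ih (σ ++ [false]) c (by simp; omega)
    have h₂ := ih (σ ++ [true]) (List.replicate (answerCount O o r (σ ++ [false])) true ++ c)
      (by simp; omega)
    have h := ((hp _ _).seq (h₁.seq (hd _ _))).seq ((hp _ _).seq (h₂.seq (hd _ _)))
    convert (show Runs O B (queryAll (r + 1)) _ (queryAll (r + 1)).cost _ from h) using 3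
    rw [← List.append_assoc, ← List.replicate_add, answerCount, add_comm]

/-- Write a string on the output tape. -/
def pushList : List Bool → Prog
  | [] => .skip
  | b :: l => .seq (pushList l) (.push 1 b)

theorem pushList_runs (l y o c E F : List Bool) :
    Runs O B (pushList l) (mem [[], y, o, [], [], [], [], [], c, [], E, F] s ω) (pushList l).cost
      (mem [[], l ++ y, o, [], [], [], [], [], c, [], E, F] s ω) := by
  induction l with
  | nil => exact ⟨1, le_rfl, .skip _⟩
  | cons b l ih =>
    have hb := Prog.Straight.runs (P := .push 1 b) (O := O) (B := B) trivial
      (mem [[], l ++ y, o, [], [], [], [], [], c, [], E, F] s ω)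
    rw [effect_push b (by simp) (by simp)] at hb
    exact ih.seq hb

/-- The binary digits of a number, least significant digit first. -/
def binary (k : ℕ) : List Bool := (Nat.digits 2 k).map (· == 1)

theorem decodeNat_binary (k : ℕ) : decodeNat (binary k) = k := by
  rw [decodeNat, binary, List.map_map]
  conv_rhs => rw [← Nat.ofDigits_digits 2 k]
  congr 1
  conv_rhs => rw [← List.map_id (Nat.digits 2 k)]
  refine List.map_congr_left fun d hd => ?_
  have := Nat.digits_lt_base (m := k) one_lt_two hd
  interval_cases d <;> rfl

/-- Write `k` plus the number of marks on stack `8` in binary. -/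
def writeCount : ℕ → ℕ → Prog
  | 0, k => pushList (binary k)
  | d + 1, k => .branch 8 (pushList (binary k)) .skip (.seq (.pop 8) (writeCount d (k + 1)))

/-- The count is bounded by a constant, so the program contains the binary expansions of all
possible values and needs no arithmetic. -/
theorem writeCount_runs (d k c : ℕ) (hc : c ≤ d) (o E F : List Bool) : ∃ c',
    Runs O B (writeCount d k)
      (mem [[], [], o, [], [], [], [], [], List.replicate c true, [], E, F] s ω)
      (writeCount d k).cost (mem [[], binary (k + c), o, [], [], [], [], [], c', [], E, F] s ω) := by
  induction d generalizing k c with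
  | zero =>
    obtain rfl : c = 0 := by omega
    exact ⟨_, by simpa [writeCount] using pushList_runs (O := O) (B := B) s ω (binary k) [] o [] E F⟩
  | succ d ih =>
    rcases c with - | c
    · obtain ⟨t, ht, h⟩ := pushList_runs (O := O) (B := B) s ω (binary k) [] o [] E F
      exact ⟨_, t + 1, by simp only [writeCount, Prog.cost]; omega,
        .branch_empty (by simp [mem_stack]) (by simpa using h)⟩
    · obtain ⟨c', h⟩ := ih (k + 1) c (by omega)
      have hb := Prog.Straight.runs (P := .pop 8) (O := O) (B := B) trivial
        (mem [[], [], o, [], [], [], [], [], List.replicate (c + 1) true, [], E, F] s ω)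
      rw [effect_pop (by simp) (by simp)] at hb
      obtain ⟨t, ht, h⟩ := hb.seq h
      refine ⟨c', t + 1, by simp only [writeCount, Prog.cost] at ht ⊢; omega,
        .branch_true (l := List.replicate c true) (by simp [mem_stack, List.replicate_succ]) ?_⟩
      rwa [add_assoc, add_comm 1] at h

theorem popTimes_eleven_runs (j : ℕ) (y o c E F : List Bool) :
    Runs O B ((Prog.pop 11).times j) (mem [[], y, o, [], [], [], [], [], c, [], E, F] s ω)
      (j + 1) (mem [[], y, o, [], [], [], [], [], c, [], E, F.drop j] s ω) := by
  induction j generalizing F with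
  | zero => exact ⟨1, le_rfl, .skip _⟩
  | succ j ih =>
    have hb := Prog.Straight.runs (P := .pop 11) (O := O) (B := B) trivial
      (mem [[], y, o, [], [], [], [], [], c, [], E, F] s ω)
    rw [effect_pop (by simp) (by simp)] at hb
    have h := (hb.seq (ih F.tail)).mono (T' := j + 1 + 1) (by simp [Prog.cost]; omega)
    rwa [List.drop_tail] at h

/-- Write a digit `0`. -/
def writeZero : Prog := .seq (.pop 11) (.push 1 false)

theorem zeroLoop_runs (k : ℕ) (y o c E : List Bool) :
    Runs O B (.loop 11 writeZero)
      (mem [[], y, o, [], [], [], [], [], c, [], E, List.replicate k true] s ω)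
      ((writeZero.cost + 1) * k + 1)
      (mem [[], List.replicate k false ++ y, o, [], [], [], [], [], c, [], E, []] s ω) := by
  induction k generalizing y with
  | zero => exact Runs.loop_stop (by simp) (by simp [mem_stack])
  | succ k ih =>
    have hb := Prog.Straight.runs (P := writeZero) (O := O) (B := B)
      (by simp [writeZero, Prog.Straight])
      (mem [[], y, o, [], [], [], [], [], c, [], E, List.replicate (k + 1) true] s ω)
    have e : writeZero.effect
        (mem [[], y, o, [], [], [], [], [], c, [], E, List.replicate (k + 1) true] s ω) =
        mem [[], false :: y, o, [], [], [], [], [], c, [], E, List.replicate k true] s ω := by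
      simp [writeZero, List.replicate_succ, effect_seq, effect_pop, effect_push]
    rw [e] at hb
    have h := Runs.loop_step (by simp [mem_stack, List.replicate_succ]) hb (ih _)
      (T'' := (writeZero.cost + 1) * (k + 1) + 1) (by ring_nf; omega)
    rwa [replicate_append_cons_self] at h

/-- Numbers are written with the least significant digit first. The zeros rescale the count by a
power of two, which depends on `n` and cannot be part of the program. -/
theorem decodeNat_zeros (k : ℕ) (y : List Bool) :
    decodeNat (List.replicate k false ++ y) = 2 ^ k * decodeNat y := by
  induction k with
  | zero => simp
  | succ k ih =>
    rw [decodeNat] at ih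
    simp only [decodeNat, List.replicate_succ, List.cons_append, List.map_cons, Nat.ofDigits_cons,
      ih]
    simp [pow_succ]; ring

theorem answerCount_le (o : List Bool) (r : ℕ) (σ : List Bool) : answerCount O o r σ ≤ 2 ^ r := by
  induction r generalizing σ with
  | zero => rw [answerCount]; split <;> simp
  | succ r ih => rw [answerCount, pow_succ]; linarith [ih (σ ++ [false]), ih (σ ++ [true])]

end

end FineGrained

/-! ### The whole estimator. -/

namespace FineGrained

open scoped Classical

variable {O : Set (List Bool)} {B : ℕ}

/-- The estimator: it shifts the polynomial at random, finds a bound on the running time of the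
sampler, chooses a seed at random, and counts the positive answers to the queries with the `2 ^ r`
possible prefixes of the index. -/
def estimator (r j e : ℕ) : Prog :=
  .seq readInput <| .seq (.push 3 true) <| .seq (.loop 3 haltStep) <| .seq (.loop 8 uncountItem) <|
  .seq (moveStack 10 9) <| .seq ((Prog.push 9 true).times r) <| .seq ((Prog.pop 5).times j) <|
  .seq (.loop 5 guessIndexBit) <| .seq (.loop 9 seedBitT) <| .seq (.loop 6 seedBitR) <|
  .seq (put true true true false) <| .seq (queryAll r) <| .seq (writeCount (2 ^ r) 0) <|
  .seq ((Prog.pop 11).times e) (.loop 11 writeZero)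

/-- The query with the seed `(t, r)` that asks for `m` bits of the index to be guessed. -/
def seedQuery (o : List Bool) (m : ℕ) (t r : List Bool) : List Bool :=
  pack true true true [false] ++ (pack false true false r ++ (pack false false true t ++
    (pack true false true (List.replicate m false) ++ o)))

theorem joinRows_length {i : ℕ} {R : List (Bool × List Bool)} (hR : RowsFrom i R)
    (ω : ℕ → Bool) : (shiftRows R ω).length = (joinRows R).length ∧
      (joinRows R).length ≤ R.length * (i + R.length) := by
  induction R generalizing i ω with
  | nil => simp [shiftRows, joinRows]
  | cons r R ih =>
    obtain ⟨rfl, hR⟩ := hR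
    obtain ⟨h₁, h₂⟩ := ih hR (dropCoins 1 ω)
    simp only [shiftRows, joinRows, List.length_cons, List.length_append, List.cons_append]
    refine ⟨by omega, ?_⟩
    nlinarith

-- The coins are consumed in this order: `n` for the shift, then `r + (n + T)` for each half of the
-- seed. `T` is not an input: it is determined by the answers of the oracle to the clock queries.
-- The same expression bounds the running time and suffices as a bound on the query lengths.
set_option maxHeartbeats 1000000 in
theorem estimator_runs (r j e : ℕ) : ∃ C : ℕ, ∀ (O : Set (List Bool)) (B : ℕ)
    (R : List (Bool × List Bool)) (x : List Bool) (ω : ℕ → Bool) (T : ℕ),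
    RowsFrom 0 R → 1 ≤ T →
    (∀ o, IsInput o (unary R.length ++ shiftRows R ω ++ x) (coinList R.length ω) →
      ∀ k, 1 ≤ k → k ≤ T → (guessItems k ++ o ∈ O ↔ k < T)) →
    C * ((R.length + 1) ^ 2 + x.length + T) ≤ B →
    ∃ o, IsInput o (unary R.length ++ shiftRows R ω ++ x) (coinList R.length ω) ∧
      ∃ m, Runs O B (estimator r j e) (Mem.init (unary R.length ++ joinRows R ++ x) ω)
        (C * ((R.length + 1) ^ 2 + x.length + T)) m ∧
        m.stack 1 = List.replicate (R.length - e) false ++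
          binary (answerCount O (seedQuery o (R.length - j)
            (coinList (r + (R.length + T)) (dropCoins R.length ω))
            (coinList (r + (R.length + T)) (dropCoins (r + (R.length + T) + R.length) ω))) r []) := by
  -- The costs of all loop bodies, with ample slack; what matters is that only `r`, `j` and `e`
  -- occur.
  refine ⟨(unaryStep.cost + shiftBit.cost + countBit.cost + copyBit.cost + haltStep.cost +
    uncountItem.cost + guessIndexBit.cost + (seedBitT.cost + seedBitR.cost) * (r + 1) +
    (queryAll r).cost + (writeCount (2 ^ r) 0).cost + writeZero.cost) + (20 * r + j + e + 200), ?_⟩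
  intro O B R x ω T hR hT hO hB
  obtain ⟨o, ho, h₁⟩ := readInput_runs (O := O) (B := B) (fun _ => []) R hR x ω
  refine ⟨o, ho, ?_⟩
  obtain ⟨hs, hj⟩ := joinRows_length hR ω
  have hlen := ho.1
  simp only [List.length_append, unary, List.length_replicate, List.length_singleton, hs,
    coinList_length] at hlen
  set n := R.length with hn
  set K := r + (n + T) with hK
  set t := coinList K (dropCoins n ω) with ht
  set b := coinList K (dropCoins (K + n) ω) with hb
  set M := (n + 1) ^ 2 + x.length + T with hM
  have hn₁ : n + 1 ≤ (n + 1) ^ 2 := Nat.le_self_pow two_ne_zero _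
  have hn₂ : n * (0 + n) ≤ (n + 1) ^ 2 := by nlinarith
  have hrM : r ≤ r * M := Nat.le_mul_of_pos_right _ (by omega)
  have hjM : j ≤ j * M := Nat.le_mul_of_pos_right _ (by omega)
  have heM : e ≤ e * M := Nat.le_mul_of_pos_right _ (by omega)
  have hB₁ : 20 * (r * M) + 200 * M ≤ B := by
    refine le_trans ?_ hB
    generalize unaryStep.cost + shiftBit.cost + countBit.cost + copyBit.cost + haltStep.cost +
      uncountItem.cost + guessIndexBit.cost + (seedBitT.cost + seedBitR.cost) * (r + 1) +
      (queryAll r).cost + (writeCount (2 ^ r) 0).cost + writeZero.cost = c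
    nlinarith [Nat.zero_le (c * M)]
  have hq : 4 * (0 + r) + (seedQuery o (n - j) t b).length ≤ B := by
    refine le_trans ?_ hB₁
    simp only [seedQuery, List.length_append, pack_length, List.length_singleton, hb, ht,
      coinList_length, List.length_replicate, hlen]
    have h1 : n - j ≤ n := Nat.sub_le _ _
    omega
  have hB' : 4 * T + o.length ≤ B := by
    refine le_trans ?_ hB₁
    omega
  have h₂ := Prog.Straight.runs (P := .push 3 true) (O := O) (B := B) trivial
    (mem [[], [], o, [], [], List.replicate n true, [], [], [], [], List.replicate n true,
      List.replicate n true] (fun _ => []) (dropCoins n ω))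
  rw [effect_push true (by simp) (by simp)] at h₂
  have h₃ := haltLoop_runs (O := O) (B := B) (fun _ => []) (dropCoins n ω) o (List.replicate n true)
    (List.replicate n true) (List.replicate n true) (hO o ho) hB' (T - 1) 0 (by omega)
  have h₄ := uncountLoop_runs (O := O) (B := B) (fun _ => []) (dropCoins n ω) T o
    (List.replicate n true) [] (List.replicate n true) (List.replicate n true)
  have h₅ := moveStack_runs (O := O) (B := B) (i := 10) (j := 9) (by simp) (by simp) (by simp)
    (fun _ => []) (dropCoins n ω) (List.replicate n true) (List.replicate T true)
    [[], [], o, [], [], List.replicate n true, [], [], [], [], [], List.replicate n true] rfl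
  have h₆ := pushTimes_runs (O := O) (B := B) (fun _ => []) (dropCoins n ω) r o
    (List.replicate n true) (List.replicate (n + T) true) [] (List.replicate n true)
  have h₇ := popTimes_five_runs (O := O) (B := B) (fun _ => []) (dropCoins n ω) j o
    (List.replicate n true) (List.replicate K true) [] (List.replicate n true)
  have h₈ := guessLoop_runs (O := O) (B := B) (fun _ => []) (dropCoins n ω) (n - j) o
    (List.replicate K true) [] (List.replicate n true)
  have h₉ := seedLoopT_runs (O := O) (B := B) (fun _ => []) (dropCoins n ω) K
    (pack true false true (List.replicate (n - j) false) ++ o) [] [] (List.replicate n true)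
  have h₁₀ := seedLoopR_runs (O := O) (B := B) (fun _ => []) (dropCoins (K + n) ω) K
    (pack false false true t ++ (pack true false true (List.replicate (n - j) false) ++ o)) []
    (List.replicate n true)
  have h₁₁ := Prog.Straight.runs (P := put true true true false) (O := O) (B := B)
    (by simp [put, Prog.Straight])
    (mem [[], [], pack false true false b ++ (pack false false true t ++
      (pack true false true (List.replicate (n - j) false) ++ o)), [], [], [], [], [], [], [], [],
      List.replicate n true] (fun _ => []) (dropCoins (K + (K + n)) ω))
  have h₁₂ := queryAll_runs (O := O) (B := B) (fun _ => []) (dropCoins (K + (K + n)) ω) r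
    (seedQuery o (n - j) t b) [] [] [] (List.replicate n true) hq
  obtain ⟨c', h₁₃⟩ := writeCount_runs (O := O) (B := B) (fun _ => []) (dropCoins (K + (K + n)) ω)
    (2 ^ r) 0 (answerCount O (seedQuery o (n - j) t b) r []) (answerCount_le _ _ _)
    (seedQuery o (n - j) t b) [] (List.replicate n true)
  have h₁₄ := popTimes_eleven_runs (O := O) (B := B) (fun _ => []) (dropCoins (K + (K + n)) ω) e
    (binary (answerCount O (seedQuery o (n - j) t b) r [])) (seedQuery o (n - j) t b) c' []
    (List.replicate n true)
  have h₁₅ := zeroLoop_runs (O := O) (B := B) (fun _ => []) (dropCoins (K + (K + n)) ω) (n - e)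
    (binary (answerCount O (seedQuery o (n - j) t b) r [])) (seedQuery o (n - j) t b) c' []
  simp only [List.append_nil, zero_add, List.set_cons_succ, guessItems, List.replicate_zero, pack,
    List.set_cons_zero, List.getD_cons_succ, List.getD_cons_zero, effect_push, List.length_cons,
    List.length_nil, Nat.reduceAdd, Nat.reduceLT, List.nil_append, List.reverse_replicate,
    List.replicate_append_replicate, List.drop_replicate, dropCoins_dropCoins, put, effect_seq,
    List.length_replicate] at h₂ h₃ h₄ h₅ h₆ h₇ h₈ h₉ h₁₀ h₁₁ h₁₂ h₁₃ h₁₄ h₁₅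
  have h := h₁.seq <| h₂.seq <| h₃.seq <| h₄.seq <| h₅.seq <| h₆.seq <| h₇.seq <| h₈.seq <|
    h₉.seq <| h₁₀.seq <| h₁₁.seq <| h₁₂.seq <| h₁₃.seq <| h₁₄.seq h₁₅
  rw [mem_init]
  refine ⟨_, h.mono ?_, by simp [mem_stack]⟩
  simp only [Prog.cost]
  have hT' : T - 1 + 1 = T := by omega
  have hj' : n - j ≤ M := by omega
  have he' : n - e ≤ M := by omega
  have hK' : K ≤ (r + 1) * M := by
    rw [add_mul, one_mul]; omega
  have p₁ := Nat.mul_le_mul_left (unaryStep.cost + shiftBit.cost + countBit.cost + copyBit.cost + 20)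
    (show (n + 1) ^ 2 + x.length ≤ M by omega)
  have p₂ := Nat.mul_le_mul_left (haltStep.cost + 1) (show T ≤ M by omega)
  have p₃ := Nat.mul_le_mul_left (uncountItem.cost + 1) (show T ≤ M by omega)
  have p₄ := Nat.mul_le_mul_left (guessIndexBit.cost + 1) hj'
  have p₅ := Nat.mul_le_mul_left (seedBitT.cost + 1) hK'
  have p₆ := Nat.mul_le_mul_left (seedBitR.cost + 1) hK'
  have p₇ := Nat.mul_le_mul_left (writeZero.cost + 1) he'
  have p₈ : (queryAll r).cost ≤ (queryAll r).cost * M := Nat.le_mul_of_pos_right _ (by omega)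
  have p₉ : (writeCount (2 ^ r) 0).cost ≤ (writeCount (2 ^ r) 0).cost * M :=
    Nat.le_mul_of_pos_right _ (by omega)
  have hM1 : 1 ≤ M := by omega
  have hnM : n ≤ M := by omega
  rw [hT']
  clear_value M K n
  linarith

end FineGrained

/-! ### The answers of the oracle in terms of the runs of the sampler. -/

namespace FineGrained

open scoped Classical

variable {O : Set (List Bool)} {B : ℕ}

/-! # The answers to the queries -/

/-- Add `∑ i, z i * x i` to a polynomial. -/
def QuadPoly.shift {n : ℕ} (f : QuadPoly n) (z : Fin n → Bool) : QuadPoly n :=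
  (fun i => f.1 i ^^ z i, f.2)

/-- The rows of the triangular matrix of the coefficients. -/
def QuadPoly.rows {n : ℕ} (f : QuadPoly n) : List (Bool × List Bool) :=
  List.ofFn fun i => (f.1 i, List.ofFn (f.2 i))

theorem joinRows_ofFn {n : ℕ} (a : Fin n → Bool) (b : Fin n → List Bool) :
    joinRows (List.ofFn fun i => (a i, b i)) = (List.ofFn fun i => a i :: b i).flatten := by
  induction n with
  | zero => rfl
  | succ n ih => simp [List.ofFn_succ, joinRows, ih]

theorem shiftRows_ofFn {n : ℕ} (a : Fin n → Bool) (b : Fin n → List Bool) (ω : ℕ → Bool) :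
    shiftRows (List.ofFn fun i => (a i, b i)) ω =
      (List.ofFn fun i => (a i ^^ ω i) :: b i).flatten := by
  induction n generalizing ω with
  | zero => rfl
  | succ n ih => simp [List.ofFn_succ, shiftRows, ih]

theorem rowsFrom_ofFn {n i : ℕ} (a : Fin n → Bool) (b : Fin n → List Bool)
    (h : ∀ k, (b k).length = i + k) : RowsFrom i (List.ofFn fun i => (a i, b i)) := by
  induction n generalizing i with
  | zero => trivial
  | succ n ih =>
    rw [List.ofFn_succ]
    exact ⟨by simpa using h 0, ih _ _ fun k => by rw [h, Fin.val_succ]; ring⟩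

theorem QuadPoly.rows_length {n : ℕ} (f : QuadPoly n) : f.rows.length = n := by
  simp [QuadPoly.rows]

theorem QuadPoly.rowsFrom_rows {n : ℕ} (f : QuadPoly n) : RowsFrom 0 f.rows :=
  rowsFrom_ofFn _ _ (by simp)

theorem QuadPoly.joinRows_rows {n : ℕ} (f : QuadPoly n) : joinRows f.rows = f.encode :=
  joinRows_ofFn _ _

theorem QuadPoly.shiftRows_rows {n : ℕ} (f : QuadPoly n) (ω : ℕ → Bool) :
    shiftRows f.rows ω = (f.shift fun i => ω i).encode :=
  shiftRows_ofFn _ _ _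

/-- A run of `t` steps depends on the first `t` coins only. -/
theorem Exec.congr_coins {P : Prog} {m m' : Mem} {t : ℕ} (h : Exec O B P m t m') :
    ∃ f ≤ t, m'.coins = dropCoins f m.coins ∧ ∀ ω : ℕ → Bool, (∀ i < t, m.coins i = ω i) →
      Exec O B P ⟨m.stack, ω⟩ t ⟨m'.stack, dropCoins f ω⟩ := by
  induction h with
  | skip m => exact ⟨0, by simp, rfl, fun ω _ => .skip _⟩
  | push i b m => exact ⟨0, by simp, rfl, fun ω _ => .push i b ⟨m.stack, ω⟩⟩
  | pop i m => exact ⟨0, by simp, rfl, fun ω _ => .pop i ⟨m.stack, ω⟩⟩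
  | flip i m =>
    refine ⟨1, le_rfl, rfl, fun ω hω => ?_⟩
    simp only [hω 0 one_pos]
    exact .flip i ⟨m.stack, ω⟩
  | query i m hB => exact ⟨0, by simp, rfl, fun ω _ => .query i ⟨m.stack, ω⟩ hB⟩
  | seq _ _ ihP ihQ =>
    obtain ⟨f, hf, hc, h⟩ := ihP
    obtain ⟨f', hf', hc', h'⟩ := ihQ
    refine ⟨f' + f, by omega, by rw [hc', hc, dropCoins_dropCoins], fun ω hω => ?_⟩
    have := h' (dropCoins f ω) fun i hi => by
      rw [hc]; exact hω _ (by omega)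
    rw [dropCoins_dropCoins] at this
    exact .seq (h ω fun i hi => hω i (by omega)) this
  | branch_empty hi _ ih =>
    obtain ⟨f, hf, hc, h⟩ := ih
    exact ⟨f, by omega, hc, fun ω hω => .branch_empty hi (h ω fun i hi => hω i (by omega))⟩
  | branch_false hi _ ih =>
    obtain ⟨f, hf, hc, h⟩ := ih
    exact ⟨f, by omega, hc, fun ω hω => .branch_false hi (h ω fun i hi => hω i (by omega))⟩
  | branch_true hi _ ih =>
    obtain ⟨f, hf, hc, h⟩ := ih
    exact ⟨f, by omega, hc, fun ω hω => .branch_true hi (h ω fun i hi => hω i (by omega))⟩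
  | loop_stop hi => exact ⟨0, by simp, rfl, fun ω _ => Exec.loop_stop hi⟩
  | loop_step hi _ _ ihP ihQ =>
    obtain ⟨f, hf, hc, h⟩ := ihP
    obtain ⟨f', hf', hc', h'⟩ := ihQ
    refine ⟨f' + f, by omega, by rw [hc', hc, dropCoins_dropCoins], fun ω hω => ?_⟩
    have := h' (dropCoins f ω) fun i hi => by
      rw [hc]; exact hω _ (by omega)
    rw [dropCoins_dropCoins] at this
    exact .loop_step hi (h ω fun i hi => hω i (by omega)) this

/-- On the input `x` and with the coins `ω`, the program `S` takes `τ ω` steps and outputs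
`y ω`. -/
def HasRuns (S : Prog) (x : List Bool) (τ : (ℕ → Bool) → ℕ) (y : (ℕ → Bool) → List Bool) : Prop :=
  ∀ ω, ∃ m, Exec ∅ 0 S (Mem.init x ω) (τ ω) m ∧ m.stack 1 = y ω

theorem HaltsWithin.hasRuns {S : Prog} {x : List Bool} {T : ℕ} (h : HaltsWithin ∅ 0 S x T) :
    ∃ τ y, HasRuns S x τ y ∧ ∀ ω, τ ω ≤ T := by
  choose τ hτ m hm using h
  exact ⟨τ, fun ω => (m ω).stack 1, fun ω => ⟨m ω, hm ω, rfl⟩, hτ⟩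

variable {S : Prog} {x z o : List Bool} {τ : (ℕ → Bool) → ℕ} {y : (ℕ → Bool) → List Bool}

theorem HasRuns.outputs_iff (h : HasRuns S x τ y) (ω : ℕ → Bool) (l : List Bool) :
    Outputs ∅ 0 S x ω l ↔ l = y ω := by
  obtain ⟨m, hm, hy⟩ := h ω
  constructor
  · rintro ⟨t, m', hm', rfl⟩
    rw [← hy, (hm.det hm').2]
  · rintro rfl
    exact ⟨_, m, hm, hy⟩

theorem HasRuns.congr {T : ℕ} (h : HasRuns S x τ y) (hT : ∀ ω, τ ω ≤ T) {ω ω' : ℕ → Bool}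
    (hω : ∀ i < T, ω i = ω' i) : y ω = y ω' := by
  obtain ⟨m, hm, hy⟩ := h ω
  obtain ⟨f, -, -, h'⟩ := hm.congr_coins
  have := h' ω' fun i hi => hω i (hi.trans_le (hT ω))
  rw [← hy]
  exact (h.outputs_iff ω' _).1 ⟨_, _, this, rfl⟩

theorem HasRuns.take {T : ℕ} (h : HasRuns S x τ y) (hT : ∀ ω, τ ω ≤ T) (l : List Bool) :
    y (listCoins (l.take T)) = y (listCoins l) :=
  h.congr hT fun i hi => by simp [listCoins, hi]

theorem coinList_listCoins (l : List Bool) : coinList l.length (listCoins l) = l := by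
  refine List.ext_getElem (by simp) fun i h₁ h₂ => ?_
  simp [coinList, listCoins, h₂]

/-- Whether the clock can run out after `k` steps. -/
theorem HasRuns.guessItems_mem (h : HasRuns S x τ y) (ho : IsInput o x z) (k : ℕ) :
    guessItems k ++ o ∈ oracle S ↔ ∃ ω, k ≤ τ ω := by
  have hread : ∀ ω, Query.read (guessItems k ++ o) (Query.empty, ω) =
      (⟨x, [], (coinList k ω).reverse, [], z, [], List.replicate k true⟩, dropCoins k ω) := by
    intro ω
    have := ho.2 [] ⟨[], [], (coinList k ω).reverse, [], [], [], List.replicate k true⟩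
      (dropCoins k ω)
    rw [guessItems, read_pack_guess_r, ← List.append_nil o]
    simpa [Query.empty, Query.read] using this
  constructor
  · rintro ⟨ω, hω⟩
    obtain ⟨m, hm, -⟩ := h (listCoins (coinList k ω).reverse)
    have := (verifier_outputs (hread ω) hm (fun i b hi => by
      simp only [hash] at hi
      simp [listCoins, hi]) (by simp) (.inl rfl)).1 hω
    exact ⟨_, by simpa using this⟩
  · rintro ⟨ω, hω⟩
    -- The verifier pushes its guesses, which reverses them, so the reversed coins have to be
    -- guessed.
    refine ⟨listCoins (coinList k ω).reverse, ?_⟩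
    have e : (coinList k (listCoins (coinList k ω).reverse)).reverse = coinList k ω := by
      rw [List.reverse_eq_iff]
      simpa using coinList_listCoins (coinList k ω).reverse
    obtain ⟨m, hm, -⟩ := h ω
    refine (verifier_outputs (hread _) hm (fun i b hi => ?_) (by simp) (.inl rfl)).2
      (.inl (by simpa using hω))
    simp only [hash, e] at hi
    obtain ⟨_, hi⟩ := List.getElem?_eq_some_iff.1 hi
    simpa [coinList] using hi

/-- Whether a guess of `m` bits completes the prefix to an index for which the sampler hits the
target. -/
theorem HasRuns.seedQuery_mem (h : HasRuns S x τ y) (ho : IsInput o x z) (m : ℕ)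
    (t r σ : List Bool) (hr : ∀ ω, τ ω < r.length) :
    pack true false false σ ++ seedQuery o m t r ∈ oracle S ↔
      ∃ γ : List Bool, γ.length = m ∧ y (listCoins (hash t (γ ++ σ) r)) = z := by
  have hread : ∀ ω, Query.read (pack true false false σ ++ seedQuery o m t r) (Query.empty, ω) =
      (⟨x, t, r, (coinList m ω).reverse ++ σ, z, [true], List.replicate r.length true⟩,
        dropCoins m ω) := by
    intro ω
    have := ho.2 [] ⟨[], t, r, (coinList m ω).reverse ++ σ, [], [true],
      List.replicate r.length true⟩ (dropCoins m ω)
    rw [seedQuery, read_pack_s, read_pack_a, read_pack_r, read_pack_t, read_pack_guess_s,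
      ← List.append_nil o]
    simpa [Query.empty, Query.read] using this
  have hacc : ∀ ω, Outputs ∅ 0 (verifier S) (pack true false false σ ++ seedQuery o m t r) ω
      [true] ↔ y (listCoins (hash t ((coinList m ω).reverse ++ σ) r)) = z := by
    intro ω
    obtain ⟨m', hm, hy⟩ := h (listCoins (hash t ((coinList m ω).reverse ++ σ) r))
    rw [verifier_outputs (hread ω) hm (fun i b hi => by simp [listCoins, hi]) (by simp)
      (.inr rfl), hy]
    -- The clock has as many ticks as `r` has bits, more than any run takes, so acceptance can only
    -- be due to a hit.
    have := hr (listCoins (hash t ((coinList m ω).reverse ++ σ) r))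
    simp [this]
  simp only [oracle, Set.mem_ofPred_eq, hacc]
  constructor
  · rintro ⟨ω, hω⟩
    exact ⟨_, by simp, hω⟩
  · rintro ⟨γ, rfl, hγ⟩
    refine ⟨listCoins γ.reverse, ?_⟩
    have := coinList_listCoins γ.reverse
    rw [List.length_reverse] at this
    rwa [this, List.reverse_reverse]

theorem answerCount_eq_bitSum (o : List Bool) (r : ℕ) (σ : List Bool) :
    (answerCount O o r σ : ℝ) =
      bitSum r fun σ' => if pack true false false (σ ++ σ') ++ o ∈ O then 1 else 0 := by
  induction r generalizing σ with
  | zero => simp [answerCount, bitSum]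
  | succ r ih => simp [answerCount, bitSum, ih]

end FineGrained

/-! ### Pairwise independence of Toeplitz hashing, and counting hits by prefixes. -/

namespace FineGrained

open scoped Classical

/-! # The hash function -/

theorem xorList_right_comm (r t u : List Bool) :
    xorList (xorList r t) u = xorList (xorList r u) t := by
  induction r generalizing t u with
  | nil => rfl
  | cons a r ih =>
    cases t <;> cases u <;> simp [xorList, ih]
    rename_i b _ c _
    cases a <;> cases b <;> cases c <;> rfl

theorem xorList_xorList (r t : List Bool) : xorList (xorList r t) t = r := by
  induction r generalizing t with
  | nil => rfl
  | cons a r ih => cases t <;> simp [xorList, ih]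

theorem xorList_tail (r t : List Bool) : (xorList r t).tail = xorList r.tail t.tail := by
  rcases r with - | ⟨a, r⟩
  · rfl
  · cases t <;> rfl

theorem hash_xorList (t s r u : List Bool) : hash t s (xorList r u) = xorList (hash t s r) u := by
  induction s generalizing t r with
  | nil => rfl
  | cons c s ih =>
    cases c
    · simp [hash, ih]
    · simp only [hash, if_true]
      rw [xorList_right_comm, ih]

/-- For fixed `t` and `s` the hash function adds a fixed string to `r`, hence is an involution. It
serves as a measure-preserving change of variables. -/
theorem hash_hash (t s r : List Bool) : hash t s (hash t s r) = r := by
  induction s generalizing t r with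
  | nil => rfl
  | cons c s ih =>
    cases c
    · simp [hash, ih]
    · simp only [hash, if_true]
      rw [← hash_xorList, xorList_xorList, ih]

/-- The value from some position on depends only on `t` and `r` from that position on. This is the
triangular structure behind independence. -/
theorem hash_tail (t s r : List Bool) : (hash t s r).tail = hash t.tail s r.tail := by
  induction s generalizing t r with
  | nil => rfl
  | cons c s ih =>
    rw [hash, hash, ih]
    cases c
    · rfl
    · simp [xorList_tail]

theorem bitAvg_succ (k : ℕ) (F : List Bool → ℝ) :
    bitAvg (k + 1) F = bitAvg k fun l => (F (false :: l) + F (true :: l)) / 2 := by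
  simp only [bitAvg, bitSum, div_eq_inv_mul _ (2 : ℝ), bitSum_mul_left, bitSum_add_fun, pow_succ]
  field_simp

theorem bitSum_xorList (k : ℕ) (t : List Bool) (F : List Bool → ℝ) :
    bitSum k (fun l => F (xorList l t)) = bitSum k F := by
  induction k generalizing t F with
  | zero => rfl
  | succ k ih =>
    have h : ∀ (t : List Bool) (a : Bool), (bitSum k fun l => F (a :: xorList l t)) =
        bitSum k fun l => F (a :: l) := fun t a => ih t fun l => F (a :: l)
    rcases t with - | ⟨b, t⟩
    · simp only [bitSum, xorList, h]
    · cases b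
      · simp [bitSum, xorList, h]
      · simp [bitSum, xorList, h, add_comm]

theorem bitAvg_xorList (k : ℕ) (t : List Bool) (F : List Bool → ℝ) :
    bitAvg k (fun l => F (xorList l t)) = bitAvg k F := by
  rw [bitAvg, bitSum_xorList, bitAvg]

theorem bitAvg_hash (k : ℕ) (t s : List Bool) (F : List Bool → ℝ) :
    bitAvg k (fun l => F (hash t s l)) = bitAvg k F := by
  induction s generalizing t with
  | nil => rfl
  | cons c s ih =>
    cases c
    · simpa [hash] using ih t.tail
    · simp only [hash, if_true]
      rw [bitAvg_xorList k t fun l => F (hash t.tail s l), ih]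

/-- Every single hash value is uniformly distributed. -/
theorem bitAvg_hash_take {T K : ℕ} (hK : T ≤ K) (t s : List Bool) (φ : List Bool → ℝ) :
    bitAvg K (fun b => φ ((hash t s b).take T)) = bitAvg T φ := by
  rw [bitAvg_hash K t s fun b => φ (b.take T)]
  obtain ⟨c, rfl⟩ := Nat.exists_eq_add_of_le hK
  exact bitAvg_take T c φ

/-- A triangular transformation preserves the uniform distribution. -/
theorem bitAvg_triangular (A : List Bool → List Bool → List Bool)
    (hA : ∀ b u, (A b u).length = b.length) (hA' : ∀ b u, (A b u).tail = A b.tail u.tail)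
    {T N : ℕ} (hN : T ≤ N) (b : List Bool) (hb : T ≤ b.length) (φ : List Bool → ℝ) :
    bitAvg N (fun t => φ ((xorList (A b t.tail) t).take T)) = bitAvg T φ := by
  induction T generalizing N b φ with
  | zero => simpa [bitAvg_const] using (by simp [bitAvg, bitSum] : φ [] = bitAvg 0 φ)
  | succ T ih =>
    obtain ⟨N, rfl⟩ : ∃ N', N = N' + 1 := ⟨N - 1, by omega⟩
    have hcons : ∀ u, ∃ a, A b u = a :: A b.tail u.tail := fun u => by
      rw [← hA']
      have := hA b u
      rcases h : A b u with - | ⟨a, l⟩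
      · rw [h, List.length_nil] at this; omega
      · exact ⟨a, rfl⟩
    -- The first bit of `t` affects only the first bit of the value, and flips it. Averaging over it
    -- makes that bit uniform whatever the other bits are.
    have h : ∀ u, φ ((xorList (A b u) (false :: u)).take (T + 1)) +
        φ ((xorList (A b u) (true :: u)).take (T + 1)) =
        φ (false :: (xorList (A b.tail u.tail) u).take T) +
          φ (true :: (xorList (A b.tail u.tail) u).take T) := by
      intro u
      obtain ⟨a, ha⟩ := hcons u
      rw [ha]
      cases a
      · simp [xorList]
      · simp [xorList, add_comm]
    simp only [bitAvg_succ, List.tail_cons, h]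
    exact ih (by omega) b.tail (by simp; omega) fun l => (φ (false :: l) + φ (true :: l)) / 2

theorem bitAvg_tail (N : ℕ) (F : List Bool → ℝ) :
    bitAvg (N + 1) (fun t => F t.tail) = bitAvg N F := by
  rw [bitAvg_succ]
  simp

/-- The hash values at two different indices are independent. -/
theorem bitAvg_hash_pair {T K N : ℕ} (hK : T ≤ K) {s s' : List Bool} (hs : s.length = s'.length)
    (hne : s ≠ s') (hN : T + s.length ≤ N) (φ ψ : List Bool → ℝ) :
    bitAvg N (fun t => bitAvg K fun b =>
      φ ((hash t s b).take T) * ψ ((hash t s' b).take T)) = bitAvg T φ * bitAvg T ψ := by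
  -- The situation at the first bit where the indices differ: `t` is added for one of them only.
  -- Substituting `hash t.tail s' b` for `b` turns the second value into `b` and the first into `t`
  -- plus a string that depends on `b` and on `t.tail` in a triangular way, hence into a uniform
  -- string for each fixed `b`.
  have key : ∀ (φ ψ : List Bool → ℝ) (s s' : List Bool) (N : ℕ), T ≤ N →
      bitAvg N (fun t => bitAvg K fun b => φ ((hash t.tail s (xorList b t)).take T) *
        ψ ((hash t.tail s' b).take T)) = bitAvg T φ * bitAvg T ψ := by
    intro φ ψ s s' N hN
    have h₁ : ∀ t, (bitAvg K fun b => φ ((hash t.tail s (xorList b t)).take T) *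
        ψ ((hash t.tail s' b).take T)) = bitAvg K fun b => ψ (b.take T) *
          φ ((xorList (hash t.tail s (hash t.tail s' b)) t).take T) := by
      intro t
      rw [← bitAvg_hash K t.tail s']
      refine bitAvg_congr fun b _ => ?_
      rw [hash_hash, hash_xorList, mul_comm]
    simp only [h₁]
    rw [bitAvg_comm]
    have h₂ : ∀ b : List Bool, b.length = K → (bitAvg N fun t => ψ (b.take T) *
        φ ((xorList (hash t.tail s (hash t.tail s' b)) t).take T)) =
        bitAvg T φ * ψ (b.take T) := by
      intro b hb
      rw [bitAvg_mul_left, bitAvg_triangular (fun b u => hash u s (hash u s' b)) (by simp)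
        (by simp [hash_tail]) hN b (by omega), mul_comm]
    rw [bitAvg_congr h₂, bitAvg_mul_left]
    obtain ⟨c, rfl⟩ := Nat.exists_eq_add_of_le hK
    rw [bitAvg_take]
  -- Equal leading bits: a common `false` only shifts `t`, and a common `true` is in addition
  -- removed by translating `b`. Each costs one bit of `t`, whence the bound `T + s.length ≤ N`.
  induction s generalizing s' N φ ψ with
  | nil => exact absurd (List.length_eq_zero_iff.1 hs.symm).symm hne
  | cons c s ih =>
    rcases s' with - | ⟨c', s'⟩
    · simp at hs
    simp only [List.length_cons, Nat.add_right_cancel_iff] at hs hN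
    obtain ⟨N, rfl⟩ : ∃ N', N = N' + 1 := ⟨N - 1, by omega⟩
    cases c <;> cases c'
    · simp only [hash, Bool.false_eq_true, if_false]
      rw [bitAvg_tail N fun t => bitAvg K fun b =>
        φ ((hash t s b).take T) * ψ ((hash t s' b).take T)]
      exact ih hs (by simpa using hne) (by omega) φ ψ
    · simp only [hash, Bool.false_eq_true, if_false, if_true]
      rw [mul_comm, ← key ψ φ s' s (N + 1) (by omega)]
      simp only [mul_comm]
    · simp only [hash, Bool.false_eq_true, if_false, if_true]
      exact key φ ψ s s' (N + 1) (by omega)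
    · simp only [hash, if_true]
      have h : ∀ t : List Bool, (bitAvg K fun b => φ ((hash t.tail s (xorList b t)).take T) *
          ψ ((hash t.tail s' (xorList b t)).take T)) = bitAvg K fun b =>
          φ ((hash t.tail s b).take T) * ψ ((hash t.tail s' b).take T) := fun t =>
        bitAvg_xorList K t fun b => φ ((hash t.tail s b).take T) * ψ ((hash t.tail s' b).take T)
      simp only [h]
      rw [bitAvg_tail N fun t => bitAvg K fun b =>
        φ ((hash t s b).take T) * ψ ((hash t s' b).take T)]
      exact ih hs (by simpa using hne) (by omega) φ ψ

/-- The average over pairs of bit strings. -/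
noncomputable def pairAvg (K : ℕ) (F : List Bool → List Bool → ℝ) : ℝ :=
  bitAvg K fun t => bitAvg K fun b => F t b

theorem pairAvg_mono {K : ℕ} {F G : List Bool → List Bool → ℝ} (h : ∀ t b, F t b ≤ G t b) :
    pairAvg K F ≤ pairAvg K G :=
  bitAvg_mono fun t _ => bitAvg_mono fun b _ => h t b

theorem pairAvg_add (K : ℕ) (F G : List Bool → List Bool → ℝ) :
    pairAvg K (fun t b => F t b + G t b) = pairAvg K F + pairAvg K G := by
  simp only [pairAvg, bitAvg_add_fun]

theorem pairAvg_mul_left (K : ℕ) (c : ℝ) (F : List Bool → List Bool → ℝ) :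
    pairAvg K (fun t b => c * F t b) = c * pairAvg K F := by
  simp only [pairAvg, bitAvg_mul_left]

theorem pairAvg_const (K : ℕ) (c : ℝ) : pairAvg K (fun _ _ => c) = c := by
  simp only [pairAvg, bitAvg_const]

theorem pairAvg_sum {ι : Type*} (s : Finset ι) (K : ℕ) (F : ι → List Bool → List Bool → ℝ) :
    pairAvg K (fun t b => ∑ i ∈ s, F i t b) = ∑ i ∈ s, pairAvg K (F i) := by
  simp only [pairAvg, bitAvg, bitSum_finset_sum, Finset.sum_div]

/-- Chebyshev's inequality for the number of indices with a given property, and for the number of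
the prefixes of such indices. -/
theorem pairAvg_count_le {T K m r : ℕ} (hK : T + (m + r) ≤ K) (p : List Bool → Prop) {D : ℝ}
    (hD : 0 < D) :
    pairAvg K (fun t b => if 2 * D < |(bitSum r fun σ =>
        if ∃ γ : List Bool, γ.length = m ∧ p ((hash t (γ ++ σ) b).take T) then 1 else 0) -
          2 ^ (m + r) * bitAvg T fun l => if p l then 1 else 0| then 1 else 0) ≤
      2 ^ r * (2 ^ m * bitAvg T fun l => if p l then 1 else 0) ^ 2 / D +
        2 ^ (m + r) * (bitAvg T fun l => if p l then 1 else 0) / D ^ 2 := by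
  set φ : List Bool → ℝ := fun l => if p l then 1 else 0 with hφ
  set q := bitAvg T φ with hq
  let ι := (Fin m → Bool) × (Fin r → Bool)
  let ix : ι → List Bool := fun i => List.ofFn i.1 ++ List.ofFn i.2
  have hix : ∀ i, (ix i).length = m + r := by simp [ix]
  have hinj : Function.Injective ix := by
    rintro ⟨γ, σ⟩ ⟨γ', σ'⟩ h
    obtain ⟨h₁, h₂⟩ := List.append_inj h (by simp)
    exact Prod.ext (List.ofFn_injective h₁) (List.ofFn_injective h₂)
  let χ : ι → List Bool → List Bool → ℝ := fun i t b => φ ((hash t (ix i) b).take T)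
  have hχ : ∀ i t b, χ i t b = 0 ∨ χ i t b = 1 := fun i t b => by
    simp only [χ, hφ]; split <;> simp
  have hχ₁ : ∀ i, pairAvg K (χ i) = q := fun i => by
    simp only [pairAvg, χ, bitAvg_hash_take (show T ≤ K by omega), bitAvg_const, hq]
  have hχ₂ : ∀ i j, i ≠ j → pairAvg K (fun t b => χ i t b * χ j t b) = q * q := fun i j hij =>
    bitAvg_hash_pair (by omega) (by rw [hix, hix]) (hinj.ne hij) (by rw [hix]; omega) φ φ
  have hq0 : 0 ≤ q := by
    rw [← hχ₁ ⟨fun _ => false, fun _ => false⟩, ← pairAvg_const K 0]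
    exact pairAvg_mono fun t b => by rcases hχ ⟨fun _ => false, fun _ => false⟩ t b with h | h <;>
      simp [h]
  set μ := 2 ^ (m + r) * q with hμ
  let X : List Bool → List Bool → ℝ := fun t b => ∑ i, χ i t b
  -- `Y` counts the ordered pairs of distinct hits with equal prefixes. A prefix with `c ≥ 1` hits
  -- contributes `c - 1` to the difference of the two counts, at most its `c (c - 1)` pairs.
  let Y : List Bool → List Bool → ℝ := fun t b =>
    ∑ σ : Fin r → Bool, ∑ γ : Fin m → Bool, ∑ γ' ∈ Finset.univ.erase γ,
      χ (γ, σ) t b * χ (γ', σ) t b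
  have hcard : (Fintype.card ι : ℝ) = 2 ^ (m + r) := by simp [ι, pow_add]
  have hEX : pairAvg K X = μ := by
    simp only [X, pairAvg_sum, hχ₁, Finset.sum_const, nsmul_eq_mul, Finset.card_univ, hcard, hμ]
  have hEXX : pairAvg K (fun t b => X t b * X t b) ≤ μ + μ ^ 2 := by
    have : ∀ t b, X t b * X t b =
        ∑ i, χ i t b + ∑ i, ∑ j ∈ Finset.univ.erase i, χ i t b * χ j t b := by
      intro t b
      simp only [X]
      rw [Finset.sum_mul_sum, ← Finset.sum_add_distrib]
      refine Finset.sum_congr rfl fun i _ => ?_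
      rw [← Finset.add_sum_erase _ _ (Finset.mem_univ i)]
      rcases hχ i t b with h | h <;> simp [h]
    simp only [this]
    rw [pairAvg_add, pairAvg_sum, pairAvg_sum]
    simp only [pairAvg_sum]
    have h : ∀ i : ι, ∑ j ∈ Finset.univ.erase i, pairAvg K (fun t b => χ i t b * χ j t b) ≤
        2 ^ (m + r) * (q * q) := by
      intro i
      rw [Finset.sum_congr rfl fun j hj => hχ₂ i j (Finset.ne_of_mem_erase hj).symm,
        Finset.sum_const, nsmul_eq_mul, ← hcard]
      refine mul_le_mul_of_nonneg_right ?_ (by positivity)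
      exact_mod_cast (Finset.card_le_univ _)
    calc _ ≤ ∑ _i : ι, q + ∑ _i : ι, 2 ^ (m + r) * (q * q) := by
          simp only [hχ₁]
          exact add_le_add_right (Finset.sum_le_sum fun i _ => h i) _
      _ = μ + μ ^ 2 := by
          simp only [Finset.sum_const, nsmul_eq_mul, Finset.card_univ, hcard, hμ]; ring
  have hVar : pairAvg K (fun t b => (X t b - μ) ^ 2) ≤ μ := by
    have : ∀ t b, (X t b - μ) ^ 2 = X t b * X t b + ((-2 * μ) * X t b + μ ^ 2) := by
      intro t b; ring
    simp only [this]
    rw [pairAvg_add, pairAvg_add, pairAvg_mul_left, pairAvg_const, hEX]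
    linarith
  have hEY : pairAvg K Y ≤ 2 ^ r * (2 ^ m * q) ^ 2 := by
    simp only [Y, pairAvg_sum]
    have h : ∀ (σ : Fin r → Bool) (γ : Fin m → Bool), ∑ γ' ∈ Finset.univ.erase γ,
        pairAvg K (fun t b => χ (γ, σ) t b * χ (γ', σ) t b) ≤ 2 ^ m * (q * q) := by
      intro σ γ
      rw [Finset.sum_congr rfl fun j hj => hχ₂ _ _ fun h =>
        (Finset.ne_of_mem_erase hj).symm (congrArg Prod.fst h), Finset.sum_const, nsmul_eq_mul]
      refine mul_le_mul_of_nonneg_right ?_ (by positivity)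
      exact_mod_cast (Finset.card_le_univ _).trans (by simp)
    calc _ ≤ ∑ _σ : Fin r → Bool, ∑ _γ : Fin m → Bool, 2 ^ m * (q * q) :=
          Finset.sum_le_sum fun σ _ => Finset.sum_le_sum fun γ _ => h σ γ
      _ = _ := by
          simp only [Finset.sum_const, nsmul_eq_mul, Finset.card_univ, Fintype.card_pi,
            Fintype.card_bool, Finset.prod_const, Fintype.card_fin, Nat.cast_pow, Nat.cast_ofNat]
          ring
  set k : List Bool → List Bool → ℝ := fun t b => bitSum r fun σ =>
    if ∃ γ : List Bool, γ.length = m ∧ p ((hash t (γ ++ σ) b).take T) then 1 else 0 with hk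
  have hXk : ∀ t b, |X t b - k t b| ≤ Y t b := by
    intro t b
    have hX : X t b = ∑ σ : Fin r → Bool, ∑ γ : Fin m → Bool, χ (γ, σ) t b := by
      simp only [X]
      rw [Fintype.sum_prod_type, Finset.sum_comm]
    rw [hX, hk]
    simp only [bitSum_eq_sum r]
    rw [← Finset.sum_sub_distrib]
    refine (Finset.abs_sum_le_sum_abs _ _).trans (Finset.sum_le_sum fun σ _ => ?_)
    have hY0 : ∀ γ, 0 ≤ ∑ γ' ∈ Finset.univ.erase γ, χ (γ, σ) t b * χ (γ', σ) t b := fun γ =>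
      Finset.sum_nonneg fun γ' _ => by
        rcases hχ (γ, σ) t b with h | h <;> rcases hχ (γ', σ) t b with h' | h' <;> simp [h, h']
    by_cases hex : ∃ γ : List Bool, γ.length = m ∧ p ((hash t (γ ++ List.ofFn σ) b).take T)
    · rw [if_pos hex]
      obtain ⟨γ, rfl, hγ⟩ := hex
      have h1 : χ (γ.get, σ) t b = 1 := by simp [χ, ix, hφ, hγ]
      rw [← Finset.add_sum_erase _ _ (Finset.mem_univ γ.get), h1, add_sub_cancel_left,
        ← Finset.add_sum_erase Finset.univ (fun γ => ∑ γ' ∈ Finset.univ.erase γ,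
          χ (γ, σ) t b * χ (γ', σ) t b) (Finset.mem_univ γ.get), abs_of_nonneg]
      · simp only [h1, one_mul]
        linarith [Finset.sum_nonneg fun γ' (_ : γ' ∈ Finset.univ.erase γ.get) => hY0 γ']
      · exact Finset.sum_nonneg fun γ' _ => by rcases hχ (γ', σ) t b with h | h <;> simp [h]
    · rw [if_neg hex, sub_zero, Finset.sum_eq_zero, abs_zero]
      · exact Finset.sum_nonneg fun γ _ => hY0 γ
      · intro γ _
        simp only [χ, ix, hφ]
        rw [if_neg fun h => hex ⟨_, by simp, h⟩]
  -- An error above `2 * D` forces `D ≤ Y` or `D ≤ |X - μ|`; Markov's inequality handles the first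
  -- event, Chebyshev's the second.
  have hpt : ∀ t b, (if 2 * D < |k t b - μ| then (1 : ℝ) else 0) ≤
      D⁻¹ * Y t b + (D ^ 2)⁻¹ * (X t b - μ) ^ 2 := by
    intro t b
    have hY0 : 0 ≤ Y t b := (abs_nonneg _).trans (hXk t b)
    split
    · rename_i h
      have htri : |k t b - μ| ≤ |X t b - k t b| + |X t b - μ| := by
        rw [abs_sub_comm (X t b) (k t b)]
        simpa using abs_add_le (k t b - X t b) (X t b - μ)
      by_cases hYD : D ≤ Y t b
      · have : 1 ≤ D⁻¹ * Y t b := by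
          rw [inv_mul_eq_div, le_div_iff₀ hD]; linarith
        nlinarith [show 0 ≤ (D ^ 2)⁻¹ * (X t b - μ) ^ 2 by positivity]
      · have h1 : D ≤ |X t b - μ| := by linarith [hXk t b]
        have : 1 ≤ (D ^ 2)⁻¹ * (X t b - μ) ^ 2 := by
          rw [inv_mul_eq_div, le_div_iff₀ (by positivity), one_mul, ← sq_abs (X t b - μ)]
          exact pow_le_pow_left₀ hD.le h1 2
        nlinarith [show 0 ≤ D⁻¹ * Y t b by positivity]
    · positivity
  refine (pairAvg_mono hpt).trans ?_
  rw [pairAvg_add, pairAvg_mul_left, pairAvg_mul_left, div_eq_inv_mul, div_eq_inv_mul]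
  exact add_le_add (mul_le_mul_of_nonneg_left hEY (by positivity))
    (mul_le_mul_of_nonneg_left hVar (by positivity))

end FineGrained

/-! ### Second and fourth moments of the gap over random `f`, and Paley–Zygmund. -/

namespace FineGrained

open scoped Classical

/-! # Moments of the gap -/

/-- The sign `(-1) ^ a`. -/
def sign2 (a : ZMod 2) : ℤ := (-1) ^ a.val

theorem sign2_add (a b : ZMod 2) : sign2 (a + b) = sign2 a * sign2 b := by
  revert a b; decide

theorem abs_sign2 (a : ZMod 2) : |sign2 a| = 1 := by
  revert a; decide

theorem bit2_xor (a b : Bool) : bit2 (a ^^ b) = bit2 a + bit2 b := by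
  revert a b; decide

/-- The sum of two polynomials. -/
def QuadPoly.xor {n : ℕ} (f h : QuadPoly n) : QuadPoly n :=
  (fun i => f.1 i ^^ h.1 i, fun i j => f.2 i j ^^ h.2 i j)

theorem QuadPoly.eval_xor {n : ℕ} (f h : QuadPoly n) (x : Fin n → Bool) :
    (f.xor h).eval x = f.eval x + h.eval x := by
  simp only [QuadPoly.eval, QuadPoly.xor, bit2_xor, add_mul, Finset.sum_add_distrib]
  ring

theorem QuadPoly.xor_involutive {n : ℕ} (h : QuadPoly n) :
    Function.Involutive fun f : QuadPoly n => f.xor h := by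
  intro f
  simp [QuadPoly.xor]

theorem QuadPoly.eval_shift {n : ℕ} (f : QuadPoly n) (z x : Fin n → Bool) :
    (f.shift z).eval x = f.eval x + ∑ i, bit2 (z i) * bit2 (x i) := by
  simp only [QuadPoly.eval, QuadPoly.shift, bit2_xor, add_mul, Finset.sum_add_distrib]
  ring

theorem QuadPoly.shift_involutive {n : ℕ} (z : Fin n → Bool) :
    Function.Involutive fun f : QuadPoly n => f.shift z := by
  intro f
  simp [QuadPoly.shift]

/-- A character sum over all polynomials vanishes unless the character is trivial. -/
theorem sum_sign2_eq_zero {n : ℕ} (l : List (Fin n → Bool)) (h : QuadPoly n)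
    (hl : (l.map h.eval).sum = 1) : ∑ f : QuadPoly n, sign2 (l.map f.eval).sum = 0 := by
  have h₁ : ∀ f : QuadPoly n, (l.map (f.xor h).eval).sum =
      (l.map f.eval).sum + (l.map h.eval).sum := by
    intro f
    rw [← List.sum_map_add]
    simp only [← QuadPoly.eval_xor]
  -- Translation by `h` permutes the polynomials and reverses every sign.
  have h₂ := Equiv.sum_comp (QuadPoly.xor_involutive h).toPerm
    fun f : QuadPoly n => sign2 (l.map f.eval).sum
  simp only [Function.Involutive.coe_toPerm, h₁, sign2_add, hl] at h₂
  rw [← Finset.sum_mul, show sign2 1 = -1 by decide] at h₂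
  linarith

/-- The polynomial `x i`. -/
def linearPoly {n : ℕ} (i : Fin n) : QuadPoly n := (fun k => decide (k = i), fun _ _ => false)

/-- The polynomial `x i * x j`. -/
def pairPoly {n : ℕ} (i : Fin n) (j : Fin i) : QuadPoly n :=
  (fun _ => false, fun k l => decide (k = i ∧ l.val = j.val))

theorem eval_linearPoly {n : ℕ} (i : Fin n) (x : Fin n → Bool) :
    (linearPoly i).eval x = bit2 (x i) := by
  rw [QuadPoly.eval, Finset.sum_eq_single i]
  · simp [linearPoly, bit2]
  · intro k _ hk; simp [linearPoly, bit2, hk]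
  · simp

theorem eval_pairPoly {n : ℕ} (i : Fin n) (j : Fin i) (x : Fin n → Bool) :
    (pairPoly i j).eval x = bit2 (x i) * bit2 (x (Fin.castLE i.isLt.le j)) := by
  rw [QuadPoly.eval, Finset.sum_eq_zero (fun k _ => by simp [pairPoly, bit2]), zero_add,
    Finset.sum_eq_single i, Finset.sum_eq_single j]
  · simp [pairPoly, bit2]
  · intro k _ hk
    simp [pairPoly, bit2, Fin.val_ne_of_ne hk]
  · simp
  · intro k _ hk
    refine Finset.sum_eq_zero fun l _ => ?_
    simp [pairPoly, bit2, hk]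
  · simp

theorem zmod_two_eq_zero {a : ZMod 2} (h : a ≠ 1) : a = 0 := by
  revert a; decide

theorem eq_of_sum_sign2_ne_zero {n : ℕ} {x y : Fin n → Bool}
    (h : ∑ f : QuadPoly n, sign2 (f.eval x + f.eval y) ≠ 0) : x = y := by
  funext i
  have := zmod_two_eq_zero fun h' => h (by
    simpa using sum_sign2_eq_zero [x, y] (linearPoly i) (by simpa using h'))
  simp only [eval_linearPoly] at this
  revert this
  generalize x i = a
  generalize y i = b
  revert a b; decide

/-- This is where degree two is needed. A nonzero sum forces the values of every monomial at the
four points to add up to zero. If `x i ≠ y i`, then `z i` equals one of the two, and the products of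
coordinate `i` with the others extend that agreement to all coordinates. -/
theorem paired_of_sum_sign2_ne_zero {n : ℕ} {x y z w : Fin n → Bool}
    (h : ∑ f : QuadPoly n, sign2 (f.eval x + (f.eval y + (f.eval z + f.eval w))) ≠ 0) :
    (x = y ∧ z = w) ∨ (x = z ∧ y = w) ∨ (x = w ∧ y = z) := by
  have h₀ : ∀ p : QuadPoly n, p.eval x + (p.eval y + (p.eval z + p.eval w)) = 0 := fun p =>
    zmod_two_eq_zero fun h' => h (by
      simpa using sum_sign2_eq_zero [x, y, z, w] p (by simpa using h'))
  have h₁ : ∀ i, bit2 (x i) + (bit2 (y i) + (bit2 (z i) + bit2 (w i))) = 0 := fun i => by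
    simpa only [eval_linearPoly] using h₀ (linearPoly i)
  have h₂ : ∀ i j, j < i → bit2 (x i) * bit2 (x j) + (bit2 (y i) * bit2 (y j) +
      (bit2 (z i) * bit2 (z j) + bit2 (w i) * bit2 (w j))) = 0 := fun i j hij => by
    have := h₀ (pairPoly i ⟨j, hij⟩)
    simp only [eval_pairPoly] at this
    exact this
  have h₃ : ∀ i j, i ≠ j → bit2 (x i) * bit2 (x j) + (bit2 (y i) * bit2 (y j) +
      (bit2 (z i) * bit2 (z j) + bit2 (w i) * bit2 (w j))) = 0 := fun i j hij => by
    rcases lt_or_gt_of_ne hij with h | h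
    · simpa only [mul_comm] using h₂ j i h
    · exact h₂ i j h
  have key₀ : ∀ a b c d : Bool, bit2 a + (bit2 b + (bit2 c + bit2 d)) = 0 →
      (a = b → c = d) ∧ (a = c → b = d) ∧ (b = c → a = d) := by decide
  have key : ∀ a b c d a' b' c' d' : Bool, bit2 a + (bit2 b + (bit2 c + bit2 d)) = 0 →
      bit2 a' + (bit2 b' + (bit2 c' + bit2 d')) = 0 →
      bit2 a * bit2 a' + (bit2 b * bit2 b' + (bit2 c * bit2 c' + bit2 d * bit2 d')) = 0 →
      a ≠ b → (a = c → a' = c') ∧ (b = c → b' = c') := by decide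
  by_cases hxy : x = y
  · exact .inl ⟨hxy, funext fun i => (key₀ _ _ _ _ (h₁ i)).1 (congrFun hxy i)⟩
  · obtain ⟨i, hi⟩ := Function.ne_iff.1 hxy
    by_cases hxz : x i = z i
    · have e : x = z := funext fun j => by
        by_cases hij : i = j
        · exact hij ▸ hxz
        · exact (key _ _ _ _ _ _ _ _ (h₁ i) (h₁ j) (h₃ i j hij) hi).1 hxz
      exact .inr (.inl ⟨e, funext fun i => (key₀ _ _ _ _ (h₁ i)).2.1 (congrFun e i)⟩)
    · have hyz : y i = z i := by
        revert hi hxz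
        generalize x i = a
        generalize y i = b
        generalize z i = c
        revert a b c; decide
      have e : y = z := funext fun j => by
        by_cases hij : i = j
        · exact hij ▸ hyz
        · exact (key _ _ _ _ _ _ _ _ (h₁ i) (h₁ j) (h₃ i j hij) hi).2 hyz
      exact .inr (.inr ⟨funext fun i => (key₀ _ _ _ _ (h₁ i)).2.2 (congrFun e i), e⟩)

theorem gap_eq_sum {n : ℕ} (f : QuadPoly n) (g : BoolCircuit n) :
    gap f g = ∑ x, sign2 (bit2 (g.eval x)) * sign2 (f.eval x) := by
  refine Finset.sum_congr rfl fun x _ => ?_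
  rw [← sign2_add, add_comm]; rfl

/-- Only the diagonal terms survive, and there the signs of `g` cancel. -/
theorem sum_gap_sq {n : ℕ} (g : BoolCircuit n) :
    ∑ f : QuadPoly n, gap f g ^ 2 = 2 ^ n * Fintype.card (QuadPoly n) := by
  have h : ∀ f : QuadPoly n, gap f g ^ 2 = ∑ x, ∑ y,
      sign2 (bit2 (g.eval x)) * sign2 (bit2 (g.eval y)) * sign2 (f.eval x + f.eval y) := by
    intro f
    rw [gap_eq_sum, sq, Finset.sum_mul_sum]
    refine Finset.sum_congr rfl fun x _ => Finset.sum_congr rfl fun y _ => ?_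
    rw [sign2_add]; ring
  simp only [h]
  rw [Finset.sum_comm]
  have h' : ∀ x : Fin n → Bool, ∑ f : QuadPoly n, ∑ y, sign2 (bit2 (g.eval x)) *
      sign2 (bit2 (g.eval y)) * sign2 (f.eval x + f.eval y) = Fintype.card (QuadPoly n) := by
    intro x
    rw [Finset.sum_comm, Finset.sum_eq_single x]
    · have : ∀ a b : ZMod 2, sign2 a * sign2 a * sign2 (b + b) = 1 := by decide
      simp [this]
    · intro y _ hy
      rw [← Finset.mul_sum]
      by_contra hne
      exact hy (eq_of_sum_sign2_ne_zero fun h0 => hne (by rw [h0, mul_zero])).symm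
    · simp
  simp only [h']
  simp

theorem sum_pairings {V : Type*} [Fintype V] [DecidableEq V] (N : ℤ) :
    ∑ x : V, ∑ y : V, ∑ z : V, ∑ w : V, (((if x = y then if z = w then N else 0 else 0) +
      if x = z then if y = w then N else 0 else 0) + if x = w then if y = z then N else 0 else 0) =
      3 * (Fintype.card V : ℤ) ^ 2 * N := by
  simp [Finset.sum_add_distrib, Finset.sum_ite_irrel]
  ring

/-- Only quadruples that coincide in pairs survive. The three pairings overlap, and counting them
separately gives the inequality; `g` contributes only signs. -/
theorem sum_gap_pow_four {n : ℕ} (g : BoolCircuit n) :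
    ∑ f : QuadPoly n, gap f g ^ 4 ≤ 3 * 4 ^ n * Fintype.card (QuadPoly n) := by
  let V := Fin n → Bool
  let N : ℤ := Fintype.card (QuadPoly n)
  let s : V → ℤ := fun x => sign2 (bit2 (g.eval x))
  have h : ∀ f : QuadPoly n, gap f g ^ 4 = ∑ x : V, ∑ y : V, ∑ z : V, ∑ w : V,
      s x * s y * s z * s w *
        sign2 (f.eval x + (f.eval y + (f.eval z + f.eval w))) := by
    intro f
    rw [gap_eq_sum, pow_succ', pow_succ', sq]
    simp only [Finset.mul_sum, Finset.sum_mul]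
    refine Finset.sum_congr rfl fun x _ => Finset.sum_congr rfl fun y _ =>
      Finset.sum_congr rfl fun z _ => Finset.sum_congr rfl fun w _ => ?_
    simp only [sign2_add, s]; ring
  have hbound : ∀ x y z w : V, ∑ f : QuadPoly n, s x * s y * s z * s w *
      sign2 (f.eval x + (f.eval y + (f.eval z + f.eval w))) ≤
      ((if x = y then if z = w then N else 0 else 0) + if x = z then if y = w then N else 0 else 0) +
        if x = w then if y = z then N else 0 else 0 := by
    intro x y z w
    have hN : 0 ≤ N := Int.natCast_nonneg _
    by_cases hp : (x = y ∧ z = w) ∨ (x = z ∧ y = w) ∨ (x = w ∧ y = z)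
    · have hle : ∑ f : QuadPoly n, s x * s y * s z * s w *
          sign2 (f.eval x + (f.eval y + (f.eval z + f.eval w))) ≤ N := by
        calc _ ≤ ∑ _f : QuadPoly n, (1 : ℤ) := Finset.sum_le_sum fun f _ => by
              refine (le_abs_self _).trans ?_
              simp only [abs_mul, s, abs_sign2, mul_one, le_refl]
          _ = N := by simp [N]
      refine hle.trans ?_
      rcases hp with ⟨rfl, rfl⟩ | ⟨rfl, rfl⟩ | ⟨rfl, rfl⟩
      · simp only [if_true]; split_ifs <;> linarith
      · simp only [if_true]; split_ifs <;> linarith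
      · simp only [if_true]; split_ifs <;> linarith
    · rw [← Finset.mul_sum]
      have : ∑ f : QuadPoly n, sign2 (f.eval x + (f.eval y + (f.eval z + f.eval w))) = 0 := by
        by_contra hne
        exact hp (paired_of_sum_sign2_ne_zero hne)
      rw [this, mul_zero]
      split_ifs <;> linarith
  have hV : (Fintype.card V : ℤ) = 2 ^ n := by simp [V]
  calc ∑ f : QuadPoly n, gap f g ^ 4
      = ∑ x : V, ∑ y : V, ∑ z : V, ∑ w : V, ∑ f : QuadPoly n, s x * s y * s z * s w *
        sign2 (f.eval x + (f.eval y + (f.eval z + f.eval w))) := by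
        simp only [h]
        rw [Finset.sum_comm]
        refine Finset.sum_congr rfl fun x _ => ?_
        rw [Finset.sum_comm]
        refine Finset.sum_congr rfl fun y _ => ?_
        rw [Finset.sum_comm]
        refine Finset.sum_congr rfl fun z _ => ?_
        rw [Finset.sum_comm]
    _ ≤ ∑ x : V, ∑ y : V, ∑ z : V, ∑ w : V,
        (((if x = y then if z = w then N else 0 else 0) +
          if x = z then if y = w then N else 0 else 0) +
            if x = w then if y = z then N else 0 else 0) :=
        Finset.sum_le_sum fun x _ => Finset.sum_le_sum fun y _ => Finset.sum_le_sum fun z _ =>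
          Finset.sum_le_sum fun w _ => hbound x y z w
    _ = 3 * 4 ^ n * N := by
        rw [sum_pairings, hV, show (4 : ℤ) ^ n = (2 ^ n) ^ 2 by rw [← pow_mul', pow_mul]; norm_num]

/-- The square of the gap is not much smaller than its average for almost a third of all
polynomials. -/
theorem gap_anticoncentration {n : ℕ} (g : BoolCircuit n) {θ : ℝ} (hθ0 : 0 ≤ θ)
    (hθ : θ ≤ 1) :
    (1 - θ) ^ 2 / 3 * (Fintype.card (QuadPoly n) : ℝ) ≤
      ((Finset.univ.filter fun f : QuadPoly n => θ * 2 ^ n ≤ (gap f g : ℝ) ^ 2).card : ℝ) := by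
  set A := Finset.univ.filter fun f : QuadPoly n => θ * 2 ^ n ≤ (gap f g : ℝ) ^ 2 with hA
  obtain ⟨N, hN⟩ : ∃ N : ℝ, (Fintype.card (QuadPoly n) : ℝ) = N := ⟨_, rfl⟩
  have hN0 : 0 < N := by
    rw [← hN]
    exact_mod_cast Fintype.card_pos (α := QuadPoly n)
  have h2 : ∑ f : QuadPoly n, (gap f g : ℝ) ^ 2 = 2 ^ n * N := by
    rw [← hN]
    exact_mod_cast sum_gap_sq g
  have h4 : ∑ f : QuadPoly n, (gap f g : ℝ) ^ 4 ≤ 3 * 4 ^ n * N := by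
    rw [← hN]
    exact_mod_cast sum_gap_pow_four g
  rw [hN]
  have h1 : ∑ f : QuadPoly n, (gap f g : ℝ) ^ 2 ≤ θ * 2 ^ n * N + ∑ f ∈ A, (gap f g : ℝ) ^ 2 := by
    rw [← Finset.sum_filter_add_sum_filter_not Finset.univ
      (fun f : QuadPoly n => θ * 2 ^ n ≤ (gap f g : ℝ) ^ 2), ← hA, add_comm]
    refine add_le_add_left ?_ _
    calc _ ≤ ∑ _f ∈ Finset.univ.filter (fun f : QuadPoly n => ¬ θ * 2 ^ n ≤ (gap f g : ℝ) ^ 2),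
          θ * 2 ^ n := Finset.sum_le_sum fun f hf => by
            rw [Finset.mem_filter] at hf; exact (not_le.1 hf.2).le
      _ ≤ _ := by
        rw [Finset.sum_const, nsmul_eq_mul, mul_comm]
        refine mul_le_mul_of_nonneg_left ?_ (by positivity)
        rw [← hN]
        exact_mod_cast Finset.card_le_univ _
  -- Cauchy–Schwarz on `A`: the fourth moment limits how much of the second moment a small set can
  -- carry.
  have hcs : (∑ f ∈ A, (gap f g : ℝ) ^ 2) ^ 2 ≤ A.card * (3 * 4 ^ n * N) := by
    have := Finset.sum_mul_sq_le_sq_mul_sq A (fun _ => (1 : ℝ)) fun f => (gap f g : ℝ) ^ 2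
    simp only [one_mul, one_pow, Finset.sum_const, nsmul_eq_mul, mul_one, ← pow_mul] at this
    refine this.trans (mul_le_mul_of_nonneg_left ?_ (by positivity))
    exact (Finset.sum_le_univ_sum_of_nonneg fun f => (even_two_mul 2).pow_nonneg _).trans h4
  have h5 : (1 - θ) * 2 ^ n * N ≤ ∑ f ∈ A, (gap f g : ℝ) ^ 2 := by linarith
  have h6 : ((1 - θ) * 2 ^ n * N) ^ 2 ≤ A.card * (3 * 4 ^ n * N) :=
    (pow_le_pow_left₀ (mul_nonneg (mul_nonneg (sub_nonneg.2 hθ) (by positivity)) hN0.le)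
      h5 2).trans hcs
  have h7 : (4 : ℝ) ^ n = 2 ^ n * 2 ^ n := by rw [← mul_pow]; norm_num
  have h8 : ((1 - θ) ^ 2 * N) * (4 ^ n * N) ≤ (3 * A.card) * (4 ^ n * N) := by
    rw [h7] at h6 ⊢; nlinarith
  have := le_of_mul_le_mul_right h8 (by positivity)
  linarith

/-- The square of the gap is rarely much larger than its average. -/
theorem gap_markov {n : ℕ} (g : BoolCircuit n) {Λ : ℝ} (hΛ : 0 < Λ) :
    ((Finset.univ.filter fun f : QuadPoly n => Λ * 2 ^ n < (gap f g : ℝ) ^ 2).card : ℝ) ≤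
      Λ⁻¹ * (Fintype.card (QuadPoly n) : ℝ) := by
  set A := Finset.univ.filter fun f : QuadPoly n => Λ * 2 ^ n < (gap f g : ℝ) ^ 2 with hA
  have h2 : ∑ f : QuadPoly n, (gap f g : ℝ) ^ 2 = 2 ^ n * Fintype.card (QuadPoly n) := by
    exact_mod_cast sum_gap_sq g
  have h : A.card * (Λ * 2 ^ n) ≤ 2 ^ n * (Fintype.card (QuadPoly n) : ℝ) := by
    rw [← h2, ← nsmul_eq_mul, ← Finset.sum_const]
    calc _ ≤ ∑ f ∈ A, (gap f g : ℝ) ^ 2 := Finset.sum_le_sum fun f hf => by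
          rw [hA, Finset.mem_filter] at hf; exact hf.2.le
      _ ≤ _ := Finset.sum_le_univ_sum_of_nonneg fun f => by positivity
  rw [inv_mul_eq_div, le_div_iff₀ hΛ]
  have h2n : (0 : ℝ) < 2 ^ n := by positivity
  nlinarith

end FineGrained

/-! ### Evaluating circuits of small depth with a single ancilla. -/

namespace FineGrained

open scoped Classical Matrix

/-! # Circuits that act on the ancilla -/

theorem QCircuit.apply_append {N : ℕ} (C D : QCircuit N) (ψ : QState N) :
    QCircuit.apply (C ++ D) ψ = D.apply (C.apply ψ) := by
  simp [QCircuit.apply]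

theorem QCircuit.apply_cons {N : ℕ} (γ : QGate N) (C : QCircuit N) (ψ : QState N) :
    QCircuit.apply (γ :: C) ψ = C.apply (γ.apply ψ) := rfl

/-- The string `x` on the first `n` qubits, and `b` on the ancilla. -/
abbrev withAncilla {n : ℕ} (x : Fin n → Bool) (b : Bool) : Fin (n + 1) → Bool :=
  Fin.snoc (α := fun _ => Bool) x b

/-- Controlled by the first `n` qubits, the circuit applies the matrix `M x` to the ancilla. -/
def ActsOnAncilla {n : ℕ} (C : QCircuit (n + 1)) (M : (Fin n → Bool) → Matrix Bool Bool ℂ) : Prop :=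
  ∀ ψ x b, C.apply ψ (withAncilla x b) = ∑ c, M x b c * ψ (withAncilla x c)

theorem ActsOnAncilla.append {n : ℕ} {C D : QCircuit (n + 1)}
    {K M : (Fin n → Bool) → Matrix Bool Bool ℂ} (hC : ActsOnAncilla C K) (hD : ActsOnAncilla D M) :
    ActsOnAncilla (C ++ D) fun x => M x * K x := by
  intro ψ x b
  rw [QCircuit.apply_append, hD]
  simp only [hC ψ, Matrix.mul_apply, Fintype.sum_bool]
  ring

theorem actsOnAncilla_nil {n : ℕ} : ActsOnAncilla ([] : QCircuit (n + 1)) fun _ => 1 := by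
  intro ψ x b
  cases b <;> simp [QCircuit.apply, Matrix.one_apply]

theorem actsOnAncilla_one {n : ℕ} (M : Matrix.unitaryGroup Bool ℂ) :
    ActsOnAncilla [QGate.one (Fin.last n) M] fun _ => M.1 := by
  intro ψ x b
  simp only [QCircuit.apply, List.foldl_cons, List.foldl_nil, QGate.apply, withAncilla,
    Fin.snoc_last, Fin.update_snoc_last]

/-- The Pauli matrix `X`, or the identity. -/
def xPow (b : Bool) : Matrix Bool Bool ℂ := Matrix.of fun i j => if (i ^^ j) = b then 1 else 0

theorem xPow_mul (a b : Bool) : xPow a * xPow b = xPow (a ^^ b) := by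
  ext i j
  cases a <;> cases b <;> cases i <;> cases j <;> simp [xPow, Matrix.mul_apply]

theorem xPow_false : xPow false = 1 := by
  ext i j
  cases i <;> cases j <;> simp [xPow]

/-- The Pauli matrix `X`. -/
def pauliX : Matrix.unitaryGroup Bool ℂ :=
  ⟨xPow true, by
    rw [Matrix.mem_unitaryGroup_iff]
    ext i j
    cases i <;> cases j <;> simp [xPow, Matrix.mul_apply, Matrix.star_apply]⟩

/-- The controlled `X` matrix. -/
def controlledX : Matrix.unitaryGroup (Bool × Bool) ℂ :=
  ⟨Matrix.of fun i j => if i.1 = j.1 ∧ (i.2 ^^ j.2) = i.1 then 1 else 0, by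
    rw [Matrix.mem_unitaryGroup_iff]
    ext ⟨a, b⟩ ⟨c, d⟩
    cases a <;> cases b <;> cases c <;> cases d <;>
      simp [Matrix.mul_apply, Matrix.star_apply, Fintype.sum_prod_type]⟩

/-- A square root of `i`. -/
noncomputable def rootI : ℂ := Complex.exp (Real.pi / 4 * Complex.I)

theorem rootI_sq : rootI * rootI = Complex.I := by
  rw [rootI, ← Complex.exp_add, ← add_mul, show (Real.pi / 4 + Real.pi / 4 : ℂ) =
    Real.pi / 2 by ring,
    Complex.exp_pi_div_two_mul_I]

theorem rootI_mul_star : rootI * star rootI = 1 := by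
  have : ‖rootI‖ = 1 := by
    rw [rootI, show (Real.pi / 4 * Complex.I : ℂ) = ((Real.pi / 4 : ℝ) : ℂ) * Complex.I by
      push_cast; ring, Complex.norm_exp_ofReal_mul_I]
  rw [Complex.star_def, Complex.mul_conj, Complex.normSq_eq_norm_sq, this]
  norm_num

/-- The `T` gate. -/
noncomputable def phaseT : Matrix.unitaryGroup Bool ℂ :=
  ⟨Matrix.diagonal fun b => if b then rootI else 1, by
    rw [Matrix.mem_unitaryGroup_iff, Matrix.star_eq_conjTranspose, Matrix.diagonal_conjTranspose,
      Matrix.diagonal_mul_diagonal, ← Matrix.diagonal_one]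
    congr 1
    ext b
    cases b
    · simp
    · simpa using rootI_mul_star⟩

/-- Up to a phase, the circuit adds `p x` to the ancilla. -/
def AddsToAncilla {n : ℕ} (C : QCircuit (n + 1)) (p : (Fin n → Bool) → Bool) : Prop :=
  ∃ φ : (Fin n → Bool) → ℂ, (∀ x, ‖φ x‖ = 1) ∧ ActsOnAncilla C fun x => φ x • xPow (p x)

theorem addsToAncilla_true {n : ℕ} :
    AddsToAncilla [QGate.one (Fin.last n) pauliX] fun _ => true :=
  ⟨fun _ => 1, fun _ => norm_one, by simpa [pauliX] using actsOnAncilla_one pauliX⟩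

theorem addsToAncilla_nil {n : ℕ} :
    AddsToAncilla ([] : QCircuit (n + 1)) fun _ => false :=
  ⟨fun _ => 1, fun _ => norm_one, by simpa [xPow_false] using actsOnAncilla_nil⟩

theorem addsToAncilla_input {n : ℕ} (i : Fin n) :
    AddsToAncilla [QGate.two i.castSucc (Fin.last n) (Fin.castSucc_lt_last i).ne controlledX]
      fun x => x i := by
  refine ⟨fun _ => 1, fun _ => norm_one, fun ψ x b => ?_⟩
  simp only [QCircuit.apply, List.foldl_cons, List.foldl_nil, QGate.apply, withAncilla,
    Fin.snoc_last, Fin.snoc_castSucc, one_smul, controlledX, Matrix.of_apply, xPow]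
  have h : ∀ c d, Function.update (Function.update (withAncilla x b) i.castSucc c) (Fin.last n) d =
      withAncilla (Function.update x i c) d := by
    intro c d
    rw [withAncilla, ← Fin.snoc_update, Fin.update_snoc_last]
  simp only [h, Fintype.sum_bool]
  have hx := Function.update_eq_self i x
  rcases Bool.eq_false_or_eq_true (x i) with hxi | hxi <;> rw [hxi] at hx <;> simp [hx, hxi]

theorem AddsToAncilla.xor {n : ℕ} {C D : QCircuit (n + 1)} {p q : (Fin n → Bool) → Bool}
    (hC : AddsToAncilla C p) (hD : AddsToAncilla D q) :
    AddsToAncilla (C ++ D) fun x => p x ^^ q x := by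
  obtain ⟨φ, hφ, hC⟩ := hC
  obtain ⟨χ, hχ, hD⟩ := hD
  refine ⟨fun x => χ x * φ x, fun x => by rw [norm_mul, hφ, hχ, one_mul], ?_⟩
  have := hC.append hD
  simpa only [Matrix.smul_mul, Matrix.mul_smul, smul_smul, xPow_mul, Bool.xor_comm,
    mul_comm] using this

/-- Conjunction of two predicates. -/
noncomputable def andCircuit {n : ℕ} (C D : QCircuit (n + 1)) : QCircuit (n + 1) :=
  let W := C ++ ([.one (Fin.last n) phaseT⁻¹] ++ D ++ [.one (Fin.last n) phaseT])
  [.one (Fin.last n) hadamard] ++ (W ++ W) ++ [.one (Fin.last n) hadamard]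

theorem length_andCircuit {n : ℕ} (C D : QCircuit (n + 1)) :
    (andCircuit C D).length = 2 * (C.length + D.length) + 6 := by
  simp [andCircuit]; ring

theorem hadamard_mul_self : hadamard.1 * hadamard.1 = 1 := by
  have h : star hadamard.1 = hadamard.1 := by
    ext b c
    cases b <;> cases c <;> simp [hadamard, Matrix.star_apply]
  have := Matrix.mem_unitaryGroup_iff.1 hadamard.2
  rwa [h] at this

theorem phaseT_mul_inv : phaseT.1 * (phaseT⁻¹).1 = 1 := by
  rw [Matrix.UnitaryGroup.inv_val]
  exact Matrix.mem_unitaryGroup_iff.1 phaseT.2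

/-- The commutator of two reflections at angle `π / 4`. -/
noncomputable def quarterTurn : Matrix Bool Bool ℂ :=
  Matrix.diagonal fun b => if b then Complex.I else -Complex.I

/-- The quarter turn is `-iZ`, and conjugation by Hadamard gives `-iX`, so a conjunction has again
the form of a phase times a power of `X`. -/
theorem hadamard_conj_quarterTurn :
    hadamard.1 * (quarterTurn * hadamard.1) = (-Complex.I) • xPow true := by
  have h : ((Real.sqrt 2 : ℝ) : ℂ) * ((Real.sqrt 2 : ℝ) : ℂ) = 2 := by
    rw [← Complex.ofReal_mul, Real.mul_self_sqrt (by norm_num)]; norm_num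
  have h0 : ((Real.sqrt 2 : ℝ) : ℂ) ≠ 0 := by
    intro h0; rw [h0] at h; norm_num at h
  ext b c
  cases b <;> cases c <;> simp [hadamard, quarterTurn, xPow, Matrix.mul_apply, Matrix.diagonal_apply] <;>
    field_simp <;> first | linear_combination h | ring

/-- `X^a` and `T X^b T⁻¹` are involutions, so the square of their product is their commutator, which
is trivial if `a` or `b` is false. If both are true, the product is diagonal with the entries `ω⁻¹`
and `ω`, where `ω² = i`. -/
theorem commutator_eq (a b : Bool) :
    ((phaseT.1 * xPow b * (phaseT⁻¹).1) * xPow a) *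
        ((phaseT.1 * xPow b * (phaseT⁻¹).1) * xPow a) =
      if a && b then quarterTurn else 1 := by
  cases a
  · have : xPow b * xPow b = 1 := by rw [xPow_mul, Bool.xor_self, xPow_false]
    rw [xPow_false, mul_one]
    calc _ = phaseT.1 * xPow b * ((phaseT⁻¹).1 * phaseT.1) * xPow b * (phaseT⁻¹).1 := by
          simp only [mul_assoc]
      _ = _ := by
        rw [mul_eq_one_comm.1 phaseT_mul_inv, mul_one, mul_assoc phaseT.1, this, mul_one,
          phaseT_mul_inv]
        simp
  · cases b
    · rw [xPow_false, mul_one, phaseT_mul_inv, one_mul, xPow_mul]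
      simp [xPow_false]
    · have h1 := rootI_mul_star
      have h2 := rootI_sq
      have h3 : star rootI * star rootI = -Complex.I := by
        rw [← star_mul, h2]; simp
      ext i j
      rw [Matrix.UnitaryGroup.inv_val]
      simp only [Complex.star_def] at h1 h2 h3
      cases i <;> cases j <;>
        simp [phaseT, quarterTurn, xPow, Matrix.mul_apply, Matrix.star_apply, h2, h3]

theorem AddsToAncilla.and {n : ℕ} {C D : QCircuit (n + 1)} {p q : (Fin n → Bool) → Bool}
    (hC : AddsToAncilla C p) (hD : AddsToAncilla D q) :
    AddsToAncilla (andCircuit C D) fun x => p x && q x := by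
  obtain ⟨φ, hφ, hC⟩ := hC
  obtain ⟨χ, hχ, hD⟩ := hD
  refine ⟨fun x => (χ x * φ x) * (χ x * φ x) * if p x && q x then -Complex.I else 1,
    fun x => ?_, ?_⟩
  · simp only [norm_mul, hφ, hχ, one_mul]
    split_ifs <;> simp
  · have hW := hC.append (((actsOnAncilla_one phaseT⁻¹).append hD).append (actsOnAncilla_one phaseT))
    have := ((actsOnAncilla_one hadamard).append (hW.append hW)).append (actsOnAncilla_one hadamard)
    refine (congrArg (ActsOnAncilla _) (funext fun x => ?_)).mp this
    have hc := commutator_eq (p x) (q x)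
    simp only [Matrix.smul_mul, Matrix.mul_smul, smul_smul] at hc ⊢
    rw [← mul_assoc phaseT.1, hc]
    cases hpq : p x && q x
    · simp [hadamard_mul_self, xPow_false, mul_comm, mul_left_comm]
    · simp only [if_true]
      rw [hadamard_conj_quarterTurn]
      simp only [smul_smul]
      congr 1; ring

theorem AddsToAncilla.congr {n : ℕ} {C : QCircuit (n + 1)} {p q : (Fin n → Bool) → Bool}
    (hC : AddsToAncilla C p) (h : ∀ x, p x = q x) : AddsToAncilla C q := by
  rwa [← funext h]

/-- The circuit is unfolded into a formula: a wire is recomputed at each use. A conjunction uses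
both subcircuits twice, and a disjunction is reduced to it by De Morgan; with subcircuits of length
at most `M ≥ 1` the length is at most `4 M + 11`, so a factor `16` per level is enough. -/
theorem exists_addsToAncilla {n m : ℕ} (G : BoolGates n m) (i : Fin (n + m)) :
    ∃ C, AddsToAncilla C (fun x => G.eval x i) ∧ C.length ≤ 16 ^ G.depth i := by
  induction G with
  | nil =>
    exact ⟨_, addsToAncilla_input i, Nat.one_le_pow _ _ (by norm_num)⟩
  | @snoc m G γ ih =>
    induction i using Fin.lastCases with
    | cast i =>
      obtain ⟨C, h, hl⟩ := ih i
      refine ⟨C, h.congr fun x => ?_, hl.trans ?_⟩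
      · exact (Fin.snoc_castSucc (α := fun _ => Bool) (n := n + m) _ _ i).symm
      · exact (congrArg (16 ^ ·)
          (Fin.snoc_castSucc (α := fun _ => ℕ) (n := n + m) _ _ i).symm).le
    | last =>
      have e₁ : ∀ x, (BoolGates.snoc G γ).eval x (Fin.last (n + m)) = γ.eval (G.eval x) :=
        fun x => Fin.snoc_last (α := fun _ => Bool) (n := n + m) _ _
      have e₂ : (BoolGates.snoc G γ).depth (Fin.last (n + m)) = γ.depth G.depth :=
        Fin.snoc_last (α := fun _ => ℕ) (n := n + m) _ _
      suffices ∃ C, AddsToAncilla C (fun x => γ.eval (G.eval x)) ∧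
          C.length ≤ 16 ^ γ.depth G.depth by
        obtain ⟨C, h, hl⟩ := this
        exact ⟨C, h.congr fun x => (e₁ x).symm, hl.trans (congrArg (16 ^ ·) e₂.symm).le⟩
      cases γ with
      | const b =>
        cases b
        · exact ⟨_, addsToAncilla_nil, by simp⟩
        · exact ⟨_, addsToAncilla_true, by simp [BoolGate.depth]⟩
      | not i =>
        obtain ⟨C, h, hl⟩ := ih i
        refine ⟨_, (h.xor addsToAncilla_true).congr fun x => by simp [BoolGate.eval], ?_⟩
        have := Nat.one_le_pow (G.depth i) 16 (by norm_num)
        simp only [List.length_append, List.length_singleton, BoolGate.depth, pow_succ]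
        omega
      | and i j =>
        obtain ⟨C, h, hl⟩ := ih i
        obtain ⟨D, h', hl'⟩ := ih j
        refine ⟨_, (h.and h').congr fun x => rfl, ?_⟩
        have h₀ := Nat.one_le_pow (G.depth i ⊔ G.depth j) 16 (by norm_num)
        have h₁ := Nat.pow_le_pow_right (n := 16) (by norm_num) (le_max_left (G.depth i) (G.depth j))
        have h₂ := Nat.pow_le_pow_right (n := 16) (by norm_num) (le_max_right (G.depth i) (G.depth j))
        simp only [length_andCircuit, BoolGate.depth, pow_succ]
        omega
      | or i j =>
        obtain ⟨C, h, hl⟩ := ih i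
        obtain ⟨D, h', hl'⟩ := ih j
        refine ⟨_, (((h.xor addsToAncilla_true).and
          (h'.xor addsToAncilla_true)).xor addsToAncilla_true).congr fun x => ?_, ?_⟩
        · simp [BoolGate.eval]
        have h₀ := Nat.one_le_pow (G.depth i ⊔ G.depth j) 16 (by norm_num)
        have h₁ := Nat.pow_le_pow_right (n := 16) (by norm_num) (le_max_left (G.depth i) (G.depth j))
        have h₂ := Nat.pow_le_pow_right (n := 16) (by norm_num) (le_max_right (G.depth i) (G.depth j))
        simp only [length_andCircuit, BoolGate.depth, pow_succ, List.length_append,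
          List.length_singleton]
        omega

theorem AddsToAncilla.computesReversibly {n : ℕ} {C : QCircuit (n + 1)} {g : BoolCircuit n}
    (hC : AddsToAncilla C g.eval) : ComputesReversibly C g := by
  obtain ⟨φ, hφ, hC⟩ := hC
  intro x
  obtain ⟨θ, hθ⟩ := (Complex.norm_eq_one_iff (φ x)).1 (hφ x)
  refine ⟨θ, funext fun y => ?_⟩
  rw [hθ]
  obtain ⟨y, b, rfl⟩ : ∃ z b, y = withAncilla z b := ⟨_, _, (Fin.snoc_init_self y).symm⟩
  rw [hC]
  simp only [ket, withAncilla, Fin.snoc_inj, Fintype.sum_bool, xPow, Matrix.smul_apply,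
    Matrix.of_apply]
  by_cases h : y = x
  · subst h; cases b <;> cases g.eval y <;> simp
  · simp [h]

end FineGrained

/-! ### The amplitudes of the circuits as gaps of shifted polynomials. -/

namespace FineGrained

open scoped Classical Matrix

/-! # Outcome probabilities -/

theorem QGate.apply_add {N : ℕ} (γ : QGate N) (ψ χ : QState N) :
    γ.apply (ψ + χ) = γ.apply ψ + γ.apply χ := by
  funext y
  cases γ <;> simp only [QGate.apply, Pi.add_apply, mul_add, Finset.sum_add_distrib]

theorem QGate.apply_smul {N : ℕ} (γ : QGate N) (a : ℂ) (ψ : QState N) :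
    γ.apply (a • ψ) = a • γ.apply ψ := by
  funext y
  cases γ <;> simp only [QGate.apply, Pi.smul_apply, smul_eq_mul, Finset.mul_sum, mul_left_comm]

/-- The action of a circuit as a linear map. -/
noncomputable def QCircuit.linear {N : ℕ} (C : QCircuit N) : QState N →ₗ[ℂ] QState N where
  toFun := C.apply
  map_add' ψ χ := by
    induction C generalizing ψ χ with
    | nil => rfl
    | cons γ C ih => simp only [QCircuit.apply_cons, QGate.apply_add, ih]
  map_smul' a ψ := by
    induction C generalizing ψ with
    | nil => rfl
    | cons γ C ih => simp only [QCircuit.apply_cons, QGate.apply_smul, ih, RingHom.id_apply]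

theorem QGate.apply_inv_apply {N : ℕ} (γ : QGate N) (ψ : QState N) :
    γ.inv.apply (γ.apply ψ) = ψ := by
  funext y
  cases γ with
  | one p M =>
    have h : (M⁻¹).1 * M.1 = 1 := by
      rw [Matrix.UnitaryGroup.inv_val]; exact Matrix.mem_unitaryGroup_iff'.1 M.2
    have h' : ∀ c, ∑ b, (M⁻¹).1 (y p) b * M.1 b c = if y p = c then 1 else 0 := fun c => by
      rw [← Matrix.mul_apply, h, Matrix.one_apply]
    simp only [QGate.inv, QGate.apply, Function.update_self, Function.update_idem, Finset.mul_sum]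
    rw [Finset.sum_comm]
    simp only [← mul_assoc, ← Finset.sum_mul, h', ite_mul, one_mul, zero_mul,
      Finset.sum_ite_eq, Finset.mem_univ, if_true, Function.update_eq_self]
  | two p q hpq M =>
    have h : (M⁻¹).1 * M.1 = 1 := by
      rw [Matrix.UnitaryGroup.inv_val]; exact Matrix.mem_unitaryGroup_iff'.1 M.2
    have h' : ∀ c, ∑ b, (M⁻¹).1 (y p, y q) b * M.1 b c = if (y p, y q) = c then 1 else 0 :=
      fun c => by rw [← Matrix.mul_apply, h, Matrix.one_apply]
    have hu : ∀ b c b' c', Function.update (Function.update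
        (Function.update (Function.update y p b) q c) p b') q c' =
        Function.update (Function.update y p b') q c' := fun b c b' c' => by
      rw [Function.update_comm hpq, Function.update_idem, Function.update_comm hpq.symm,
        Function.update_idem]
    simp only [QGate.inv, QGate.apply, Function.update_self, Function.update_of_ne hpq, hu,
      ← Fintype.sum_prod_type']
    simp only [Finset.mul_sum]
    rw [Finset.sum_comm]
    simp only [← mul_assoc, ← Finset.sum_mul, h', ite_mul, one_mul, zero_mul,
      Finset.sum_ite_eq, Finset.mem_univ, if_true, Function.update_eq_self]

theorem QCircuit.apply_inv_apply {N : ℕ} (C : QCircuit N) (ψ : QState N) :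
    C.inv.apply (C.apply ψ) = ψ := by
  induction C generalizing ψ with
  | nil => rfl
  | cons γ C ih =>
    have : QCircuit.inv (γ :: C) = QCircuit.inv C ++ [γ.inv] := by simp [QCircuit.inv]
    rw [this, QCircuit.apply_append, QCircuit.apply_cons γ C, ih]
    exact γ.apply_inv_apply ψ

theorem QCircuit.length_inv {N : ℕ} (C : QCircuit N) : C.inv.length = C.length := by
  simp [QCircuit.inv]

/-- The circuit multiplies the amplitudes by the signs `(-1) ^ a`. -/
def ActsBySign {N : ℕ} (C : QCircuit N) (a : (Fin N → Bool) → ZMod 2) : Prop :=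
  ∀ ψ y, C.apply ψ y = (sign2 (a y) : ℂ) * ψ y

theorem actsBySign_nil {N : ℕ} : ActsBySign ([] : QCircuit N) fun _ => 0 := fun ψ y => by
  simp [QCircuit.apply, show sign2 0 = 1 by decide]

theorem ActsBySign.append {N : ℕ} {C D : QCircuit N} {a b : (Fin N → Bool) → ZMod 2}
    (hC : ActsBySign C a) (hD : ActsBySign D b) : ActsBySign (C ++ D) fun y => a y + b y := by
  intro ψ y
  rw [QCircuit.apply_append, hD, hC, sign2_add]
  push_cast; ring

theorem ActsBySign.flatten_ofFn {N k : ℕ} {C : Fin k → QCircuit N}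
    {a : Fin k → (Fin N → Bool) → ZMod 2} (h : ∀ i, ActsBySign (C i) (a i)) :
    ActsBySign (List.ofFn C).flatten fun y => ∑ i, a i y := by
  induction k with
  | zero => simpa using actsBySign_nil
  | succ k ih =>
    simp only [List.ofFn_succ, List.flatten_cons, Fin.sum_univ_succ]
    exact (h 0).append (ih fun i => h i.succ)

theorem actsBySign_pauliZ {N : ℕ} (p : Fin N) (b : Bool) :
    ActsBySign (if b then [QGate.one p pauliZ] else []) fun y => bit2 b * bit2 (y p) := by
  cases b
  · simpa [bit2] using actsBySign_nil
  · intro ψ y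
    have hy := Function.update_eq_self p y
    rcases Bool.eq_false_or_eq_true (y p) with h | h <;> rw [h] at hy <;>
      simp [QCircuit.apply, QGate.apply, pauliZ, bit2, h, hy, Matrix.diagonal_apply, sign2,
        ZMod.val_one]

theorem actsBySign_controlledZ {N : ℕ} {p q : Fin N} (hpq : p ≠ q) (b : Bool) :
    ActsBySign (if b then [QGate.two p q hpq controlledZ] else [])
      fun y => bit2 b * bit2 (y p) * bit2 (y q) := by
  cases b
  · simpa [bit2] using actsBySign_nil
  · intro ψ y
    have hy := Function.update_eq_self p y
    have hy' := Function.update_eq_self q y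
    rcases Bool.eq_false_or_eq_true (y p) with h | h <;>
      rcases Bool.eq_false_or_eq_true (y q) with h' | h' <;> rw [h] at hy <;> rw [h'] at hy' <;>
      simp [QCircuit.apply, QGate.apply, controlledZ, bit2, h, h', hy, hy', Matrix.diagonal_apply,
        sign2, ZMod.val_one]

theorem actsBySign_phaseLayer {n : ℕ} (f : QuadPoly n) :
    ActsBySign (phaseLayer f) fun y => f.eval fun i => y i.castSucc := by
  simp only [QuadPoly.eval, ← Finset.sum_add_distrib]
  exact .flatten_ofFn fun i => (actsBySign_pauliZ _ _).append
    (.flatten_ofFn fun j => actsBySign_controlledZ _ _)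

/-- The state `ψ ⊗ |0⟩`. -/
noncomputable def ancillaZero {n : ℕ} (ψ : QState n) : QState (n + 1) :=
  ∑ x, ψ x • ket (withAncilla x false)

theorem ancillaZero_apply {n : ℕ} (ψ : QState n) (x : Fin n → Bool) (b : Bool) :
    ancillaZero ψ (withAncilla x b) = if b then 0 else ψ x := by
  simp only [ancillaZero, Finset.sum_apply, Pi.smul_apply, ket, Fin.snoc_inj, smul_eq_mul,
    mul_ite, mul_one, mul_zero, withAncilla]
  cases b <;> simp

theorem ActsBySign.ancillaZero {n : ℕ} {C : QCircuit (n + 1)} {a : (Fin (n + 1) → Bool) → ZMod 2}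
    (hC : ActsBySign C a) (ψ : QState n) : C.apply (ancillaZero ψ) =
      FineGrained.ancillaZero fun x => (sign2 (a (withAncilla x false)) : ℂ) * ψ x := by
  funext y
  obtain ⟨y, b, rfl⟩ : ∃ z b, y = withAncilla z b := ⟨_, _, (Fin.snoc_init_self y).symm⟩
  rw [hC, ancillaZero_apply, ancillaZero_apply]
  cases b <;> simp

theorem apply_ancillaZero {n : ℕ} (C : QCircuit (n + 1)) (ψ : QState n) :
    C.apply (ancillaZero ψ) = ∑ x, ψ x • C.apply (ket (withAncilla x false)) := by
  change C.linear _ = ∑ x, ψ x • C.linear _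
  simp only [ancillaZero, map_sum, map_smul]

/-- Computing `g`, applying `Z` to the ancilla and uncomputing gives the phases `(-1) ^ g`. -/
theorem ComputesReversibly.phase {n : ℕ} {U : QCircuit (n + 1)} {g : BoolCircuit n}
    (hU : ComputesReversibly U g) (ψ : QState n) :
    QCircuit.apply (U ++ [.one (Fin.last n) pauliZ] ++ U.inv) (ancillaZero ψ) =
      ancillaZero fun x => (sign2 (bit2 (g.eval x)) : ℂ) * ψ x := by
  rw [QCircuit.apply_append, QCircuit.apply_append]
  -- The images `U|x,0⟩` are eigenvectors of `Z` on the ancilla with eigenvalue `(-1)^(g x)`. So `Z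
  -- U ψ = U ψ'`, where `ψ'` carries the signs, and the inverse circuit returns `ψ'`; the unknown
  -- phases never have to be cancelled explicitly.
  refine Eq.trans (congrArg U.inv.apply ?_) (QCircuit.apply_inv_apply U _)
  funext y
  have hZ := actsBySign_pauliZ (Fin.last n) true (U.apply (ancillaZero ψ)) y
  rw [if_pos rfl] at hZ
  rw [hZ, apply_ancillaZero, apply_ancillaZero, Finset.sum_apply, Finset.sum_apply, Finset.mul_sum]
  refine Finset.sum_congr rfl fun x _ => ?_
  obtain ⟨θ, hθ⟩ := hU x
  simp only [Pi.smul_apply, withAncilla, hθ, smul_eq_mul, ket]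
  split_ifs with h
  · rw [h, Fin.snoc_last]
    simp [bit2, mul_assoc]
  · simp

/-- A product state. -/
noncomputable def productState {n : ℕ} (v : Fin n → Bool → ℂ) : QState (n + 1) :=
  fun y => (∏ i, v i (y i.castSucc)) * if y (Fin.last n) then 0 else 1

theorem apply_one_productState {n : ℕ} (v : Fin n → Bool → ℂ) (i : Fin n)
    (M : Matrix.unitaryGroup Bool ℂ) :
    (QGate.one i.castSucc M).apply (productState v) =
      productState (Function.update v i fun b => ∑ c, M.1 b c * v i c) := by
  funext y
  have hl : Fin.last n ≠ i.castSucc := (Fin.castSucc_lt_last i).ne'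
  simp only [QGate.apply, productState, Function.update_of_ne hl, ← mul_assoc, ← Finset.sum_mul]
  congr 1
  rw [← Finset.mul_prod_erase _ _ (Finset.mem_univ i)]
  simp only [← Finset.mul_prod_erase _ _ (Finset.mem_univ i), Function.update_self]
  rw [Finset.sum_mul]
  refine Finset.sum_congr rfl fun c _ => ?_
  rw [mul_assoc]
  congr 2
  refine Finset.prod_congr rfl fun k hk => ?_
  have hk := Finset.ne_of_mem_erase hk
  rw [Function.update_of_ne hk, Function.update_of_ne (fun h => hk (Fin.castSucc_injective n h))]

/-- Gates on distinct qubits act on separate factors of a product state, each factor being changed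
once. -/
theorem apply_gates_productState {n : ℕ} (M : Matrix.unitaryGroup Bool ℂ) (l : List (Fin n))
    (hl : l.Nodup) (v : Fin n → Bool → ℂ) :
    QCircuit.apply (l.map fun i => QGate.one i.castSucc M) (productState v) =
      productState fun i b => if i ∈ l then ∑ c, M.1 b c * v i c else v i b := by
  induction l generalizing v with
  | nil => simp [QCircuit.apply]
  | cons i l ih =>
    rw [List.nodup_cons] at hl
    rw [List.map_cons, QCircuit.apply_cons, apply_one_productState, ih hl.2]
    congr 1
    funext k b
    by_cases hk : k = i
    · subst hk; simp [hl.1]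
    · simp [hk]

theorem hadamardLayer_ket {n : ℕ} (x : Fin n → Bool) :
    (hadamardLayer n).apply (ket (withAncilla x false)) =
      ancillaZero fun z => ∏ i, hadamard.1 (z i) (x i) := by
  have h : ket (withAncilla x false) = productState fun i b => if b = x i then 1 else 0 := by
    funext y
    obtain ⟨y, b, rfl⟩ : ∃ z b, y = withAncilla z b := ⟨_, _, (Fin.snoc_init_self y).symm⟩
    simp only [ket, productState, withAncilla, Fin.snoc_inj, Fin.snoc_castSucc, Fin.snoc_last,
      Finset.prod_ite_zero, Finset.mem_univ, true_implies, ← (funext_iff (f := y) (g := x))]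
    cases b <;> simp
  rw [h, hadamardLayer, List.ofFn_eq_map, apply_gates_productState _ _ (List.nodup_finRange n)]
  funext y
  obtain ⟨y, b, rfl⟩ : ∃ z b, y = withAncilla z b := ⟨_, _, (Fin.snoc_init_self y).symm⟩
  rw [ancillaZero_apply]
  simp only [productState, withAncilla, Fin.snoc_castSucc, Fin.snoc_last, List.mem_finRange,
    if_true, mul_ite, mul_one, mul_zero, Finset.sum_ite_eq', Finset.mem_univ]

theorem hadamard_apply (a b : Bool) :
    hadamard.1 a b = (sign2 (bit2 a * bit2 b) : ℂ) * ((Real.sqrt 2 : ℝ) : ℂ)⁻¹ := by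
  cases a <;> cases b <;> simp [hadamard, bit2, sign2, ZMod.val_one, div_eq_mul_inv]

theorem sign2_sum {ι : Type*} (s : Finset ι) (a : ι → ZMod 2) :
    sign2 (∑ i ∈ s, a i) = ∏ i ∈ s, sign2 (a i) := by
  induction s using Finset.induction_on with
  | empty => simp [sign2]
  | insert i s hi ih => rw [Finset.sum_insert hi, Finset.prod_insert hi, sign2_add, ih]

theorem prod_hadamard {n : ℕ} (z x : Fin n → Bool) : ∏ i, hadamard.1 (z i) (x i) =
    (sign2 (∑ i, bit2 (z i) * bit2 (x i)) : ℂ) * (((Real.sqrt 2 : ℝ) : ℂ)⁻¹) ^ n := by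
  simp only [hadamard_apply, Finset.prod_mul_distrib, sign2_sum, Int.cast_prod, Finset.prod_const,
    Finset.card_univ, Fintype.card_fin]

/-- The first layer makes the uniform superposition, the middle part multiplies by `(-1)^(f + g)`,
and the last layer sums against `(-1)^(z·x)`, which amounts to shifting the linear part of `f` by
`z`. -/
theorem iqpWith_apply {n : ℕ} {U : QCircuit (n + 1)} {g : BoolCircuit n}
    (hU : ComputesReversibly U g) (f : QuadPoly n) (z : Fin n → Bool) (b : Bool) :
    (iqpWith f U).apply (ket fun _ => false) (withAncilla z b) =
      if b then 0 else (gap (f.shift z) g : ℂ) / 2 ^ n := by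
  have h0 : (fun _ => false : Fin (n + 1) → Bool) = withAncilla (fun _ => false) false := by
    funext i
    induction i using Fin.lastCases <;> simp [withAncilla]
  have h2 : (((Real.sqrt 2 : ℝ) : ℂ)⁻¹) ^ n * (((Real.sqrt 2 : ℝ) : ℂ)⁻¹) ^ n = ((2 : ℂ) ^ n)⁻¹ := by
    rw [← mul_pow, ← mul_inv, ← Complex.ofReal_mul, Real.mul_self_sqrt (by norm_num), inv_pow]
    norm_num
  have hassoc : iqpWith f U = hadamardLayer n ++ ((U ++ [.one (Fin.last n) pauliZ] ++ U.inv) ++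
      (phaseLayer f ++ hadamardLayer n)) := by
    simp [iqpWith]
  rw [hassoc, QCircuit.apply_append, QCircuit.apply_append, QCircuit.apply_append, h0,
    hadamardLayer_ket, hU.phase, (actsBySign_phaseLayer f).ancillaZero, apply_ancillaZero,
    Finset.sum_apply]
  simp only [Pi.smul_apply, hadamardLayer_ket, ancillaZero_apply, smul_eq_mul]
  cases b
  · rw [gap_eq_sum, Int.cast_sum, Finset.sum_div]
    refine Finset.sum_congr rfl fun x _ => ?_
    simp only [prod_hadamard, withAncilla, Fin.snoc_castSucc, QuadPoly.eval_shift, sign2_add,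
      Bool.false_eq_true, if_false]
    have hz : sign2 (∑ i, bit2 (x i) * bit2 false) = 1 := by simp [bit2, sign2]
    rw [hz, div_eq_mul_inv, ← h2]
    push_cast
    ring
  · simp

theorem outcomeProb_iqpWith {n : ℕ} {U : QCircuit (n + 1)} {g : BoolCircuit n}
    (hU : ComputesReversibly U g) (f : QuadPoly n) (z : Fin n → Bool) :
    outcomeProb (iqpWith f U) z = (gap (f.shift z) g : ℝ) ^ 2 / 4 ^ n := by
  have h : ∀ b, (iqpWith f U).apply (ket fun _ => false) (Fin.snoc (α := fun _ => Bool) z b) = _ :=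
    iqpWith_apply hU f z
  simp only [outcomeProb, h, Fintype.sum_bool, if_true, Bool.false_eq_true, if_false, map_zero,
    zero_add]
  rw [show ((gap (f.shift z) g : ℂ) / 2 ^ n) = (((gap (f.shift z) g : ℝ) / 2 ^ n : ℝ) : ℂ) by
    push_cast; rfl, Complex.normSq_ofReal, ← sq, div_pow, ← pow_mul, mul_comm n, pow_mul]
  norm_num

/-! # Sizes -/

theorem length_flatten_ofFn_le {α : Type*} {k : ℕ} (l : Fin k → List α) (b : ℕ)
    (h : ∀ i, (l i).length ≤ b) : (List.ofFn l).flatten.length ≤ k * b := by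
  rw [List.length_flatten, List.map_ofFn, List.sum_ofFn]
  refine (Finset.sum_le_card_nsmul _ _ b fun i _ => h i).trans ?_
  simp

theorem length_phaseLayer_le {n : ℕ} (f : QuadPoly n) : (phaseLayer f).length ≤ n * (1 + n) := by
  refine length_flatten_ofFn_le _ _ fun i => ?_
  rw [List.length_append]
  refine Nat.add_le_add (by split_ifs <;> simp) ?_
  refine (length_flatten_ofFn_le _ 1 fun j => by split_ifs <;> simp).trans ?_
  simp [i.isLt.le]

theorem length_iqpWith_le {n : ℕ} (f : QuadPoly n) (U : QCircuit (n + 1)) :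
    (iqpWith f U).length ≤ 2 * n + 2 * U.length + 1 + n * (1 + n) := by
  have := length_phaseLayer_le f
  simp only [iqpWith, List.length_append, QCircuit.length_inv, hadamardLayer, List.length_ofFn,
    List.length_singleton]
  omega

/-- Logarithmic depth makes the unfolded length polynomial: `16 ^ (c * log n)` is at most `n ^ (4 *
c)`. -/
theorem exists_reversible_circuits {g : (n : ℕ) → BoolCircuit n} (hg : IsLogDepth g) :
    ∃ U : (n : ℕ) → QCircuit (n + 1), (∀ n, ComputesReversibly (U n) (g n)) ∧
      ∃ c : ℕ, ∀ (n : ℕ) (f : QuadPoly n), (iqpWith f (U n)).length ≤ c * (n + 1) ^ c := by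
  obtain ⟨c, hc⟩ := hg
  choose U hU hl using fun n => exists_addsToAncilla (g n).gates (g n).out
  refine ⟨U, fun n => (hU n).computesReversibly, 6 + 4 * c + 2 * 16 ^ c, fun n f => ?_⟩
  have h₁ : (U n).length ≤ 16 ^ c * (n + 1) ^ (4 * c) := by
    refine (hl n).trans ((Nat.pow_le_pow_right (by norm_num) (hc n).1).trans ?_)
    rw [pow_add, mul_comm, show (16 : ℕ) = 2 ^ 4 by norm_num, ← pow_mul 2 4 (c * _),
      show 4 * (c * Nat.log 2 n) = Nat.log 2 n * (4 * c) by ring, pow_mul 2 (Nat.log 2 n)]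
    refine Nat.mul_le_mul_left _ (Nat.pow_le_pow_left ?_ _)
    rcases Nat.eq_zero_or_pos n with rfl | hn
    · simp
    · exact (Nat.pow_log_le_self 2 hn.ne').trans n.le_succ
  have h₂ : (n + 1) ^ (4 * c) ≤ (n + 1) ^ (6 + 4 * c + 2 * 16 ^ c) :=
    Nat.pow_le_pow_right n.succ_pos (by omega)
  have h₃ : (n + 1) ^ 2 ≤ (n + 1) ^ (6 + 4 * c + 2 * 16 ^ c) :=
    Nat.pow_le_pow_right n.succ_pos (by omega)
  calc _ ≤ _ := length_iqpWith_le f (U n)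
    _ ≤ 2 * (n + 1) ^ 2 + 2 * (16 ^ c * (n + 1) ^ (4 * c)) := by nlinarith
    _ ≤ 2 * (n + 1) ^ (6 + 4 * c + 2 * 16 ^ c) +
        2 * (16 ^ c * (n + 1) ^ (6 + 4 * c + 2 * 16 ^ c)) := by gcongr
    _ = (2 + 2 * 16 ^ c) * (n + 1) ^ (6 + 4 * c + 2 * 16 ^ c) := by ring
    _ ≤ _ := Nat.mul_le_mul_right _ (by omega)

end FineGrained

/-! ### From the oracle's answers to an estimate of the squared gap. -/

namespace FineGrained

open scoped Classical

/-! # The success probability of the estimator -/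

theorem coinList_listCoins_append (a l : List Bool) : coinList a.length (listCoins (a ++ l)) = a := by
  refine List.ext_getElem (by simp) fun i h₁ h₂ => ?_
  simp [coinList, listCoins, List.getElem?_append_left h₂, h₂]

theorem dropCoins_listCoins_append (a l : List Bool) :
    dropCoins a.length (listCoins (a ++ l)) = listCoins l := by
  funext i
  simp [dropCoins, listCoins, List.getElem?_append_right]

/-- `T` is one more than the length of a longest run, the value that the search of the estimator
finds: clocks with fewer ticks can run out, those with `T` ticks cannot. -/
theorem HaltsWithin.exists_clock {S : Prog} {x : List Bool} {t : ℕ} (h : HaltsWithin ∅ 0 S x t) :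
    ∃ (T : ℕ) (τ : (ℕ → Bool) → ℕ) (y : (ℕ → Bool) → List Bool), T ≤ t + 1 ∧ HasRuns S x τ y ∧
      (∀ ω, τ ω < T) ∧ ∃ ω, T ≤ τ ω + 1 := by
  obtain ⟨τ, y, hy, hτ⟩ := h.hasRuns
  have hb : BddAbove (Set.range τ) := ⟨t, by rintro _ ⟨ω, rfl⟩; exact hτ ω⟩
  obtain ⟨ω, hω⟩ := Nat.sSup_mem (Set.range_nonempty τ) hb
  refine ⟨sSup (Set.range τ) + 1, τ, y, ?_, hy, fun ω => ?_, ω, by omega⟩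
  · rw [← hω]; exact Nat.succ_le_succ (hτ ω)
  · exact Nat.lt_succ_of_le (le_csSup hb ⟨ω, rfl⟩)

/-- The output depends on the first `T - 1` coins only, and both `t` and `T` are at least `T - 1`.
-/
theorem HasRuns.sampleProb_eq {S : Prog} {n t T : ℕ} {f : QuadPoly n} {g : BoolCircuit n}
    {τ : (ℕ → Bool) → ℕ} {y : (ℕ → Bool) → List Bool} (h : HasRuns S (encodeInput f g) τ y)
    (hT : ∀ ω, τ ω < T) (htT : T ≤ t + 1) (z : Fin n → Bool) :
    sampleProb S t f g z = bitAvg T fun l => if y (listCoins l) = List.ofFn z then 1 else 0 := by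
  have hT' : ∀ ω, τ ω ≤ T - 1 := fun ω => Nat.le_sub_one_of_lt (hT ω)
  have hF : ∀ l, (fun l => if y (listCoins l) = List.ofFn z then (1 : ℝ) else 0) (l.take (T - 1)) =
      if y (listCoins l) = List.ofFn z then 1 else 0 := fun l => by
    simp only [h.take hT' l]
  rw [sampleProb, outputProb_eq_bitAvg, bitAvg_congr_take hF (Nat.sub_le T 1),
    ← bitAvg_congr_take hF (show T - 1 ≤ t by omega)]
  refine bitAvg_congr fun l _ => ?_
  simp only [h.outputs_iff, exists_eq_left, eq_comm]

/-- The output of the estimator. -/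
theorem estimator_count (r j e : ℕ) : ∃ C : ℕ, ∀ (S : Prog) (n : ℕ) (f : QuadPoly n)
    (g : BoolCircuit n) (t B T : ℕ) (τ : (ℕ → Bool) → ℕ) (y : (ℕ → Bool) → List Bool)
    (ω : ℕ → Bool), HasRuns S (encodeInput (f.shift fun i => ω i) g) τ y → (∀ ω, τ ω < T) →
    (∃ ω, T ≤ τ ω + 1) → T ≤ t → C * ((n + 1) ^ 2 + g.encode.length + t) ≤ B →
    ∃ m k, Runs (oracle S) B (estimator r j e) (Mem.init (encodeInput f g) ω)
      (C * ((n + 1) ^ 2 + g.encode.length + t)) m ∧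
      m.stack 1 = List.replicate (n - e) false ++ binary k ∧
      (k : ℝ) = bitSum r fun σ => if ∃ γ : List Bool, γ.length = n - j ∧
        y (listCoins ((hash (coinList (r + (n + T)) (dropCoins n ω)) (γ ++ σ)
          (coinList (r + (n + T)) (dropCoins (r + (n + T) + n) ω))).take T)) =
          List.ofFn (fun i : Fin n => ω i) then 1 else 0 := by
  obtain ⟨C, hC⟩ := estimator_runs r j e
  refine ⟨C, fun S n f g t B T τ y ω hy hT hT' htT hB => ?_⟩
  have hT₁ : 1 ≤ T := by have := hT ω; omega
  have hle : C * ((n + 1) ^ 2 + g.encode.length + T) ≤ C * ((n + 1) ^ 2 + g.encode.length + t) :=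
    Nat.mul_le_mul_left _ (by omega)
  have hx : unary n ++ shiftRows f.rows ω ++ g.encode =
      encodeInput (f.shift fun i => ω i) g := by
    rw [f.shiftRows_rows]; rfl
  have hz : coinList n ω = List.ofFn fun i : Fin n => ω i :=
    List.ext_getElem (by simp) fun i h₁ h₂ => by simp [coinList]
  have h := hC (oracle S) B f.rows g.encode ω T f.rowsFrom_rows hT₁
  simp only [f.rows_length, hz, hx] at h
  obtain ⟨o, ho, m, hm, hout⟩ := h (fun o ho k _ hk => by
    rw [hy.guessItems_mem ho]
    constructor
    · rintro ⟨ω', h'⟩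
      exact h'.trans_lt (hT ω')
    · intro hlt
      obtain ⟨ω', h'⟩ := hT'
      exact ⟨ω', by omega⟩) (hle.trans hB)
  rw [f.joinRows_rows] at hm
  refine ⟨m, _, hm.mono hle, hout, ?_⟩
  rw [answerCount_eq_bitSum]
  refine bitSum_congr fun σ _ => ?_
  rw [List.nil_append, hy.seedQuery_mem ho _ _ _ _ fun ω' => by
    have := hT ω'; rw [coinList_length]; omega]
  simp only [hy.take fun ω => (hT ω).le]

/-- Here `l` stands for `2^n q` and `k / 2^κ` for its estimate. The error of the count and that of
the sampler, at most `2^n δ` each after rescaling, add up. -/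
theorem decodeNat_error {n κ k : ℕ} {u δ l G : ℝ} (hκ : κ ≤ n)
    (hk : |(k : ℝ) - 2 ^ κ * l| ≤ 2 ^ κ * δ) (hl : |2 ^ n * l - G| ≤ 2 ^ n * δ)
    (hG : 2 * δ * 2 ^ n ≤ u * G) :
    |(decodeNat (List.replicate (n - κ) false ++ binary k) : ℝ) - G| ≤ u * G := by
  rw [decodeNat_zeros, decodeNat_binary]
  have h2 : (2 : ℝ) ^ n = 2 ^ (n - κ) * 2 ^ κ := by rw [← pow_add, Nat.sub_add_cancel hκ]
  have h : |2 ^ (n - κ) * (k : ℝ) - 2 ^ n * l| ≤ 2 ^ n * δ := by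
    rw [h2, mul_assoc, mul_assoc, ← mul_sub, abs_mul, abs_of_pos (by positivity)]
    exact mul_le_mul_of_nonneg_left hk (by positivity)
  push_cast
  calc _ ≤ _ := abs_sub_le _ (2 ^ n * l) _
    _ ≤ _ := by linarith

/-- The hypothesis `hpar` is the bound of `pairAvg_count_le` at `D = 2^κ δ / 2`, with the mean
number of hits bounded by `2^κ M`. A loss of `ζ` accounts for shifts at which the sampler is
inaccurate, another one for unlucky seeds. The program does not depend on `S`. -/
theorem estimator_success {u δ ζ M : ℝ} {κ ρ : ℕ} (hκ : κ ≤ ρ) (hδ : 0 < δ)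
    (hpar : 2 ^ (2 * κ) * M ^ 2 / (2 ^ ρ * (2 ^ κ * δ / 2)) + 2 ^ κ * M / (2 ^ κ * δ / 2) ^ 2 ≤ ζ) :
    ∃ (P : Prog) (C : ℕ), ∀ (S : Prog) (n : ℕ) (f : QuadPoly n) (g : BoolCircuit n) (t B : ℕ),
      (∀ z, HaltsWithin ∅ 0 S (encodeInput (f.shift z) g) t) →
      C * ((n + 1) ^ 2 + g.encode.length + (t + 1)) = B →
      HaltsWithin (oracle S) B P (encodeInput f g) B ∧ (ρ ≤ n →
        2 * δ * 2 ^ n ≤ u * (gap f g : ℝ) ^ 2 → (gap f g : ℝ) ^ 2 + δ * 2 ^ n ≤ M * 2 ^ n →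
        ∑ z, |(gap f g : ℝ) ^ 2 / 4 ^ n - sampleProb S t (f.shift z) g z| ≤ ζ * δ →
        1 - 2 * ζ ≤ gapSuccess (oracle S) B P B u f g) := by
  obtain ⟨C, hC⟩ := estimator_count ρ (ρ - κ) κ
  refine ⟨estimator ρ (ρ - κ) κ, C + (2 * ρ + 3), fun S n f g t B hS hB => ?_⟩
  choose T τ y hT hy hτ hτ' using fun z => (hS z).exists_clock
  have hCB : C * ((n + 1) ^ 2 + g.encode.length + (t + 1)) ≤ B := by
    rw [← hB]; exact Nat.mul_le_mul_right _ (by omega)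
  have hrun := fun ω : ℕ → Bool => hC S n f g (t + 1) B (T fun i => ω i) (τ fun i => ω i)
    (y fun i => ω i) ω (hy _) (hτ _) (hτ' _) (hT _) hCB
  refine ⟨fun ω => ?_, fun hn hu hM hsum => ?_⟩
  · obtain ⟨m, k, hm, -⟩ := hrun ω
    obtain ⟨s, hs, hm⟩ := hm.mono hCB
    exact ⟨s, hs, m, hm⟩
  set G : ℝ := (gap f g : ℝ) ^ 2 with hGdef
  obtain ⟨p, hp⟩ : ∃ p : (Fin n → Bool) → List Bool → Prop, ∀ z l,
      y z (listCoins l) = List.ofFn z ↔ p z l := ⟨_, fun _ _ => Iff.rfl⟩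
  let q : (Fin n → Bool) → ℝ := fun z => bitAvg (T z) fun l => if p z l then 1 else 0
  have hq : ∀ z, sampleProb S t (f.shift z) g z = q z := fun z => by
    rw [(hy z).sampleProb_eq (hτ z) (hT z) z]
    simp only [hp, q]
  have h2n : (0 : ℝ) < 2 ^ n := by positivity
  have h2κ : (0 : ℝ) < 2 ^ κ := by positivity
  have hζ0 : 0 ≤ ζ := by
    by_contra hneg
    have : ζ * δ < 0 := mul_neg_of_neg_of_pos (not_le.1 hneg) hδ
    have h0 : 0 ≤ ∑ z, |G / 4 ^ n - sampleProb S t (f.shift z) g z| :=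
      Finset.sum_nonneg fun z _ => abs_nonneg _
    linarith
  -- Few targets have a wrong probability.
  let bad : Finset (Fin n → Bool) := Finset.univ.filter fun z => δ < |G / 2 ^ n - 2 ^ n * q z|
  have hbad : (bad.card : ℝ) ≤ ζ * 2 ^ n := by
    have h4 : (4 : ℝ) ^ n = 2 ^ n * 2 ^ n := by rw [← mul_pow]; norm_num
    have h₁ : bad.card * (δ / 2 ^ n) ≤ ζ * δ := by
      refine le_trans ?_ hsum
      rw [← nsmul_eq_mul, ← Finset.sum_const]
      refine le_trans (Finset.sum_le_sum fun z hz => ?_)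
        (Finset.sum_le_univ_sum_of_nonneg fun z => abs_nonneg _)
      have := (Finset.mem_filter.1 hz).2.le
      rw [hq, div_le_iff₀ h2n]
      refine this.trans (le_of_eq ?_)
      rw [← abs_of_pos h2n, ← abs_mul, abs_of_pos h2n, h4]
      congr 1
      field_simp
    rw [mul_div_assoc', div_le_iff₀ h2n] at h₁
    have h₂ : (bad.card : ℝ) * δ ≤ (ζ * 2 ^ n) * δ := by linarith
    exact le_of_mul_le_mul_right h₂ hδ
  -- On the others the estimate is good with high probability.
  have hnB : n ≤ B := by
    rw [← hB]; nlinarith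
  obtain ⟨R, rfl⟩ := Nat.exists_eq_add_of_le hnB
  rw [gapSuccess, outputProb_eq_bitAvg]
  set F : List Bool → ℝ := fun l => if ∃ y, |(decodeNat y : ℝ) - G| ≤ u * G ∧
    Outputs (oracle S) (n + R) (estimator ρ (ρ - κ) κ) (encodeInput f g) (listCoins l) y
    then 1 else 0 with hF
  have hF0 : ∀ l, 0 ≤ F l := fun l => by simp only [F]; split_ifs <;> norm_num
  have hgood : ∀ z, z ∉ bad → 1 - ζ ≤ bitAvg R fun l => F (List.ofFn z ++ l) := by
    intro z hz
    have hz : |G / 2 ^ n - 2 ^ n * q z| ≤ δ := by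
      by_contra h
      exact hz (Finset.mem_filter.2 ⟨Finset.mem_univ _, not_le.1 h⟩)
    have hzz : |2 ^ n * (2 ^ n * q z) - G| ≤ 2 ^ n * δ := by
      rw [abs_sub_comm, show G - 2 ^ n * (2 ^ n * q z) = 2 ^ n * (G / 2 ^ n - 2 ^ n * q z) by
        field_simp, abs_mul, abs_of_pos h2n]
      exact mul_le_mul_of_nonneg_left hz h2n.le
    have hqM : 2 ^ n * q z ≤ M := by
      have := (abs_le.1 hzz).2
      have : 2 ^ n * (2 ^ n * q z) ≤ 2 ^ n * M := by linarith
      exact le_of_mul_le_mul_left this h2n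
    have hq0 : 0 ≤ q z := by
      simp only [q]
      refine (bitAvg_const (T z) 0).ge.trans (bitAvg_mono fun l _ => ?_)
      split_ifs <;> norm_num
    set K := ρ + (n + T z) with hK
    have hKR : K + K ≤ R := by
      have := hT z
      nlinarith
    obtain ⟨R', rfl⟩ := Nat.exists_eq_add_of_le hKR
    let X : List Bool → List Bool → ℝ := fun s b => bitSum ρ fun σ =>
      if ∃ γ : List Bool, γ.length = n - (ρ - κ) ∧ p z ((hash s (γ ++ σ) b).take (T z)) then 1 else 0
    -- The index has `n + κ` bits, so the mean number of hits is `2^κ * (2^n * q z)`, bounded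
    -- independently of `n`.
    have hm : n - (ρ - κ) + ρ = n + κ := by omega
    have hD : 0 < 2 ^ κ * δ / 2 := by positivity
    have hcheb := pairAvg_count_le (T := T z) (K := K) (m := n - (ρ - κ)) (r := ρ)
      (by omega) (p z) hD
    have hfail : pairAvg K (fun s b => if 2 * (2 ^ κ * δ / 2) <
        |X s b - 2 ^ (n - (ρ - κ) + ρ) * q z| then 1 else 0) ≤ ζ := by
      refine hcheb.trans (le_trans ?_ hpar)
      have e₁ : (2 : ℝ) ^ (n - (ρ - κ) + ρ) * q z = 2 ^ κ * (2 ^ n * q z) := by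
        rw [hm, pow_add]; ring
      have e₂ : (2 : ℝ) ^ ρ * (2 ^ (n - (ρ - κ)) * q z) ^ 2 =
          2 ^ (2 * κ) * (2 ^ n * q z) ^ 2 / 2 ^ ρ := by
        rw [eq_div_iff (by positivity)]
        calc _ = (2 ^ (n - (ρ - κ) + ρ) * q z) ^ 2 := by rw [pow_add]; ring
          _ = _ := by rw [e₁]; ring
      change 2 ^ ρ * (2 ^ (n - (ρ - κ)) * q z) ^ 2 / _ + 2 ^ (n - (ρ - κ) + ρ) * q z / _ ≤ _
      rw [e₁, e₂, div_div]
      have : 0 ≤ 2 ^ n * q z := by positivity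
      gcongr
    have hpt : ∀ s b c, s.length = K → b.length = K →
        1 + (-1) * (if 2 * (2 ^ κ * δ / 2) < |X s b - 2 ^ (n - (ρ - κ) + ρ) * q z| then 1 else 0) ≤
          F (List.ofFn z ++ (s ++ (b ++ c))) := by
      intro s b c hs hb
      split_ifs with h
      · have := hF0 (List.ofFn z ++ (s ++ (b ++ c))); linarith
      rw [mul_zero, add_zero]
      obtain ⟨m, k, ⟨t', -, hm'⟩, hout, hk⟩ := hrun (listCoins (List.ofFn z ++ (s ++ (b ++ c))))
      have ez : (fun i : Fin n => listCoins (List.ofFn z ++ (s ++ (b ++ c))) i) = z := by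
        funext i
        simp [listCoins, List.getElem?_append_left]
      have e₁ : dropCoins n (listCoins (List.ofFn z ++ (s ++ (b ++ c)))) =
          listCoins (s ++ (b ++ c)) := by
        simpa using dropCoins_listCoins_append (List.ofFn z) (s ++ (b ++ c))
      have e₂ : dropCoins (K + n) (listCoins (List.ofFn z ++ (s ++ (b ++ c)))) =
          listCoins (b ++ c) := by
        rw [← dropCoins_dropCoins, e₁, ← hs]; exact dropCoins_listCoins_append _ _
      have e₃ : coinList K (listCoins (s ++ (b ++ c))) = s := by
        rw [← hs]; exact coinList_listCoins_append _ _
      have e₄ : coinList K (listCoins (b ++ c)) = b := by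
        rw [← hb]; exact coinList_listCoins_append _ _
      simp only [ez, ← hK, e₁, e₂, e₃, e₄, hp] at hk
      refine (if_pos ⟨_, ?_, t', m, hm', hout⟩).ge
      refine decodeNat_error (hκ.trans hn) (l := 2 ^ n * q z) (δ := δ) ?_ hzz hu
      rw [hk]
      have := not_lt.1 h
      rw [hm, pow_add] at this
      rw [show (2 : ℝ) ^ κ * (2 ^ n * q z) = 2 ^ n * 2 ^ κ * q z by ring]
      exact this.trans (le_of_eq (by ring))
    calc 1 - ζ ≤ 1 + (-1) * pairAvg K (fun s b => if 2 * (2 ^ κ * δ / 2) <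
          |X s b - 2 ^ (n - (ρ - κ) + ρ) * q z| then 1 else 0) := by linarith
      _ = pairAvg K (fun s b => 1 + (-1) * if 2 * (2 ^ κ * δ / 2) <
          |X s b - 2 ^ (n - (ρ - κ) + ρ) * q z| then 1 else 0) := by
        rw [pairAvg_add, pairAvg_mul_left, pairAvg_const]
      _ ≤ _ := by
        rw [add_assoc, bitAvg_add]
        refine bitAvg_mono fun s hs => ?_
        rw [bitAvg_add K]
        refine bitAvg_mono fun b hb => ?_
        exact (bitAvg_const R' _).ge.trans (bitAvg_mono fun c _ => hpt s b c hs hb)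
  -- The first `n` coins are the shift; its bad values are discarded.
  rw [bitAvg_add, bitAvg, le_div_iff₀ h2n, bitSum_eq_sum]
  have hcard : (badᶜ.card : ℝ) = 2 ^ n - bad.card := by
    rw [Finset.card_compl, Nat.cast_sub (Finset.card_le_univ _)]; simp
  calc (1 - 2 * ζ) * 2 ^ n ≤ badᶜ.card * (1 - ζ) := by rw [hcard]; nlinarith
    _ ≤ ∑ z ∈ badᶜ, bitAvg R fun l => F (List.ofFn z ++ l) := by
      rw [← nsmul_eq_mul]
      exact Finset.card_nsmul_le_sum _ _ _ fun z hz => hgood z (Finset.mem_compl.1 hz)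
    _ ≤ _ := Finset.sum_le_univ_sum_of_nonneg fun z => by
      rw [← bitAvg_const R 0]
      exact bitAvg_mono fun l _ => hF0 _

end FineGrained

/-! ### Growth of the inputs and choice of the constants. -/

namespace FineGrained

open scoped Classical

/-! # Growth -/

theorem BoolGate.length_encode_le {k : ℕ} (γ : BoolGate k) : γ.encode.length ≤ 2 * k + 3 := by
  cases γ with
  | const b => simp [BoolGate.encode]
  | not i => simp [BoolGate.encode, unary]; omega
  | and i j => simp [BoolGate.encode, unary]; omega
  | or i j => simp [BoolGate.encode, unary]; omega

theorem BoolGates.length_encode_le {n m : ℕ} (G : BoolGates n m) :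
    G.encode.length ≤ m * (2 * (n + m) + 4) := by
  induction G with
  | nil => simp [BoolGates.encode]
  | @snoc m G γ ih =>
    have := γ.length_encode_le
    simp only [BoolGates.encode, List.length_append, List.length_cons]
    nlinarith

theorem BoolCircuit.length_encode_le {n : ℕ} (g : BoolCircuit n) :
    g.encode.length ≤ (g.size + 1) * (2 * (n + g.size) + 4) := by
  have := g.gates.length_encode_le
  have := g.out.isLt
  simp only [BoolCircuit.encode, unary, List.length_append, List.length_cons, List.length_replicate,
    List.length_nil]
  nlinarith

theorem IsLogDepth.length_encode_le {g : (n : ℕ) → BoolCircuit n} (hg : IsLogDepth g) :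
    ∃ c k : ℕ, ∀ n, (g n).encode.length ≤ c * (n + 1) ^ k := by
  obtain ⟨c, hc⟩ := hg
  refine ⟨(2 * c + 1) * (4 * c + 6), c + (c + 1), fun n => ?_⟩
  have hX : 1 ≤ (n + 1) ^ c := Nat.one_le_pow _ _ n.succ_pos
  have hs : (g n).size ≤ 2 * c * (n + 1) ^ c := by
    have := Nat.mul_le_mul_left c (Nat.pow_le_pow_left n.le_succ c)
    have := (hc n).2
    nlinarith
  calc _ ≤ _ := (g n).length_encode_le
    _ ≤ ((2 * c + 1) * (n + 1) ^ c) * ((4 * c + 6) * ((n + 1) ^ c * (n + 1))) := by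
      refine Nat.mul_le_mul (by nlinarith) ?_
      have h₁ : n + 1 ≤ (n + 1) ^ c * (n + 1) := Nat.le_mul_of_pos_left _ hX
      have h₂ : 2 * c * (n + 1) ^ c ≤ 2 * c * ((n + 1) ^ c * (n + 1)) :=
        Nat.mul_le_mul_left _ (Nat.le_mul_of_pos_right _ n.succ_pos)
      nlinarith
    _ = _ := by rw [pow_add, pow_succ (n + 1) c]; ring

/-- Query lengths must be `O(2^(an))` without a polynomial factor, so the polynomial parts of the
queries have to be absorbed; this uses `0 < a`. -/
theorem exists_pow_le_exp (k : ℕ) {a : ℝ} (ha : 0 < a) :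
    ∃ D : ℝ, ∀ n : ℕ, ((n : ℝ) + 1) ^ k ≤ D * (2 : ℝ) ^ (a * n) := by
  have hr : 1 < (2 : ℝ) ^ a := Real.one_lt_rpow (by norm_num) ha
  obtain ⟨b, hb⟩ := (tendsto_pow_const_div_const_pow_of_one_lt k hr).bddAbove_range
  refine ⟨b * 2 ^ a, fun n => ?_⟩
  have := hb ⟨n + 1, rfl⟩
  simp only [] at this
  rw [div_le_iff₀ (by positivity)] at this
  rw [Real.rpow_mul (by norm_num), Real.rpow_natCast, mul_assoc, ← pow_succ']
  exact_mod_cast this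

theorem exists_estimator_parameters {δ ζ : ℝ} (M : ℝ) (hδ : 0 < δ) (hζ : 0 < ζ) : ∃ κ ρ : ℕ, κ ≤ ρ ∧
    2 ^ (2 * κ) * M ^ 2 / (2 ^ ρ * (2 ^ κ * δ / 2)) + 2 ^ κ * M / (2 ^ κ * δ / 2) ^ 2 ≤ ζ := by
  -- First `κ` makes the variance term at most `ζ / 2`, then `ρ` does so for the collision term,
  -- which grows with `κ`. The prefix length is `κ + ρ`, so that it is at least `κ`.
  obtain ⟨κ, hκ⟩ := pow_unbounded_of_one_lt (8 * M / (δ ^ 2 * ζ)) (one_lt_two (α := ℝ))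
  obtain ⟨ρ, hρ⟩ := pow_unbounded_of_one_lt (4 * 2 ^ κ * M ^ 2 / (δ * ζ)) (one_lt_two (α := ℝ))
  have hρ' : 4 * 2 ^ κ * M ^ 2 / (δ * ζ) ≤ 2 ^ (κ + ρ) :=
    hρ.le.trans (pow_le_pow_right₀ one_le_two (Nat.le_add_left _ _))
  refine ⟨κ, κ + ρ, Nat.le_add_right _ _, ?_⟩
  have h2 : (0 : ℝ) < 2 ^ κ := by positivity
  rw [div_le_iff₀ (by positivity)] at hρ'
  rw [div_lt_iff₀ (by positivity)] at hκ
  have h₁ : 2 ^ (2 * κ) * M ^ 2 / (2 ^ (κ + ρ) * (2 ^ κ * δ / 2)) ≤ ζ / 2 := by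
    rw [div_le_iff₀ (by positivity), two_mul, pow_add]
    have := mul_le_mul_of_nonneg_left hρ' h2.le
    linarith
  have h₃ : 2 ^ κ * M / (2 ^ κ * δ / 2) ^ 2 ≤ ζ / 2 := by
    rw [div_le_iff₀ (by positivity)]
    have := mul_le_mul_of_nonneg_left hκ.le h2.le
    linarith
  linarith

/-- An average over all polynomials may be taken over the shifted ones. -/
theorem sum_shift {n : ℕ} (F : QuadPoly n → (Fin n → Bool) → ℝ) :
    ∑ f : QuadPoly n, ∑ z, F (f.shift z) z = ∑ f : QuadPoly n, ∑ z, F f z := by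
  rw [Finset.sum_comm]
  refine (Finset.sum_congr rfl fun z _ => ?_).trans Finset.sum_comm
  exact Equiv.sum_comp (QuadPoly.shift_involutive z).toPerm fun f => F f z

end FineGrained

/-! ### The reduction from estimating gaps to sampling. -/

theorem theorem2 (u v w : ℝ) (hu : 0 < u) (hv₀ : 0 < v) (hv : v < 1 / 3)
    (hw₀ : 0 < w) (hw : w < 1) :
    ∃ ε : ℝ, 0 < ε ∧
      ∀ (a : ℝ), 0 < a → ∀ g : (n : ℕ) → BoolCircuit n, IsLogDepth g → GapHard u v w a g →
        ∃ U : (n : ℕ) → QCircuit (n + 1),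
          (∀ n : ℕ, ComputesReversibly (U n) (g n)) ∧
          (∃ c : ℕ, ∀ (n : ℕ) (f : QuadPoly n),
            (iqpWith f (U n)).length ≤ c * (n + 1) ^ c) ∧
          SamplingHard a ε g (fun n f => iqpWith f (U n)) := by
  classical
  -- A quarter of the room below `1/3`: anticoncentration at `θ = 3η` costs a fraction of at most
  -- `2η`, and the two exceptional sets cost `η` each. With `ζ = (1 - w) / 2` the success
  -- probability `1 - 2ζ` is `w`.
  obtain ⟨η, hη⟩ : ∃ η : ℝ, η = (1 / 3 - v) / 4 := ⟨_, rfl⟩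
  obtain ⟨ζ, hζ⟩ : ∃ ζ : ℝ, ζ = (1 - w) / 2 := ⟨_, rfl⟩
  have hη0 : 0 < η := by rw [hη]; linarith
  have hζ0 : 0 < ζ := by rw [hζ]; linarith
  -- The last condition makes the additive error `2δ · 2^n` at most `u · gap²` when `gap² ≥ 3η ·
  -- 2^n`; `δ ≤ 1` gives the bound `M = η⁻¹ + 1`.
  obtain ⟨δ, hδ0, hδ1, hδu⟩ : ∃ δ : ℝ, 0 < δ ∧ δ ≤ 1 ∧ 2 * δ ≤ u * (3 * η) :=
    ⟨min 1 (u * (3 * η) / 2), lt_min one_pos (by positivity), min_le_left _ _, by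
      have := min_le_right 1 (u * (3 * η) / 2); linarith⟩
  obtain ⟨κ, ρ, hκ, hpar⟩ := exists_estimator_parameters (η⁻¹ + 1) hδ0 hζ0
  obtain ⟨P, C, hP⟩ := estimator_success (u := u) hκ hδ0 hpar
  refine ⟨ζ * η * δ, by positivity, fun a ha g hg hhard => ?_⟩
  obtain ⟨U, hU, hlen⟩ := exists_reversible_circuits hg
  refine ⟨U, hU, hlen, fun S T ⟨CS, hT⟩ hS => ?_⟩
  -- One bound for the running time, the query length and the number of coins of the estimator.
  let B : ℕ → ℕ := fun n => C * ((n + 1) ^ 2 + (g n).encode.length + (T n + 1))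
  have hB : ∃ D : ℝ, ∀ n : ℕ, (B n : ℝ) ≤ D * (2 : ℝ) ^ (a * n) := by
    obtain ⟨c, k, hk⟩ := hg.length_encode_le
    obtain ⟨D₁, h₁⟩ := exists_pow_le_exp 2 ha
    obtain ⟨D₂, h₂⟩ := exists_pow_le_exp k ha
    refine ⟨C * (D₁ + c * D₂ + (CS * 2 ^ a + 1)), fun n => ?_⟩
    have h₃ : ((g n).encode.length : ℝ) ≤ c * ((n : ℝ) + 1) ^ k := by exact_mod_cast hk n
    have h₄ := mul_le_mul_of_nonneg_left (h₂ n) (Nat.cast_nonneg (α := ℝ) c)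
    have h₅ : (1 : ℝ) ≤ 2 ^ (a * n) := Real.one_le_rpow (by norm_num) (by positivity)
    have h₆ := hT n
    rw [mul_add, mul_one, Real.rpow_add (by norm_num)] at h₆
    simp only [B]
    push_cast
    rw [mul_assoc]
    refine mul_le_mul_of_nonneg_left ?_ (Nat.cast_nonneg _)
    linarith [h₁ n]
  have hsub : ∀ n (f : QuadPoly n), _ := fun n f =>
    hP S n f (g n) (T n) (B n) (fun z => hS n (f.shift z)) rfl
  obtain ⟨n₀, hn₀⟩ := hhard (oracle S) (oracle_mem S) P B B
    (by
      obtain ⟨D, hD⟩ := hB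
      exact ⟨D, 0, fun n => by simpa using hD n⟩) hB (fun n f => (hsub n f).1)
  refine ⟨max n₀ ρ, fun n hn => ?_⟩
  by_contra! hall
  refine hn₀ n ((le_max_left _ _).trans_lt hn) ?_
  have hρn : ρ ≤ n := ((le_max_right _ _).trans_lt hn).le
  let N : ℝ := Fintype.card (QuadPoly n)
  let d : QuadPoly n → ℝ := fun f =>
    ∑ z, |(gap f (g n) : ℝ) ^ 2 / 4 ^ n - sampleProb S (T n) (f.shift z) (g n) z|
  -- The same gap is compared with the outcome `z` for `f.shift z`. Summing over all `f` and
  -- reindexing replaces this by the sampling errors of the unshifted polynomials, each at most `ε`.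
  have hd : ∑ f, d f ≤ N * (ζ * η * δ) := by
    have h : ∀ (f : QuadPoly n) z, (gap f (g n) : ℝ) ^ 2 / 4 ^ n =
        outcomeProb (iqpWith (f.shift z) (U n)) z := fun f z => by
      rw [outcomeProb_iqpWith (hU n)]
      congr 4
      exact (QuadPoly.shift_involutive z f).symm
    simp only [d]
    calc _ = ∑ f : QuadPoly n, ∑ z, |outcomeProb (iqpWith (f.shift z) (U n)) z -
          sampleProb S (T n) (f.shift z) (g n) z| :=
          Finset.sum_congr rfl fun f _ => Finset.sum_congr rfl fun z _ => by rw [← h]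
      _ = _ := sum_shift fun f z => |outcomeProb (iqpWith f (U n)) z -
          sampleProb S (T n) f (g n) z|
      _ ≤ ∑ _f : QuadPoly n, ζ * η * δ := Finset.sum_le_sum fun f _ => hall f
      _ = _ := by rw [Finset.sum_const, nsmul_eq_mul, Finset.card_univ]
  let A₁ := Finset.univ.filter fun f : QuadPoly n => 3 * η * 2 ^ n ≤ (gap f (g n) : ℝ) ^ 2
  let A₂ := Finset.univ.filter fun f : QuadPoly n => η⁻¹ * 2 ^ n < (gap f (g n) : ℝ) ^ 2
  let A₃ := Finset.univ.filter fun f : QuadPoly n => ζ * δ < d f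
  have h₁ : (1 - 3 * η) ^ 2 / 3 * N ≤ A₁.card :=
    gap_anticoncentration (g n) (by positivity) (by rw [hη]; linarith)
  have h₂ : (A₂.card : ℝ) ≤ η * N := by
    have := gap_markov (g n) (inv_pos.2 hη0)
    rwa [inv_inv] at this
  have h₃ : (A₃.card : ℝ) ≤ η * N := by
    have : A₃.card * (ζ * δ) ≤ (η * N) * (ζ * δ) := by
      rw [← nsmul_eq_mul, ← Finset.sum_const]
      calc _ ≤ ∑ f ∈ A₃, d f := Finset.sum_le_sum fun f hf => (Finset.mem_filter.1 hf).2.le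
        _ ≤ ∑ f, d f := Finset.sum_le_univ_sum_of_nonneg fun f =>
          Finset.sum_nonneg fun z _ => abs_nonneg _
        _ ≤ _ := by linarith
    exact le_of_mul_le_mul_right this (by positivity)
  rw [Fintype.card_subtype]
  set A := Finset.univ.filter fun f : QuadPoly n =>
    w ≤ gapSuccess (oracle S) (B n) P (B n) u f (g n) with hA
  -- If the gap is not too small, not too large, and the sampler is accurate on average over the
  -- shifts, the estimator succeeds.
  have hcover : A₁ ⊆ A ∪ A₂ ∪ A₃ := by
    intro f hf
    by_contra hnot
    simp only [Finset.mem_union, not_or] at hnot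
    obtain ⟨⟨hfA, hf₂⟩, hf₃⟩ := hnot
    have hf₁ := (Finset.mem_filter.1 hf).2
    have hf₂ : (gap f (g n) : ℝ) ^ 2 ≤ η⁻¹ * 2 ^ n := by
      simpa [A₂] using hf₂
    have hf₃ : d f ≤ ζ * δ := by simpa [A₃] using hf₃
    refine hfA (Finset.mem_filter.2 ⟨Finset.mem_univ _, ?_⟩)
    have h2n : (0 : ℝ) < 2 ^ n := by positivity
    have := (hsub n f).2 hρn (by nlinarith) (by nlinarith) hf₃
    rw [hζ] at this
    linarith
  have hcard : (A₁.card : ℝ) ≤ A.card + A₂.card + A₃.card := by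
    exact_mod_cast (Finset.card_le_card hcover).trans
      ((Finset.card_union_le _ _).trans (Nat.add_le_add_right (Finset.card_union_le _ _) _))
  have hN : 0 ≤ N := Nat.cast_nonneg _
  have hv' : v = 1 / 3 - 4 * η := by rw [hη]; ring
  change v * N ≤ A.card
  rw [hv']
  -- `(1 - 3η)² / 3 - 2η = 1/3 - 4η + 3η²`, which is at least `v`.
  nlinarith [mul_nonneg (sq_nonneg η) hN]
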